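/- **Setting.** All terms are taken up to renaming of bound variables. *Indices.* Dimensions are $d ::= x \mid n \mid (+\ d\dots)$ and shapes are $\iota ::= x \mid (\mathrm{Shp}\ d\dots) \mid (\mathbin{+\!\!+}\ \iota\dots)$; an index is a dimension or a shape. Two indices are equal, $\iota\equiv\iota'$, if they denote the same number (for shapes: the same element of the free monoid on $\mathbb N$) for all values of their variables. *Types.* $\tau ::= x \mid B \mid (\to(\tau\dots)\,\tau) \mid (\forall((x\,k)\dots)\,\tau) \mid (\Pi((x\,\gamma)\dots)\,\tau) \mid (\Sigma((x\,\gamma)\dots)\,\tau) \mid (\mathrm{Arr}\ \tau\ \iota)$, with $k$ one of the kinds Atom, Array and $\gamma$ one of the sorts Dim, Shape. $(\mathrm{Arr}\ \tau\ \iota)$ has kind Array when $\tau$ has kind Atom; base, function, $\forall$, $\Pi$ and $\Sigma$ types have kind Atom, and their components (inputs, output, body) must have kind Array. Type equivalence $\cong$ is the congruence generated by equality of indices. *Explicit Remora.* Expressions are variables, $(\mathrm{array}\ (n\dots)\ a\dots)$, $(\mathrm{frame}\ (n\dots)\ e\dots)$, $(e_f\ e\dots)$, $(\mathrm{t\text{-}app}\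 e\ \tau\dots)$, $(\mathrm{i\text{-}app}\ e\ \iota\dots)$ and $(\mathrm{unbox}\ (x_i\dots x_e\ e_s)\ e_b)$; atoms are base values, primitive operators, $(\lambda((x\,\tau)\dots)\,e)$, $(\mathrm{T}\lambda((x\,k)\dots)\,v)$, $(\mathrm{I}\lambda((x\,\gamma)\dots)\,v)$ and $(\mathrm{box}\ \iota\dots\ e\ \tau)$. Every expression and atom is tagged with its type, and an unbox form also with the type of its body, which does not mention the $x_i$. Values $v$ are array literals all of whose boxes contain values. The typing rules are as follows, with the tag of each node equivalent to the type given and with a conversion rule for $\cong$. An array literal with $\prod n$ atoms of type $\tau$ has type $(\mathrm{Arr}\ \tau\ (\mathrm{Shp}\ n\dots))$. A frame of $\prod n$ cells of type $(\mathrm{Arr}\ \tau\ \iota)$ has type $(\mathrm{Arr}\ \tau\ (\mathbin{+\!\!+}(\mathrm{Shp}\ n\dots)\ \iota))$. If $e_f:(\mathrm{Arr}\ (\to((\mathrm{Arr}\ \tau_i\ \iota_i)\dots)(\mathrm{Arr}\ \tau_o\ \iota_o))\ \iota_f)$, each argument has type $(\mathrm{Arr}\ \tau_i\ (\mathbin{+\!\!+}\iota_a\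 \iota_i))$, and $\iota_p$ is the largest of $\iota_f,\iota_a\dots$ in the prefix order, then the application has type $(\mathrm{Arr}\ \tau_o\ (\mathbin{+\!\!+}\iota_p\ \iota_o))$. A type or index application of an array with frame $\iota_f$ of abstractions whose body has type $(\mathrm{Arr}\ \tau\ \iota)$ has type $(\mathrm{Arr}\ \tau'\ (\mathbin{+\!\!+}\iota_f\ \iota'))$, where $\tau',\iota'$ are the instances of $\tau,\iota$ at the arguments. If $e_s:(\mathrm{Arr}\ (\Sigma((x\,\gamma)\dots)\,\tau_s)\ \iota_s)$ and $e_b:(\mathrm{Arr}\ \tau_b\ \iota_b)$, this type not mentioning the $x_i$, where $e_b$ is typed with $x_i:\gamma$ and $x_e:\tau_s$, then the unbox form has type $(\mathrm{Arr}\ \tau_b\ (\mathbin{+\!\!+}\iota_s\ \iota_b))$. Variables, base values, operators (with closed types given by a signature), abstractions and boxes are typed as usual. *Explicit steps* $e\mapsto e'$. Evaluation is left-to-right and call-by-value in the contexts: content of a box in an array, cells of a frame, function and then arguments of an application, function of a type or index application, scrutinee of an unbox form. In an application of an array of functions to array values, each argument's dimensions split into a frame and the dimensions of the input type of the function; the principal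 frame is the largest frame in the prefix order. - *lift*: if the frames are not all equal, replicate the cells of function and arguments so that all frames become the principal one. - *map*: if all frames equal $(n\dots)\ne()$, step to the frame $(n\dots)$ of the cell-wise applications. - $\beta$, $\delta$: if all frames are $()$, substitute into the $\lambda$ or apply the operator's partial meaning. - $t\beta$, $i\beta$: type/index application of an array $(n\dots)$ of abstractions steps to the frame $(n\dots)$ of the instantiated bodies. - *collapse*: a frame of array literals becomes the array of all their atoms, its dimensions being read from the type tag when there are no cells. - *unbox*: unboxing an array $(n\dots)$ of boxes steps to the frame $(n\dots)$ of the bodies instantiated with the contents. *Erased Remora* has no types. Its indices are taken up to $\equiv$. Its expressions are variables, $(\mathrm{array}\ (n\dots)\ \hat a\dots)$, $(\mathrm{frame}\ \iota\ \hat e\dots)$ with $\iota$ the shape of the whole result, $(\hat e_f\ (\hat e\ \iota)\dots\ \iota_r)$ with the expected cell shape of each argument and the result shape, $(\mathrm{i\text{-}app}\ \hat e\ \iota\dots\ \iota_r)$ and $(\mathrm{unbox}\ (x_i\dots x_e\ \hat e_s)\ \hat e_b\ \iota_b)$; its atoms are base values, operators, $(\lambda(x\dots)\hat e)$, $(\mathrm{I}\lambda(x\dots)\hat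 v)$ and $(\mathrm{box}\ \iota\dots\ \hat e)$. Its steps are the same rules without $t\beta$, with these shape annotations in place of the type tags; unboxing an array with dimensions $(n\dots)$ yields a frame with shape $(\mathbin{+\!\!+}(\mathrm{Shp}\ n\dots)\ \iota_b)$. *Erasure.* $\mathcal T[\![x]\!]=x$, $\mathcal T[\![(\mathrm{Arr}\ \tau\ \iota)]\!]=\iota$, and $\mathcal T[\![\tau]\!]=(\mathrm{Shp})$ for every other type. $\mathcal E$ maps explicit to erased expressions homomorphically. It replaces the tag $\tau$ of a frame or application form by $\mathcal T[\![\tau]\!]$, annotates the arguments of an application with $\mathcal T$ of the input types of the function, annotates an unbox form with $\mathcal T$ of the type of its body, turns $\mathrm{T}\lambda$ into $\mathrm{I}\lambda$ and $(\mathrm{t\text{-}app}\ e\ \tau\dots)$ into the i-app with indices $\mathcal T[\![\tau]\!]\dots$, and drops all other types. The language is given by arbitrary sets of base types, base values and operators, a base type for each base value, a closed Atom-kinded type for each operator, and partial meanings $\delta$ of the operators on explicit and on erased argument values such that, on arguments of the operator's input types, results are values of its output type, and $\delta$ commutes with erasure (including definedness). **Theorem.** Let $S$ be the disjoint union of the set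 of closed well-typed explicit expressions and the set of their erasures, with the transitions $\mapsto$ of the two languages, and let $\cong_{\mathcal E}$ be the equivalence closure on $S$ of the relation $\{(e,\mathcal E[\![e]\!])\}$, $e$ ranging over the closed well-typed explicit expressions. Then $\cong_{\mathcal E}$ is a bisimulation. That is, for all $s,w\in S$ with $s\cong_{\mathcal E}w$, either there are $u,v\in S$ with $s\mapsto u$, $w\mapsto v$ and $u\cong_{\mathcal E}v$, or neither $s$ nor $w$ has a transition. Moreover, whenever $s\mapsto u$, then $u\in S$ and there is $v\in S$ with $w\mapsto v$ and $u\cong_{\mathcal E}v$; and whenever $w\mapsto v$, then $v\in S$ and there is $u\in S$ with $s\mapsto u$ and $u\cong_{\mathcal E}v$. -/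

import Mathlib

namespace Remora

/-! Binding is represented by de Bruijn indices, so terms are taken up to renaming of bound
variables.  There are two namespaces: static variables (index variables and type variables) and
term variables.  A form that binds a list of `k` variables at once makes the indices `0, …, k-1`
refer to these variables, in the order of the list. -/

/-! ### Type indices -/

/-- The sorts of type indices. -/
inductive IxSort where
  | dim
  | shape

/-- Dimensions: variables, natural numbers, sums. -/
inductive Dim where
  | var (i : ℕ)
  | nat (n : ℕ)
  | add (ds : List Dim)

/-- Shapes: variables, `(Shp d …)`, and appends `(++ s …)`. -/
inductive Shp where
  | var (i : ℕ)
  | shp (ds : List Dim)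
  | app (ss : List Shp)

/-- A type index of either sort. -/
inductive Idx where
  | dim (d : Dim)
  | shape (s : Shp)

/-- The literal shape `(Shp n …)`. -/
def lit (ns : List ℕ) : Shp := .shp (ns.map .nat)

/-- The action of a renaming under `k` binders. -/
def upRen (k : ℕ) (r : ℕ → ℕ) (i : ℕ) : ℕ := if i < k then i else r (i - k) + k

mutual
def Dim.rename (r : ℕ → ℕ) : Dim → Dim
  | .var i => .var (r i)
  | .nat n => .nat n
  | .add ds => .add (Dim.renames r ds)
def Dim.renames (r : ℕ → ℕ) : List Dim → List Dim
  | [] => []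
  | d :: ds => d.rename r :: Dim.renames r ds
end

mutual
def Shp.rename (r : ℕ → ℕ) : Shp → Shp
  | .var i => .var (r i)
  | .shp ds => .shp (Dim.renames r ds)
  | .app ss => .app (Shp.renames r ss)
def Shp.renames (r : ℕ → ℕ) : List Shp → List Shp
  | [] => []
  | s :: ss => s.rename r :: Shp.renames r ss
end

def Idx.rename (r : ℕ → ℕ) : Idx → Idx
  | .dim d => .dim (d.rename r)
  | .shape s => .shape (s.rename r)

mutual
def Dim.subst (σ : ℕ → Dim) : Dim → Dim
  | .var i => σ i
  | .nat n => .nat n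
  | .add ds => .add (Dim.substs σ ds)
def Dim.substs (σ : ℕ → Dim) : List Dim → List Dim
  | [] => []
  | d :: ds => d.subst σ :: Dim.substs σ ds
end

mutual
def Shp.subst (σ : ℕ → Dim) (θ : ℕ → Shp) : Shp → Shp
  | .var i => θ i
  | .shp ds => .shp (Dim.substs σ ds)
  | .app ss => .app (Shp.substs σ θ ss)
def Shp.substs (σ : ℕ → Dim) (θ : ℕ → Shp) : List Shp → List Shp
  | [] => []
  | s :: ss => s.subst σ θ :: Shp.substs σ θ ss
end

def Idx.subst (σ : ℕ → Dim) (θ : ℕ → Shp) : Idx → Idx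
  | .dim d => .dim (d.subst σ)
  | .shape s => .shape (s.subst σ θ)

mutual
/-- The natural number denoted by a dimension, given the values of the variables. -/
def Dim.eval (v : ℕ → ℕ) : Dim → ℕ
  | .var i => v i
  | .nat n => n
  | .add ds => Dim.evalSum v ds
def Dim.evalSum (v : ℕ → ℕ) : List Dim → ℕ
  | [] => 0
  | d :: ds => d.eval v + Dim.evalSum v ds
end

def Dim.evals (v : ℕ → ℕ) : List Dim → List ℕ
  | [] => []
  | d :: ds => d.eval v :: Dim.evals v ds

mutual
/-- The element of the free monoid on `ℕ` denoted by a shape, given the values of the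
variables. -/
def Shp.eval (v : ℕ → ℕ) (w : ℕ → List ℕ) : Shp → List ℕ
  | .var i => w i
  | .shp ds => Dim.evals v ds
  | .app ss => Shp.evalApp v w ss
def Shp.evalApp (v : ℕ → ℕ) (w : ℕ → List ℕ) : List Shp → List ℕ
  | [] => []
  | s :: ss => s.eval v w ++ Shp.evalApp v w ss
end

/-- Equality of dimensions that holds for all values of the variables. -/
instance Dim.setoid : Setoid Dim where
  r d d' := ∀ v, d.eval v = d'.eval v
  iseqv := ⟨fun _ _ => rfl, fun h v => (h v).symm, fun h h' v => (h v).trans (h' v)⟩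

/-- Equality of shapes in the free monoid that holds for all values of the variables. -/
instance Shp.setoid : Setoid Shp where
  r s s' := ∀ v w, s.eval v w = s'.eval v w
  iseqv := ⟨fun _ _ _ => rfl, fun h v w => (h v w).symm,
    fun h h' v w => (h v w).trans (h' v w)⟩

mutual
theorem Dim.eval_subst (σ : ℕ → Dim) (v : ℕ → ℕ) :
    ∀ d : Dim, (d.subst σ).eval v = d.eval (fun i => (σ i).eval v)
  | .var i => by simp [Dim.subst, Dim.eval]
  | .nat n => by simp [Dim.subst, Dim.eval]
  | .add ds => by simp [Dim.subst, Dim.eval, Dim.evalSum_substs σ v ds]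
theorem Dim.evalSum_substs (σ : ℕ → Dim) (v : ℕ → ℕ) :
    ∀ ds : List Dim, Dim.evalSum v (Dim.substs σ ds)
      = Dim.evalSum (fun i => (σ i).eval v) ds
  | [] => by simp [Dim.substs, Dim.evalSum]
  | d :: ds => by
    simp [Dim.substs, Dim.evalSum, Dim.eval_subst σ v d, Dim.evalSum_substs σ v ds]
end

theorem Dim.evals_substs (σ : ℕ → Dim) (v : ℕ → ℕ) :
    ∀ ds : List Dim, Dim.evals v (Dim.substs σ ds) = Dim.evals (fun i => (σ i).eval v) ds
  | [] => by simp [Dim.substs, Dim.evals]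
  | d :: ds => by
    simp [Dim.substs, Dim.evals, Dim.eval_subst σ v d, Dim.evals_substs σ v ds]

mutual
theorem Shp.eval_subst (σ : ℕ → Dim) (θ : ℕ → Shp) (v : ℕ → ℕ) (w : ℕ → List ℕ) :
    ∀ s : Shp, (s.subst σ θ).eval v w
      = s.eval (fun i => (σ i).eval v) (fun i => (θ i).eval v w)
  | .var i => by simp [Shp.subst, Shp.eval]
  | .shp ds => by simp [Shp.subst, Shp.eval, Dim.evals_substs]
  | .app ss => by simp [Shp.subst, Shp.eval, Shp.evalApp_substs σ θ v w ss]
theorem Shp.evalApp_substs (σ : ℕ → Dim) (θ : ℕ → Shp) (v : ℕ → ℕ) (w : ℕ → List ℕ) :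
    ∀ ss : List Shp, Shp.evalApp v w (Shp.substs σ θ ss)
      = Shp.evalApp (fun i => (σ i).eval v) (fun i => (θ i).eval v w) ss
  | [] => by simp [Shp.substs, Shp.evalApp]
  | s :: ss => by
    simp [Shp.substs, Shp.evalApp, Shp.eval_subst σ θ v w s, Shp.evalApp_substs σ θ v w ss]
end

/-- The action on dimensions of a substitution under `k` binders. -/
def upDim (k : ℕ) (σ : ℕ → Dim) (i : ℕ) : Dim :=
  if i < k then .var i else (σ (i - k)).rename (· + k)

/-- The action on shapes of a substitution under `k` binders. -/
def upShp (k : ℕ) (θ : ℕ → Shp) (i : ℕ) : Shp :=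
  if i < k then .var i else (θ (i - k)).rename (· + k)

/-! ### Types -/

/-- The kinds of types. -/
inductive Kind where
  | atom
  | array

/-- Types over a set `B` of base types; `fn`, `univ`, `pi`, `sigma`, `arr` stand for
`(-> (τ …) τ)`, `(Forall ((x k) …) τ)`, `(Pi ((x γ) …) τ)`, `(Sigma ((x γ) …) τ)` and
`(Arr τ ι)`. -/
inductive Ty (B : Type) where
  | var (i : ℕ)
  | base (b : B)
  | fn (ins : List (Ty B)) (out : Ty B)
  | univ (ks : List Kind) (body : Ty B)
  | pi (γs : List IxSort) (body : Ty B)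
  | sigma (γs : List IxSort) (body : Ty B)
  | arr (elt : Ty B) (s : Shp)

section Types
variable {B : Type}

mutual
def Ty.rename (r : ℕ → ℕ) : Ty B → Ty B
  | .var i => .var (r i)
  | .base b => .base b
  | .fn ins out => .fn (Ty.renames r ins) (out.rename r)
  | .univ ks t => .univ ks (t.rename (upRen ks.length r))
  | .pi γs t => .pi γs (t.rename (upRen γs.length r))
  | .sigma γs t => .sigma γs (t.rename (upRen γs.length r))
  | .arr t s => .arr (t.rename r) (s.rename r)
def Ty.renames (r : ℕ → ℕ) : List (Ty B) → List (Ty B)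
  | [] => []
  | t :: ts => t.rename r :: Ty.renames r ts
end

/-- Weakening by `k` new static variables. -/
def Ty.shift (k : ℕ) (t : Ty B) : Ty B := t.rename (· + k)

end Types

/-- A substitution for static variables.  A static variable has one sort or kind, which selects
the component that is used for it. -/
structure SSub (B : Type) where
  dim : ℕ → Dim
  shape : ℕ → Shp
  ty : ℕ → Ty B

/-- A static argument: a type index or a type. -/
inductive SArg (B : Type) where
  | dim (d : Dim)
  | shape (s : Shp)
  | ty (t : Ty B)

section Subst
variable {B : Type}

def SSub.id : SSub B := ⟨.var, .var, .var⟩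

def SSub.up (k : ℕ) (σ : SSub B) : SSub B where
  dim := upDim k σ.dim
  shape := upShp k σ.shape
  ty i := if i < k then .var i else (σ.ty (i - k)).rename (· + k)

mutual
def Ty.subst (σ : SSub B) : Ty B → Ty B
  | .var i => σ.ty i
  | .base b => .base b
  | .fn ins out => .fn (Ty.substs σ ins) (out.subst σ)
  | .univ ks t => .univ ks (t.subst (σ.up ks.length))
  | .pi γs t => .pi γs (t.subst (σ.up γs.length))
  | .sigma γs t => .sigma γs (t.subst (σ.up γs.length))
  | .arr t s => .arr (t.subst σ) (s.subst σ.dim σ.shape)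
def Ty.substs (σ : SSub B) : List (Ty B) → List (Ty B)
  | [] => []
  | t :: ts => t.subst σ :: Ty.substs σ ts
end

/-- The shape component of a type: the shape of an array type, a type variable itself (now
read as a shape variable), and the scalar shape for every other type. -/
def Ty.rawShape : Ty B → Shp
  | .var i => .var i
  | .arr _ s => s
  | _ => .shp []

def Idx.toSArg : Idx → SArg B
  | .dim d => .dim d
  | .shape s => .shape s

/-! Static arguments are used at the sort or kind of the variable they replace; the values for
arguments of another sort or kind are irrelevant defaults. -/

def SArg.toDim : SArg B → Dim
  | .dim d => d
  | _ => .nat 0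

def SArg.toShape : SArg B → Shp
  | .shape s => s
  | .ty t => t.rawShape
  | .dim _ => .shp []

def SArg.toTy : SArg B → Ty B
  | .ty t => t
  | .shape s => .arr (.univ [.array] (.var 0)) s
  | .dim _ => .univ [.array] (.var 0)

/-- Replace the first static variables by the given arguments and lower the others. -/
def SSub.inst (as : List (SArg B)) : SSub B where
  dim i := (as[i]?.map SArg.toDim).getD (.var (i - as.length))
  shape i := (as[i]?.map SArg.toShape).getD (.var (i - as.length))
  ty i := (as[i]?.map SArg.toTy).getD (.var (i - as.length))

def SSub.instTy (ts : List (Ty B)) : SSub B := .inst (ts.map .ty)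

def SSub.instIdx (is : List Idx) : SSub B := .inst (is.map Idx.toSArg)

/-- Type equivalence: the congruence on types generated by equality of indices. -/
inductive TEqv : Ty B → Ty B → Prop
  | refl (t : Ty B) : TEqv t t
  | arr {t t' : Ty B} {s s' : Shp} : TEqv t t' → s ≈ s' → TEqv (.arr t s) (.arr t' s')
  | fn {ins ins' : List (Ty B)} {out out' : Ty B} : ins.length = ins'.length →
      (∀ p ∈ ins.zip ins', TEqv p.1 p.2) → TEqv out out' →
      TEqv (.fn ins out) (.fn ins' out')
  | univ {ks : List Kind} {t t' : Ty B} : TEqv t t' → TEqv (.univ ks t) (.univ ks t')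
  | pi {γs : List IxSort} {t t' : Ty B} : TEqv t t' → TEqv (.pi γs t) (.pi γs t')
  | sigma {γs : List IxSort} {t t' : Ty B} : TEqv t t' → TEqv (.sigma γs t) (.sigma γs t')

end Subst

/-! ### Sorting and kinding -/

/-- What is known about a static variable: the sort of an index variable or the kind of a type
variable. -/
inductive SEntry where
  | sort (γ : IxSort)
  | kind (k : Kind)

/-- The environment of static variables. -/
abbrev SCtx := List SEntry

mutual
def Dim.WS (Θ : SCtx) : Dim → Prop
  | .var i => Θ[i]? = some (.sort .dim)
  | .nat _ => True
  | .add ds => Dim.WSs Θ ds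
def Dim.WSs (Θ : SCtx) : List Dim → Prop
  | [] => True
  | d :: ds => d.WS Θ ∧ Dim.WSs Θ ds
end

mutual
def Shp.WS (Θ : SCtx) : Shp → Prop
  | .var i => Θ[i]? = some (.sort .shape)
  | .shp ds => Dim.WSs Θ ds
  | .app ss => Shp.WSs Θ ss
def Shp.WSs (Θ : SCtx) : List Shp → Prop
  | [] => True
  | s :: ss => s.WS Θ ∧ Shp.WSs Θ ss
end

/-- The sorting judgement for type indices. -/
def Idx.HasSort (Θ : SCtx) : Idx → IxSort → Prop
  | .dim d, .dim => d.WS Θ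
  | .shape s, .shape => s.WS Θ
  | _, _ => False

/-- The kinding judgement for types. -/
inductive HasKind {B : Type} : SCtx → Ty B → Kind → Prop
  | var {Θ : SCtx} {i : ℕ} {k : Kind} : Θ[i]? = some (.kind k) → HasKind Θ (.var i) k
  | base {Θ : SCtx} {b : B} : HasKind Θ (.base b) .atom
  | fn {Θ : SCtx} {ins : List (Ty B)} {out : Ty B} : (∀ t ∈ ins, HasKind Θ t .array) →
      HasKind Θ out .array → HasKind Θ (.fn ins out) .atom
  | univ {Θ : SCtx} {ks : List Kind} {t : Ty B} : HasKind (ks.map .kind ++ Θ) t .array →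
      HasKind Θ (.univ ks t) .atom
  | pi {Θ : SCtx} {γs : List IxSort} {t : Ty B} : HasKind (γs.map .sort ++ Θ) t .array →
      HasKind Θ (.pi γs t) .atom
  | sigma {Θ : SCtx} {γs : List IxSort} {t : Ty B} : HasKind (γs.map .sort ++ Θ) t .array →
      HasKind Θ (.sigma γs t) .atom
  | arr {Θ : SCtx} {t : Ty B} {s : Shp} : HasKind Θ t .atom → s.WS Θ →
      HasKind Θ (.arr t s) .array

/-! ### Explicitly typed terms -/

/-- The parameters of the language: base types, base values with their base types, and
primitive operators with their closed types. -/
structure Lang where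
  Base : Type
  Const : Type
  Op : Type
  constTy : Const → Base
  sig : Op → Ty Base
  sig_kind : ∀ o, HasKind [] (sig o) .atom

/-- The types of the language `L`. -/
abbrev Lang.Ty (L : Lang) := Remora.Ty L.Base

mutual
/-- Explicitly typed expressions.  The last argument `τ` of every constructor is the type with
which the expression is tagged.  The expression `unbox k s b τb τ` stands for
`(unbox (x₁ … xₖ y s) b)`; it binds the `k` index variables `x₁ … xₖ` and the term variable `y`
in `b`, and `τb` is the type of `b`, which does not mention `x₁ … xₖ`. -/
inductive Expr (L : Lang) where
  | var (x : ℕ) (τ : L.Ty)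
  | array (ns : List ℕ) (as : List (Atom L)) (τ : L.Ty)
  | frame (ns : List ℕ) (es : List (Expr L)) (τ : L.Ty)
  | app (f : Expr L) (es : List (Expr L)) (τ : L.Ty)
  | tapp (f : Expr L) (ts : List L.Ty) (τ : L.Ty)
  | iapp (f : Expr L) (is : List Idx) (τ : L.Ty)
  | unbox (k : ℕ) (s : Expr L) (b : Expr L) (τb : L.Ty) (τ : L.Ty)
/-- Explicitly typed atoms.  The last argument `τ` of every constructor is the type with which
the atom is tagged; the argument `τσ` of a box is its ascribed dependent sum type. -/
inductive Atom (L : Lang) where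
  | const (c : L.Const) (τ : L.Ty)
  | op (o : L.Op) (τ : L.Ty)
  | lam (τs : List L.Ty) (e : Expr L) (τ : L.Ty)
  | tlam (ks : List Kind) (e : Expr L) (τ : L.Ty)
  | ilam (γs : List IxSort) (e : Expr L) (τ : L.Ty)
  | box (is : List Idx) (e : Expr L) (τσ : L.Ty) (τ : L.Ty)
end

section Explicit
variable {L : Lang}

/-- The type with which an expression is tagged. -/
def Expr.tag : Expr L → L.Ty
  | .var _ τ => τ
  | .array _ _ τ => τ
  | .frame _ _ τ => τ
  | .app _ _ τ => τ
  | .tapp _ _ τ => τ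
  | .iapp _ _ τ => τ
  | .unbox _ _ _ _ τ => τ

mutual
/-- Value expressions: array literals all of whose atoms are values. -/
def Expr.IsVal : Expr L → Prop
  | .array _ as _ => Atom.AreVals as
  | _ => False
/-- Value atoms: all atoms, except that the content of a box must be a value. -/
def Atom.IsVal : Atom L → Prop
  | .box _ e _ _ => e.IsVal
  | _ => True
def Atom.AreVals : List (Atom L) → Prop
  | [] => True
  | a :: as => a.IsVal ∧ Atom.AreVals as
end

mutual
/-- Renaming of static variables by `r` and of term variables by `q`. -/
def Expr.rename (r q : ℕ → ℕ) : Expr L → Expr L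
  | .var x τ => .var (q x) (τ.rename r)
  | .array ns as τ => .array ns (Atom.renames r q as) (τ.rename r)
  | .frame ns es τ => .frame ns (Expr.renames r q es) (τ.rename r)
  | .app f es τ => .app (f.rename r q) (Expr.renames r q es) (τ.rename r)
  | .tapp f ts τ => .tapp (f.rename r q) (Ty.renames r ts) (τ.rename r)
  | .iapp f is τ => .iapp (f.rename r q) (is.map (Idx.rename r)) (τ.rename r)
  | .unbox k s b τb τ =>
    .unbox k (s.rename r q) (b.rename (upRen k r) (upRen 1 q)) (τb.rename r) (τ.rename r)
def Atom.rename (r q : ℕ → ℕ) : Atom L → Atom L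
  | .const c τ => .const c (τ.rename r)
  | .op o τ => .op o (τ.rename r)
  | .lam τs e τ => .lam (Ty.renames r τs) (e.rename r (upRen τs.length q)) (τ.rename r)
  | .tlam ks e τ => .tlam ks (e.rename (upRen ks.length r) q) (τ.rename r)
  | .ilam γs e τ => .ilam γs (e.rename (upRen γs.length r) q) (τ.rename r)
  | .box is e τσ τ => .box (is.map (Idx.rename r)) (e.rename r q) (τσ.rename r) (τ.rename r)
def Expr.renames (r q : ℕ → ℕ) : List (Expr L) → List (Expr L)
  | [] => []
  | e :: es => e.rename r q :: Expr.renames r q es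
def Atom.renames (r q : ℕ → ℕ) : List (Atom L) → List (Atom L)
  | [] => []
  | a :: as => a.rename r q :: Atom.renames r q as
end

end Explicit

/-- A substitution for term variables: each variable is renamed or replaced by an expression. -/
abbrev TSub (L : Lang) := ℕ → ℕ ⊕ Expr L

section ExplicitSubst
variable {L : Lang}

def TSub.id : TSub L := Sum.inl

/-- The action of a substitution under `k` static and `m` term binders. -/
def TSub.up (k m : ℕ) (ρ : TSub L) : TSub L := fun i =>
  if i < m then .inl i else (ρ (i - m)).map (· + m) (Expr.rename (· + k) (· + m))

/-- Replace the first term variables by the given expressions and lower the others. -/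
def TSub.inst (es : List (Expr L)) : TSub L := fun i =>
  match es[i]? with
  | some e => .inr e
  | none => .inl (i - es.length)

mutual
/-- Simultaneous capture-avoiding substitution for static and term variables. -/
def Expr.subst (σ : SSub L.Base) (ρ : TSub L) : Expr L → Expr L
  | .var x τ =>
    match ρ x with
    | .inl y => .var y (τ.subst σ)
    | .inr e => e
  | .array ns as τ => .array ns (Atom.substs σ ρ as) (τ.subst σ)
  | .frame ns es τ => .frame ns (Expr.substs σ ρ es) (τ.subst σ)
  | .app f es τ => .app (f.subst σ ρ) (Expr.substs σ ρ es) (τ.subst σ)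
  | .tapp f ts τ => .tapp (f.subst σ ρ) (Ty.substs σ ts) (τ.subst σ)
  | .iapp f is τ => .iapp (f.subst σ ρ) (is.map (Idx.subst σ.dim σ.shape)) (τ.subst σ)
  | .unbox k s b τb τ =>
    .unbox k (s.subst σ ρ) (b.subst (σ.up k) (ρ.up k 1)) (τb.subst σ) (τ.subst σ)
def Atom.subst (σ : SSub L.Base) (ρ : TSub L) : Atom L → Atom L
  | .const c τ => .const c (τ.subst σ)
  | .op o τ => .op o (τ.subst σ)
  | .lam τs e τ => .lam (Ty.substs σ τs) (e.subst σ (ρ.up 0 τs.length)) (τ.subst σ)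
  | .tlam ks e τ => .tlam ks (e.subst (σ.up ks.length) (ρ.up ks.length 0)) (τ.subst σ)
  | .ilam γs e τ => .ilam γs (e.subst (σ.up γs.length) (ρ.up γs.length 0)) (τ.subst σ)
  | .box is e τσ τ =>
    .box (is.map (Idx.subst σ.dim σ.shape)) (e.subst σ ρ) (τσ.subst σ) (τ.subst σ)
def Expr.substs (σ : SSub L.Base) (ρ : TSub L) : List (Expr L) → List (Expr L)
  | [] => []
  | e :: es => e.subst σ ρ :: Expr.substs σ ρ es
def Atom.substs (σ : SSub L.Base) (ρ : TSub L) : List (Atom L) → List (Atom L)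
  | [] => []
  | a :: as => a.subst σ ρ :: Atom.substs σ ρ as
end

end ExplicitSubst

/-! ### Typing -/

/-- `m` is the largest of the shapes `ss` in the prefix order. -/
def IsMaxShape (m : Shp) (ss : List Shp) : Prop :=
  m ∈ ss ∧ ∀ s ∈ ss, ∃ rest, Shp.app [s, rest] ≈ m

mutual
/-- The typing judgement for expressions.  Every syntax-directed rule demands that the tag of
the expression is equivalent to the type that the rule computes. -/
inductive HasTy {L : Lang} : SCtx → List L.Ty → Expr L → L.Ty → Prop
  | eqv {Θ : SCtx} {Γ : List L.Ty} {e : Expr L} {τ τ' : L.Ty} :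
      HasTy Θ Γ e τ → TEqv τ τ' → HasTy Θ Γ e τ'
  | var {Θ : SCtx} {Γ : List L.Ty} {x : ℕ} {τx τ : L.Ty} :
      Γ[x]? = some τx → TEqv τx τ → HasTy Θ Γ (.var x τ) τ
  | array {Θ : SCtx} {Γ : List L.Ty} {ns : List ℕ} {as : List (Atom L)} {τa τ : L.Ty} :
      HasKind Θ τa .atom → (∀ a ∈ as, AHasTy Θ Γ a τa) → as.length = ns.prod →
      TEqv (.arr τa (lit ns)) τ → HasTy Θ Γ (.array ns as τ) τ
  | frame {Θ : SCtx} {Γ : List L.Ty} {ns : List ℕ} {es : List (Expr L)} {τc : L.Ty} {ιc : Shp}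
      {τ : L.Ty} :
      HasKind Θ (.arr τc ιc) .array → (∀ e ∈ es, HasTy Θ Γ e (.arr τc ιc)) →
      es.length = ns.prod → TEqv (.arr τc (.app [lit ns, ιc])) τ →
      HasTy Θ Γ (.frame ns es τ) τ
  | app {Θ : SCtx} {Γ : List L.Ty} {f : Expr L} {es : List (Expr L)}
      {ins : List (L.Ty × Shp)} {ιas : List Shp} {τo : L.Ty} {ιf ιo ιp : Shp} {τ : L.Ty} :
      HasTy Θ Γ f (.arr (.fn (ins.map fun p => .arr p.1 p.2) (.arr τo ιo)) ιf) →
      es.length = ins.length → ιas.length = ins.length →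
      (∀ p ∈ es.zip (ins.zip ιas), HasTy Θ Γ p.1 (.arr p.2.1.1 (.app [p.2.2, p.2.1.2]))) →
      IsMaxShape ιp (ιf :: ιas) → TEqv (.arr τo (.app [ιp, ιo])) τ →
      HasTy Θ Γ (.app f es τ) τ
  | tapp {Θ : SCtx} {Γ : List L.Ty} {f : Expr L} {ks : List Kind} {ts : List L.Ty}
      {τu : L.Ty} {ιu ιf : Shp} {τ : L.Ty} :
      HasTy Θ Γ f (.arr (.univ ks (.arr τu ιu)) ιf) →
      ts.length = ks.length → (∀ p ∈ ts.zip ks, HasKind Θ p.1 p.2) →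
      TEqv (.arr (τu.subst (.instTy ts))
        (.app [ιf, ιu.subst (SSub.instTy ts).dim (SSub.instTy ts).shape])) τ →
      HasTy Θ Γ (.tapp f ts τ) τ
  | iapp {Θ : SCtx} {Γ : List L.Ty} {f : Expr L} {γs : List IxSort} {is : List Idx}
      {τp : L.Ty} {ιp ιf : Shp} {τ : L.Ty} :
      HasTy Θ Γ f (.arr (.pi γs (.arr τp ιp)) ιf) →
      is.length = γs.length → (∀ p ∈ is.zip γs, p.1.HasSort Θ p.2) →
      TEqv (.arr (τp.subst (.instIdx is))
        (.app [ιf, ιp.subst (SSub.instIdx (B := L.Base) is).dim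
          (SSub.instIdx (B := L.Base) is).shape])) τ →
      HasTy Θ Γ (.iapp f is τ) τ
  | unbox {Θ : SCtx} {Γ : List L.Ty} {γs : List IxSort} {s b : Expr L} {τs τb : L.Ty}
      {ιs ιb : Shp} {τ : L.Ty} :
      HasTy Θ Γ s (.arr (.sigma γs τs) ιs) →
      HasTy (γs.map .sort ++ Θ) (τs :: Γ.map (Ty.shift γs.length)) b
        ((Ty.arr τb ιb).shift γs.length) →
      HasKind Θ (.arr τb ιb) .array → TEqv (.arr τb (.app [ιs, ιb])) τ →
      HasTy Θ Γ (.unbox γs.length s b (.arr τb ιb) τ) τ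
/-- The typing judgement for atoms. -/
inductive AHasTy {L : Lang} : SCtx → List L.Ty → Atom L → L.Ty → Prop
  | eqv {Θ : SCtx} {Γ : List L.Ty} {a : Atom L} {τ τ' : L.Ty} :
      AHasTy Θ Γ a τ → TEqv τ τ' → AHasTy Θ Γ a τ'
  | const {Θ : SCtx} {Γ : List L.Ty} {c : L.Const} {τ : L.Ty} :
      TEqv (.base (L.constTy c)) τ → AHasTy Θ Γ (.const c τ) τ
  | op {Θ : SCtx} {Γ : List L.Ty} {o : L.Op} {τ : L.Ty} :
      TEqv (L.sig o) τ → AHasTy Θ Γ (.op o τ) τ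
  | lam {Θ : SCtx} {Γ : List L.Ty} {τs : List L.Ty} {e : Expr L} {τo τ : L.Ty} :
      (∀ t ∈ τs, HasKind Θ t .array) → HasTy Θ (τs ++ Γ) e τo → TEqv (.fn τs τo) τ →
      AHasTy Θ Γ (.lam τs e τ) τ
  | tlam {Θ : SCtx} {Γ : List L.Ty} {ks : List Kind} {e : Expr L} {τb τ : L.Ty} :
      e.IsVal → HasTy (ks.map .kind ++ Θ) (Γ.map (Ty.shift ks.length)) e τb →
      TEqv (.univ ks τb) τ → AHasTy Θ Γ (.tlam ks e τ) τ
  | ilam {Θ : SCtx} {Γ : List L.Ty} {γs : List IxSort} {e : Expr L} {τb τ : L.Ty} :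
      e.IsVal → HasTy (γs.map .sort ++ Θ) (Γ.map (Ty.shift γs.length)) e τb →
      TEqv (.pi γs τb) τ → AHasTy Θ Γ (.ilam γs e τ) τ
  | box {Θ : SCtx} {Γ : List L.Ty} {γs : List IxSort} {is : List Idx} {e : Expr L}
      {τb τ : L.Ty} :
      is.length = γs.length → (∀ p ∈ is.zip γs, p.1.HasSort Θ p.2) →
      HasKind Θ (.sigma γs τb) .atom → HasTy Θ Γ e (τb.subst (.instIdx is)) →
      TEqv (.sigma γs τb) τ → AHasTy Θ Γ (.box is e (.sigma γs τb) τ) τ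
end

/-! ### Erased terms -/

/-- The type indices of the erased language, taken up to equality of indices. -/
def EDim := Quotient Dim.setoid

/-- The type indices of the erased language, taken up to equality of indices. -/
def EShp := Quotient Shp.setoid

inductive EIdx where
  | dim (d : EDim)
  | shape (s : EShp)

def Dim.toE (d : Dim) : EDim := Quotient.mk _ d

def Shp.toE (s : Shp) : EShp := Quotient.mk _ s

def Idx.toE : Idx → EIdx
  | .dim d => .dim d.toE
  | .shape s => .shape s.toE

/-- A substitution for the index variables of erased terms. -/
structure ESub where
  dim : ℕ → EDim
  shape : ℕ → EShp

noncomputable section Erased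

def EDim.subst (σ : ESub) : EDim → EDim :=
  Quotient.map (Dim.subst fun i => (σ.dim i).out) fun d d' h v => by
    rw [Dim.eval_subst, Dim.eval_subst]; exact h _

def EShp.subst (σ : ESub) : EShp → EShp :=
  Quotient.map (Shp.subst (fun i => (σ.dim i).out) (fun i => (σ.shape i).out))
    fun s s' h v w => by rw [Shp.eval_subst, Shp.eval_subst]; exact h _ _

def EIdx.subst (σ : ESub) : EIdx → EIdx
  | .dim d => .dim (d.subst σ)
  | .shape s => .shape (s.subst σ)

/-- The append of two shapes. -/
def EShp.append (s t : EShp) : EShp := (Shp.app [s.out, t.out]).toE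

def ESub.id : ESub := ⟨fun i => (Dim.var i).toE, fun i => (Shp.var i).toE⟩

/-- The substitution that renames variables by `r`. -/
def ESub.ofRen (r : ℕ → ℕ) : ESub := ⟨fun i => (Dim.var (r i)).toE, fun i => (Shp.var (r i)).toE⟩

def ESub.up (k : ℕ) (σ : ESub) : ESub where
  dim i := if i < k then (Dim.var i).toE else (σ.dim (i - k)).subst (.ofRen (· + k))
  shape i := if i < k then (Shp.var i).toE else (σ.shape (i - k)).subst (.ofRen (· + k))

def EIdx.toDim : EIdx → EDim
  | .dim d => d
  | _ => (Dim.nat 0).toE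

def EIdx.toShape : EIdx → EShp
  | .shape s => s
  | _ => (lit []).toE

/-- Replace the first index variables by the given indices and lower the others. -/
def ESub.inst (is : List EIdx) : ESub where
  dim i := (is[i]?.map EIdx.toDim).getD (Dim.var (i - is.length)).toE
  shape i := (is[i]?.map EIdx.toShape).getD (Shp.var (i - is.length)).toE

end Erased

mutual
/-- Erased expressions.  A frame form carries the shape of the whole result; application forms
carry the shape of their result and, for every argument, the cell shape that is expected there;
the shape carried by an unboxing form is that of its body. -/
inductive EExpr (L : Lang) where
  | var (x : ℕ)
  | array (ns : List ℕ) (as : List (EAtom L))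
  | frame (s : EShp) (es : List (EExpr L))
  | app (f : EExpr L) (es : List (EArg L)) (s : EShp)
  | iapp (f : EExpr L) (is : List EIdx) (s : EShp)
  | unbox (k : ℕ) (e : EExpr L) (b : EExpr L) (s : EShp)
/-- Erased atoms.  Functions and index abstractions only record how many variables they bind. -/
inductive EAtom (L : Lang) where
  | const (c : L.Const)
  | op (o : L.Op)
  | lam (n : ℕ) (e : EExpr L)
  | ilam (n : ℕ) (e : EExpr L)
  | box (is : List EIdx) (e : EExpr L)
/-- Arguments of erased applications, with the expected cell shape. -/
inductive EArg (L : Lang) where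
  | mk (e : EExpr L) (s : EShp)
end

section ErasedTerms
variable {L : Lang}

mutual
def EExpr.IsVal : EExpr L → Prop
  | .array _ as => EAtom.AreVals as
  | _ => False
def EAtom.IsVal : EAtom L → Prop
  | .box _ e => e.IsVal
  | _ => True
def EAtom.AreVals : List (EAtom L) → Prop
  | [] => True
  | a :: as => a.IsVal ∧ EAtom.AreVals as
end

def EArg.expr : EArg L → EExpr L
  | .mk e _ => e

end ErasedTerms

noncomputable section ErasedSubst
variable {L : Lang}

mutual
/-- Renaming of index variables by `r` and of term variables by `q`. -/
def EExpr.rename (r q : ℕ → ℕ) : EExpr L → EExpr L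
  | .var x => .var (q x)
  | .array ns as => .array ns (EAtom.renames r q as)
  | .frame s es => .frame (s.subst (.ofRen r)) (EExpr.renames r q es)
  | .app f es s => .app (f.rename r q) (EArg.renames r q es) (s.subst (.ofRen r))
  | .iapp f is s =>
    .iapp (f.rename r q) (is.map (EIdx.subst (.ofRen r))) (s.subst (.ofRen r))
  | .unbox k e b s =>
    .unbox k (e.rename r q) (b.rename (upRen k r) (upRen 1 q)) (s.subst (.ofRen r))
def EAtom.rename (r q : ℕ → ℕ) : EAtom L → EAtom L
  | .const c => .const c
  | .op o => .op o
  | .lam n e => .lam n (e.rename r (upRen n q))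
  | .ilam n e => .ilam n (e.rename (upRen n r) q)
  | .box is e => .box (is.map (EIdx.subst (.ofRen r))) (e.rename r q)
def EArg.rename (r q : ℕ → ℕ) : EArg L → EArg L
  | .mk e s => .mk (e.rename r q) (s.subst (.ofRen r))
def EExpr.renames (r q : ℕ → ℕ) : List (EExpr L) → List (EExpr L)
  | [] => []
  | e :: es => e.rename r q :: EExpr.renames r q es
def EAtom.renames (r q : ℕ → ℕ) : List (EAtom L) → List (EAtom L)
  | [] => []
  | a :: as => a.rename r q :: EAtom.renames r q as
def EArg.renames (r q : ℕ → ℕ) : List (EArg L) → List (EArg L)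
  | [] => []
  | a :: as => a.rename r q :: EArg.renames r q as
end

/-- A substitution for the term variables of erased terms. -/
abbrev ETSub (L : Lang) := ℕ → ℕ ⊕ EExpr L

def ETSub.id : ETSub L := Sum.inl

def ETSub.up (k m : ℕ) (ρ : ETSub L) : ETSub L := fun i =>
  if i < m then .inl i else (ρ (i - m)).map (· + m) (EExpr.rename (· + k) (· + m))

def ETSub.inst (es : List (EExpr L)) : ETSub L := fun i =>
  match es[i]? with
  | some e => .inr e
  | none => .inl (i - es.length)

mutual
/-- Simultaneous capture-avoiding substitution for index and term variables. -/
def EExpr.subst (σ : ESub) (ρ : ETSub L) : EExpr L → EExpr L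
  | .var x =>
    match ρ x with
    | .inl y => .var y
    | .inr e => e
  | .array ns as => .array ns (EAtom.substs σ ρ as)
  | .frame s es => .frame (s.subst σ) (EExpr.substs σ ρ es)
  | .app f es s => .app (f.subst σ ρ) (EArg.substs σ ρ es) (s.subst σ)
  | .iapp f is s => .iapp (f.subst σ ρ) (is.map (EIdx.subst σ)) (s.subst σ)
  | .unbox k e b s => .unbox k (e.subst σ ρ) (b.subst (σ.up k) (ρ.up k 1)) (s.subst σ)
def EAtom.subst (σ : ESub) (ρ : ETSub L) : EAtom L → EAtom L
  | .const c => .const c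
  | .op o => .op o
  | .lam n e => .lam n (e.subst σ (ρ.up 0 n))
  | .ilam n e => .ilam n (e.subst (σ.up n) (ρ.up n 0))
  | .box is e => .box (is.map (EIdx.subst σ)) (e.subst σ ρ)
def EArg.subst (σ : ESub) (ρ : ETSub L) : EArg L → EArg L
  | .mk e s => .mk (e.subst σ ρ) (s.subst σ)
def EExpr.substs (σ : ESub) (ρ : ETSub L) : List (EExpr L) → List (EExpr L)
  | [] => []
  | e :: es => e.subst σ ρ :: EExpr.substs σ ρ es
def EAtom.substs (σ : ESub) (ρ : ETSub L) : List (EAtom L) → List (EAtom L)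
  | [] => []
  | a :: as => a.subst σ ρ :: EAtom.substs σ ρ as
def EArg.substs (σ : ESub) (ρ : ETSub L) : List (EArg L) → List (EArg L)
  | [] => []
  | a :: as => a.subst σ ρ :: EArg.substs σ ρ as
end

end ErasedSubst

/-! ### Partial type erasure -/

section Erasure
variable {L : Lang}

/-- Erasure of a type to the index it leaves behind. -/
def Ty.erase {B : Type} (t : Ty B) : EShp := t.rawShape.toE

/-- The cell shapes of the arguments, read off the type of the function position. -/
def argShapes {B : Type} : Ty B → List EShp
  | .arr (.fn ins _) _ => ins.map Ty.erase
  | _ => []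

mutual
/-- Erasure of expressions. -/
def Expr.erase : Expr L → EExpr L
  | .var x _ => .var x
  | .array ns as _ => .array ns (Atom.erases as)
  | .frame _ es τ => .frame τ.erase (Expr.erases es)
  | .app f es τ => .app f.erase (Expr.eraseArgs es (argShapes f.tag)) τ.erase
  | .tapp f ts τ => .iapp f.erase (ts.map fun t => .shape t.erase) τ.erase
  | .iapp f is τ => .iapp f.erase (is.map Idx.toE) τ.erase
  | .unbox k s b τb _ => .unbox k s.erase b.erase τb.erase
/-- Erasure of atoms. -/
def Atom.erase : Atom L → EAtom L
  | .const c _ => .const c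
  | .op o _ => .op o
  | .lam τs e _ => .lam τs.length e.erase
  | .tlam ks e _ => .ilam ks.length e.erase
  | .ilam γs e _ => .ilam γs.length e.erase
  | .box is e _ _ => .box (is.map Idx.toE) e.erase
def Expr.erases : List (Expr L) → List (EExpr L)
  | [] => []
  | e :: es => e.erase :: Expr.erases es
def Atom.erases : List (Atom L) → List (EAtom L)
  | [] => []
  | a :: as => a.erase :: Atom.erases as
def Expr.eraseArgs : List (Expr L) → List EShp → List (EArg L)
  | [], _ => []
  | e :: es, ss => .mk e.erase (ss.headD (lit []).toE) :: Expr.eraseArgs es ss.tail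
end

end Erasure

/-! ### Operational semantics -/

/-- The `j`-th piece of `l` when it is split into pieces of length `m`. -/
def cell {α : Type} (m : ℕ) (l : List α) (j : ℕ) : List α := (l.drop (j * m)).take m

/-- Split `l` into `c` pieces of length `m`, repeat every piece `k` times, and concatenate. -/
def replicateCells {α : Type} (c m k : ℕ) (l : List α) : List α :=
  (List.range c).flatMap fun j => (List.replicate k (cell m l j)).flatten

/-- `np` is the principal frame among `frames`: the largest in the prefix order. -/
def IsPrincipal (np : List ℕ) (frames : List (List ℕ)) : Prop :=
  np ∈ frames ∧ ∀ n ∈ frames, n <+: np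

/-- The number of copies that lifting a frame `n` to the frame `np` makes of every cell. -/
def copies (np n : List ℕ) : ℕ := (np.drop n.length).prod

/-- The meaning of the primitive operators in the two languages: partial functions on argument
values.  The results of well-typed applications are values of the expected type, and an operator
acts in the same way on terms and on erased terms. -/
structure OpSem (L : Lang) where
  δ : L.Op → List (Expr L) → Option (Expr L)
  δE : L.Op → List (EExpr L) → Option (EExpr L)
  δ_type : ∀ o ins out, L.sig o = .fn ins out → ∀ vs : List (Expr L),
    vs.length = ins.length → (∀ v ∈ vs, v.IsVal) → (∀ p ∈ vs.zip ins, HasTy [] [] p.1 p.2) →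
    ∀ r, δ o vs = some r → r.IsVal ∧ HasTy [] [] r out
  δ_erase : ∀ o ins out, L.sig o = .fn ins out → ∀ vs : List (Expr L),
    vs.length = ins.length → (∀ v ∈ vs, v.IsVal) → (∀ p ∈ vs.zip ins, HasTy [] [] p.1 p.2) →
    δE o (vs.map Expr.erase) = (δ o vs).map Expr.erase

/-- An argument value of an application: an array literal whose dimensions are a frame followed
by the dimensions of its cells, together with its tag and the input type `(Arr elt shape)` that
determines the cells. -/
structure ArgVal (L : Lang) where
  frame : List ℕ
  cellDims : List ℕ
  atoms : List (Atom L)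
  tag : L.Ty
  elt : L.Ty
  shape : Shp

section Explicit
variable {L : Lang}

def ArgVal.Ok (a : ArgVal L) : Prop := (∀ x ∈ a.atoms, x.IsVal) ∧ a.shape ≈ lit a.cellDims

def ArgVal.inTy (a : ArgVal L) : L.Ty := .arr a.elt a.shape

def ArgVal.expr (a : ArgVal L) : Expr L := .array (a.frame ++ a.cellDims) a.atoms a.tag

/-- The argument with its cells replicated so that its frame becomes `np`. -/
def ArgVal.lift (np : List ℕ) (a : ArgVal L) : Expr L :=
  .array (np ++ a.cellDims)
    (replicateCells a.frame.prod a.cellDims.prod (copies np a.frame) a.atoms)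
    (.arr a.elt (lit (np ++ a.cellDims)))

/-- The `j`-th cell of the argument. -/
def ArgVal.cellExpr (j : ℕ) (a : ArgVal L) : Expr L :=
  .array a.cellDims (cell a.cellDims.prod a.atoms j) (.arr a.elt (lit a.cellDims))

/-- One step of evaluation of explicitly typed expressions: the reduction rules, followed by one
rule for every form of evaluation context. -/
inductive Step (D : OpSem L) : Expr L → Expr L → Prop
  | lift {nf np : List ℕ} {fs : List (Atom L)} {τs : List L.Ty} {τo : L.Ty} {ιf : Shp}
      {args : List (ArgVal L)} {τ : L.Ty} :
      (∀ x ∈ fs, x.IsVal) → (∀ a ∈ args, a.Ok) → τs = args.map ArgVal.inTy →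
      IsPrincipal np (nf :: args.map ArgVal.frame) →
      (∃ n ∈ nf :: args.map ArgVal.frame, n ≠ np) →
      Step D (.app (.array nf fs (.arr (.fn τs τo) ιf)) (args.map ArgVal.expr) τ)
        (.app (.array np (replicateCells nf.prod 1 (copies np nf) fs)
          (.arr (.fn τs τo) (lit np))) (args.map (ArgVal.lift np)) τ)
  | map {nf : List ℕ} {fs : List (Atom L)} {τs : List L.Ty} {τo : L.Ty} {ιf : Shp}
      {args : List (ArgVal L)} {τ : L.Ty} :
      (∀ x ∈ fs, x.IsVal) → (∀ a ∈ args, a.Ok) → τs = args.map ArgVal.inTy →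
      nf ≠ [] → (∀ a ∈ args, a.frame = nf) →
      Step D (.app (.array nf fs (.arr (.fn τs τo) ιf)) (args.map ArgVal.expr) τ)
        (.frame nf ((List.range nf.prod).map fun j =>
          .app (.array [] (cell 1 fs j) (.arr (.fn τs τo) (lit [])))
            (args.map (ArgVal.cellExpr j)) τo) τ)
  | beta {τs' : List L.Ty} {e : Expr L} {τl : L.Ty} {τs : List L.Ty} {τo : L.Ty} {ιf : Shp}
      {args : List (ArgVal L)} {τ : L.Ty} :
      (∀ a ∈ args, a.Ok) → τs = args.map ArgVal.inTy → (∀ a ∈ args, a.frame = []) →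
      τs'.length = args.length →
      Step D (.app (.array [] [.lam τs' e τl] (.arr (.fn τs τo) ιf)) (args.map ArgVal.expr) τ)
        (e.subst .id (.inst (args.map ArgVal.expr)))
  | delta {o : L.Op} {τl : L.Ty} {τs : List L.Ty} {τo : L.Ty} {ιf : Shp}
      {args : List (ArgVal L)} {τ : L.Ty} {r : Expr L} :
      (∀ a ∈ args, a.Ok) → τs = args.map ArgVal.inTy → (∀ a ∈ args, a.frame = []) →
      D.δ o (args.map ArgVal.expr) = some r →
      Step D (.app (.array [] [.op o τl] (.arr (.fn τs τo) ιf)) (args.map ArgVal.expr) τ) r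
  | tbeta {ns : List ℕ} {fs : List (List Kind × Expr L × L.Ty)} {τf : L.Ty} {ts : List L.Ty}
      {τ : L.Ty} :
      (∀ x ∈ fs, x.1.length = ts.length) →
      Step D (.tapp (.array ns (fs.map fun x => .tlam x.1 x.2.1 x.2.2) τf) ts τ)
        (.frame ns (fs.map fun x => x.2.1.subst (.instTy ts) .id) τ)
  | ibeta {ns : List ℕ} {fs : List (List IxSort × Expr L × L.Ty)} {τf : L.Ty} {is : List Idx}
      {τ : L.Ty} :
      (∀ x ∈ fs, x.1.length = is.length) →
      Step D (.iapp (.array ns (fs.map fun x => .ilam x.1 x.2.1 x.2.2) τf) is τ)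
        (.frame ns (fs.map fun x => x.2.1.subst (.instIdx is) .id) τ)
  | collapse {ns ns' : List ℕ} {cells : List (List (Atom L) × L.Ty)} {τa : L.Ty} {ι : Shp} :
      (∀ c ∈ cells, ∀ x ∈ c.1, x.IsVal) → ι ≈ lit (ns ++ ns') →
      Step D (.frame ns (cells.map fun c => .array ns' c.1 c.2) (.arr τa ι))
        (.array (ns ++ ns') (cells.map Prod.fst).flatten (.arr τa ι))
  | unbox {k : ℕ} {ns : List ℕ} {boxes : List (List Idx × Expr L × L.Ty × L.Ty)} {b : Expr L}
      {τs τb τ : L.Ty} :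
      (∀ x ∈ boxes, x.1.length = k ∧ x.2.1.IsVal) →
      Step D (.unbox k (.array ns (boxes.map fun x => .box x.1 x.2.1 x.2.2.1 x.2.2.2) τs) b τb τ)
        (.frame ns (boxes.map fun x => b.subst (.instIdx x.1) (.inst [x.2.1])) τ)
  | inBox {ns : List ℕ} {vs as : List (Atom L)} {is : List Idx} {e e' : Expr L}
      {τσ τx τ : L.Ty} :
      (∀ v ∈ vs, v.IsVal) → Step D e e' →
      Step D (.array ns (vs ++ .box is e τσ τx :: as) τ)
        (.array ns (vs ++ .box is e' τσ τx :: as) τ)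
  | inFrame {ns : List ℕ} {vs es : List (Expr L)} {e e' : Expr L} {τ : L.Ty} :
      (∀ v ∈ vs, v.IsVal) → Step D e e' →
      Step D (.frame ns (vs ++ e :: es) τ) (.frame ns (vs ++ e' :: es) τ)
  | inFun {f f' : Expr L} {es : List (Expr L)} {τ : L.Ty} :
      Step D f f' → Step D (.app f es τ) (.app f' es τ)
  | inArg {f : Expr L} {vs es : List (Expr L)} {e e' : Expr L} {τ : L.Ty} :
      f.IsVal → (∀ v ∈ vs, v.IsVal) → Step D e e' →
      Step D (.app f (vs ++ e :: es) τ) (.app f (vs ++ e' :: es) τ)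
  | inTApp {f f' : Expr L} {ts : List L.Ty} {τ : L.Ty} :
      Step D f f' → Step D (.tapp f ts τ) (.tapp f' ts τ)
  | inIApp {f f' : Expr L} {is : List Idx} {τ : L.Ty} :
      Step D f f' → Step D (.iapp f is τ) (.iapp f' is τ)
  | inUnbox {k : ℕ} {s s' b : Expr L} {τb τ : L.Ty} :
      Step D s s' → Step D (.unbox k s b τb τ) (.unbox k s' b τb τ)

end Explicit

/-- An argument value of an erased application: an array literal whose dimensions are a frame
followed by the dimensions of its cells, and the cell shape expected by the application. -/
structure EArgVal (L : Lang) where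
  frame : List ℕ
  cellDims : List ℕ
  atoms : List (EAtom L)
  shape : EShp

section ErasedStep
variable {L : Lang}

def EArgVal.Ok (a : EArgVal L) : Prop :=
  (∀ x ∈ a.atoms, x.IsVal) ∧ a.shape = (lit a.cellDims).toE

def EArgVal.expr (a : EArgVal L) : EExpr L := .array (a.frame ++ a.cellDims) a.atoms

def EArgVal.arg (a : EArgVal L) : EArg L := .mk a.expr a.shape

def EArgVal.lift (np : List ℕ) (a : EArgVal L) : EArg L :=
  .mk (.array (np ++ a.cellDims)
    (replicateCells a.frame.prod a.cellDims.prod (copies np a.frame) a.atoms)) a.shape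

def EArgVal.cellArg (j : ℕ) (a : EArgVal L) : EArg L :=
  .mk (.array a.cellDims (cell a.cellDims.prod a.atoms j)) a.shape

/-- One step of evaluation of erased expressions: the reduction rules, followed by one rule for
every form of evaluation context. -/
inductive EStep (D : OpSem L) : EExpr L → EExpr L → Prop
  | lift {nf np : List ℕ} {fs : List (EAtom L)} {args : List (EArgVal L)} {s : EShp} :
      (∀ x ∈ fs, x.IsVal) → (∀ a ∈ args, a.Ok) →
      IsPrincipal np (nf :: args.map EArgVal.frame) →
      (∃ n ∈ nf :: args.map EArgVal.frame, n ≠ np) →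
      EStep D (.app (.array nf fs) (args.map EArgVal.arg) s)
        (.app (.array np (replicateCells nf.prod 1 (copies np nf) fs))
          (args.map (EArgVal.lift np)) s)
  | map {nf no : List ℕ} {fs : List (EAtom L)} {args : List (EArgVal L)} {s : EShp} :
      (∀ x ∈ fs, x.IsVal) → (∀ a ∈ args, a.Ok) → nf ≠ [] → (∀ a ∈ args, a.frame = nf) →
      s = (lit (nf ++ no)).toE →
      EStep D (.app (.array nf fs) (args.map EArgVal.arg) s)
        (.frame s ((List.range nf.prod).map fun j =>
          .app (.array [] (cell 1 fs j)) (args.map (EArgVal.cellArg j)) (lit no).toE))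
  | beta {n : ℕ} {e : EExpr L} {args : List (EArgVal L)} {s : EShp} :
      (∀ a ∈ args, a.Ok) → (∀ a ∈ args, a.frame = []) → n = args.length →
      EStep D (.app (.array [] [.lam n e]) (args.map EArgVal.arg) s)
        (e.subst .id (.inst (args.map EArgVal.expr)))
  | delta {o : L.Op} {args : List (EArgVal L)} {s : EShp} {r : EExpr L} :
      (∀ a ∈ args, a.Ok) → (∀ a ∈ args, a.frame = []) →
      D.δE o (args.map EArgVal.expr) = some r →
      EStep D (.app (.array [] [.op o]) (args.map EArgVal.arg) s) r
  | ibeta {ns : List ℕ} {fs : List (ℕ × EExpr L)} {is : List EIdx} {s : EShp} :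
      (∀ x ∈ fs, x.1 = is.length) →
      EStep D (.iapp (.array ns (fs.map fun x => .ilam x.1 x.2)) is s)
        (.frame s (fs.map fun x => x.2.subst (.inst is) .id))
  | collapse {ns ns' : List ℕ} {cells : List (List (EAtom L))} {s : EShp} :
      (∀ c ∈ cells, ∀ x ∈ c, x.IsVal) → s = (lit (ns ++ ns')).toE →
      EStep D (.frame s (cells.map fun c => .array ns' c)) (.array (ns ++ ns') cells.flatten)
  | unbox {k : ℕ} {ns : List ℕ} {boxes : List (List EIdx × EExpr L)} {b : EExpr L} {s : EShp} :
      (∀ x ∈ boxes, x.1.length = k ∧ x.2.IsVal) →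
      EStep D (.unbox k (.array ns (boxes.map fun x => .box x.1 x.2)) b s)
        (.frame ((lit ns).toE.append s)
          (boxes.map fun x => b.subst (.inst x.1) (.inst [x.2])))
  | inBox {ns : List ℕ} {vs as : List (EAtom L)} {is : List EIdx} {e e' : EExpr L} :
      (∀ v ∈ vs, v.IsVal) → EStep D e e' →
      EStep D (.array ns (vs ++ .box is e :: as)) (.array ns (vs ++ .box is e' :: as))
  | inFrame {vs es : List (EExpr L)} {e e' : EExpr L} {s : EShp} :
      (∀ v ∈ vs, v.IsVal) → EStep D e e' →
      EStep D (.frame s (vs ++ e :: es)) (.frame s (vs ++ e' :: es))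
  | inFun {f f' : EExpr L} {es : List (EArg L)} {s : EShp} :
      EStep D f f' → EStep D (.app f es s) (.app f' es s)
  | inArg {f : EExpr L} {vs es : List (EArg L)} {e e' : EExpr L} {t s : EShp} :
      f.IsVal → (∀ v ∈ vs, v.expr.IsVal) → EStep D e e' →
      EStep D (.app f (vs ++ .mk e t :: es) s) (.app f (vs ++ .mk e' t :: es) s)
  | inIApp {f f' : EExpr L} {is : List EIdx} {s : EShp} :
      EStep D f f' → EStep D (.iapp f is s) (.iapp f' is s)
  | inUnbox {k : ℕ} {e e' b : EExpr L} {s : EShp} :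
      EStep D e e' → EStep D (.unbox k e b s) (.unbox k e' b s)

end ErasedStep

/-! ### Machine states and erasure equivalence -/

section States
variable {L : Lang}

/-- Closed well-typed explicit expressions. -/
def WellTyped (e : Expr L) : Prop := ∃ τ, HasTy [] [] e τ

/-- An explicit state is a closed well-typed expression; an erased state is the erasure of one. -/
def IsState : Expr L ⊕ EExpr L → Prop
  | .inl e => WellTyped e
  | .inr w => ∃ e : Expr L, WellTyped e ∧ e.erase = w

variable (L) in
/-- The machine states: the disjoint sum of the closed well-typed explicit expressions and of
their erasures. -/
def State := {x : Expr L ⊕ EExpr L // IsState x}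

/-- The transitions of the two languages. -/
inductive Trans (D : OpSem L) : Expr L ⊕ EExpr L → Expr L ⊕ EExpr L → Prop
  | explicit {e e' : Expr L} : Step D e e' → Trans D (.inl e) (.inl e')
  | erased {w w' : EExpr L} : EStep D w w' → Trans D (.inr w) (.inr w')

/-- There is no transition out of the state. -/
def Stuck (D : OpSem L) (s : State L) : Prop := ∀ x, ¬ Trans D s.1 x

/-- The graph of the erasure function on states. -/
def ErasesTo (s w : State L) : Prop := ∃ e : Expr L, s.1 = .inl e ∧ w.1 = .inr e.erase

/-- Erasure equivalence: the equivalence closure of the erasure function. -/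
def ErasureEquiv : State L → State L → Prop := Relation.EqvGen ErasesTo

end States

end Remora

-- Substitution calculus for indices and types.

namespace Remora

/-! ### Lists of terms -/

-- Two states are erasure equivalent exactly when their erasures coincide, because every erased
-- state is itself the erasure of a typed expression (`erasureEquiv_iff`). It therefore suffices
-- that erasure matches single steps in both directions on closed typed expressions. Forward
-- (`HasTy.step`): if `e` steps to `e'`, then `e'` keeps every type of `e`, and `e.erase` steps to
-- `e'.erase`. Backward (`EStep.reflect`): every step of `e.erase` is the erasure of a step of `e`.
-- A transition is then transported between equivalent states through their common erasure.
--
-- For the forward direction, the reduction rules inspect only dimensions of literals and index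
-- annotations, and erasure keeps both. The annotations of the arguments of an application are read
-- off the tag of the function; erased indices are classes modulo equality, so these annotations
-- depend on the function type only up to equivalence (`HasTy.argShapes_tag`) and do not change
-- while the function is evaluated. The rules that instantiate binders need erasure to commute with
-- substitution. Since a type variable is erased to a shape variable, this holds for substitutions
-- whose type and shape components agree (`SSub.Coherent`), a condition satisfied by renamings and
-- instantiations. `SubstClass.hasTy_subst` proves preservation of types and commutation with
-- erasure together.
--
-- For the backward direction, typing restores what erasure forgets. Inversion (`HasTy.inv`,
-- `AHasTy.inv`) tells type abstractions from index abstractions by the type of the array that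
-- contains them. A closed shape denotes a literal, so the missing dimensions of frames and cells
-- can be read from types; the frame of an argument is what is left of its dimensions when the cell
-- shape is cancelled (`HasTy.app_inv`). Type equivalence keeps the outermost constructor, so that
-- tags literally have the form that the explicit rules demand (`exists_app`).
--
-- Inversion works only up to conversion, so kinding must be invariant under equality of indices.
-- This is the one point where the denotation of indices matters in depth: an index that mentions a
-- variable takes arbitrarily large values as that variable grows, hence equal shapes have the same
-- variables (`Shp.WS.congr`).

theorem map_eq_self {α : Type} {f : α → α} {l : List α} (h : ∀ x ∈ l, f x = x) :
    l.map f = l :=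
  (List.map_congr_left h).trans l.map_id

@[simp] theorem Dim.renames_eq_map (r : ℕ → ℕ) (ds : List Dim) :
    Dim.renames r ds = ds.map (Dim.rename r) := by
  induction ds <;> simp_all [Dim.renames]

@[simp] theorem Dim.substs_eq_map (σ : ℕ → Dim) (ds : List Dim) :
    Dim.substs σ ds = ds.map (Dim.subst σ) := by
  induction ds <;> simp_all [Dim.substs]

@[simp] theorem Shp.renames_eq_map (r : ℕ → ℕ) (ss : List Shp) :
    Shp.renames r ss = ss.map (Shp.rename r) := by
  induction ss <;> simp_all [Shp.renames]

@[simp] theorem Shp.substs_eq_map (σ : ℕ → Dim) (θ : ℕ → Shp) (ss : List Shp) :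
    Shp.substs σ θ ss = ss.map (Shp.subst σ θ) := by
  induction ss <;> simp_all [Shp.substs]

@[simp] theorem Ty.renames_eq_map {B : Type} (r : ℕ → ℕ) (ts : List (Ty B)) :
    Ty.renames r ts = ts.map (Ty.rename r) := by
  induction ts <;> simp_all [Ty.renames]

@[simp] theorem Ty.substs_eq_map {B : Type} (σ : SSub B) (ts : List (Ty B)) :
    Ty.substs σ ts = ts.map (Ty.subst σ) := by
  induction ts <;> simp_all [Ty.substs]

@[simp] theorem Dim.evals_eq_map (v : ℕ → ℕ) (ds : List Dim) :
    Dim.evals v ds = ds.map (Dim.eval v) := by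
  induction ds <;> simp_all [Dim.evals]

theorem Dim.wss_iff (Θ : SCtx) (ds : List Dim) : Dim.WSs Θ ds ↔ ∀ d ∈ ds, d.WS Θ := by
  induction ds <;> simp_all [Dim.WSs]

theorem Shp.wss_iff (Θ : SCtx) (ss : List Shp) : Shp.WSs Θ ss ↔ ∀ s ∈ ss, s.WS Θ := by
  induction ss <;> simp_all [Shp.WSs]

/-! ### Induction principles -/

mutual
-- Sums nest dimensions inside a list, so the induction hypothesis must range over the members of
-- that list; the companion statement on lists carries the recursion. The principles for shapes,
-- types and terms follow the same pattern.
theorem Dim.ind {P : Dim → Prop} (hv : ∀ i, P (.var i)) (hn : ∀ n, P (.nat n))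
    (ha : ∀ ds, (∀ d ∈ ds, P d) → P (.add ds)) : ∀ d, P d
  | .var i => hv i
  | .nat n => hn n
  | .add ds => ha ds (Dim.ind_list hv hn ha ds)
theorem Dim.ind_list {P : Dim → Prop} (hv : ∀ i, P (.var i)) (hn : ∀ n, P (.nat n))
    (ha : ∀ ds, (∀ d ∈ ds, P d) → P (.add ds)) : ∀ ds : List Dim, ∀ d ∈ ds, P d
  | [] => by simp
  | d :: ds => by
    have h₁ := Dim.ind hv hn ha d
    have h₂ := Dim.ind_list hv hn ha ds
    simp only [List.mem_cons, forall_eq_or_imp]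
    exact ⟨h₁, h₂⟩
end

mutual
theorem Shp.ind {P : Shp → Prop} (hv : ∀ i, P (.var i)) (hs : ∀ ds, P (.shp ds))
    (ha : ∀ ss, (∀ s ∈ ss, P s) → P (.app ss)) : ∀ s, P s
  | .var i => hv i
  | .shp ds => hs ds
  | .app ss => ha ss (Shp.ind_list hv hs ha ss)
theorem Shp.ind_list {P : Shp → Prop} (hv : ∀ i, P (.var i)) (hs : ∀ ds, P (.shp ds))
    (ha : ∀ ss, (∀ s ∈ ss, P s) → P (.app ss)) : ∀ ss : List Shp, ∀ s ∈ ss, P s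
  | [] => by simp
  | s :: ss => by
    have h₁ := Shp.ind hv hs ha s
    have h₂ := Shp.ind_list hv hs ha ss
    simp only [List.mem_cons, forall_eq_or_imp]
    exact ⟨h₁, h₂⟩
end

section
variable {B : Type} {P : Ty B → Prop}

mutual
theorem Ty.ind (hv : ∀ i, P (.var i)) (hb : ∀ b, P (.base b))
    (hf : ∀ ins out, (∀ t ∈ ins, P t) → P out → P (.fn ins out))
    (hu : ∀ ks t, P t → P (.univ ks t)) (hp : ∀ γs t, P t → P (.pi γs t))
    (hs : ∀ γs t, P t → P (.sigma γs t)) (ha : ∀ t s, P t → P (.arr t s)) : ∀ t, P t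
  | .var i => hv i
  | .base b => hb b
  | .fn ins out =>
    hf ins out (Ty.ind_list hv hb hf hu hp hs ha ins) (Ty.ind hv hb hf hu hp hs ha out)
  | .univ ks t => hu ks t (Ty.ind hv hb hf hu hp hs ha t)
  | .pi γs t => hp γs t (Ty.ind hv hb hf hu hp hs ha t)
  | .sigma γs t => hs γs t (Ty.ind hv hb hf hu hp hs ha t)
  | .arr t s => ha t s (Ty.ind hv hb hf hu hp hs ha t)
theorem Ty.ind_list (hv : ∀ i, P (.var i)) (hb : ∀ b, P (.base b))
    (hf : ∀ ins out, (∀ t ∈ ins, P t) → P out → P (.fn ins out))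
    (hu : ∀ ks t, P t → P (.univ ks t)) (hp : ∀ γs t, P t → P (.pi γs t))
    (hs : ∀ γs t, P t → P (.sigma γs t)) (ha : ∀ t s, P t → P (.arr t s)) :
    ∀ ts : List (Ty B), ∀ t ∈ ts, P t
  | [] => by simp
  | t :: ts => by
    have h₁ := Ty.ind hv hb hf hu hp hs ha t
    have h₂ := Ty.ind_list hv hb hf hu hp hs ha ts
    simp only [List.mem_cons, forall_eq_or_imp]
    exact ⟨h₁, h₂⟩
end

end

/-! ### Substitution in indices -/

theorem Dim.rename_eq_subst (r : ℕ → ℕ) (d : Dim) :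
    d.rename r = d.subst fun i => .var (r i) := by
  induction d using Dim.ind <;> simp_all [Dim.rename, Dim.subst]

theorem Shp.rename_eq_subst (r : ℕ → ℕ) (s : Shp) :
    s.rename r = s.subst (fun i => .var (r i)) fun i => .var (r i) := by
  induction s using Shp.ind <;> simp_all [Shp.rename, Shp.subst, Dim.rename_eq_subst]

theorem Dim.subst_subst (σ σ' : ℕ → Dim) (d : Dim) :
    (d.subst σ).subst σ' = d.subst fun i => (σ i).subst σ' := by
  induction d using Dim.ind <;> simp_all [Dim.subst]

theorem Shp.subst_subst (σ σ' : ℕ → Dim) (θ θ' : ℕ → Shp) (s : Shp) :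
    (s.subst σ θ).subst σ' θ'
      = s.subst (fun i => (σ i).subst σ') fun i => (θ i).subst σ' θ' := by
  induction s using Shp.ind <;> simp_all [Shp.subst, Dim.subst_subst]

@[simp] theorem Dim.subst_var (d : Dim) : d.subst .var = d := by
  induction d using Dim.ind with
  | hv i => rfl
  | hn n => rfl
  | ha ds ih => simpa [Dim.subst] using map_eq_self ih

theorem Dim.map_subst_var (ds : List Dim) : ds.map (Dim.subst .var) = ds :=
  map_eq_self fun d _ => d.subst_var

@[simp] theorem Shp.subst_var (s : Shp) : s.subst .var .var = s := by
  induction s using Shp.ind with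
  | hv i => rfl
  | hs n => simp [Shp.subst, Dim.map_subst_var]
  | ha ds ih => simpa [Shp.subst] using map_eq_self ih

/-! ### Substitution in types -/

section
variable {B : Type}

attribute [ext] SSub

/-- The substitution that renames static variables by `r`. -/
def SSub.ofRen (r : ℕ → ℕ) : SSub B :=
  ⟨fun i => .var (r i), fun i => .var (r i), fun i => .var (r i)⟩

/-- The substitution `σ` followed by `σ'`. -/
def SSub.comp (σ σ' : SSub B) : SSub B where
  dim i := (σ.dim i).subst σ'.dim
  shape i := (σ.shape i).subst σ'.dim σ'.shape
  ty i := (σ.ty i).subst σ'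

/-- Type variables and shape variables are substituted consistently. -/
def SSub.Coherent (σ : SSub B) : Prop := ∀ i, (σ.ty i).rawShape = σ.shape i

theorem SSub.up_ofRen (k : ℕ) (r : ℕ → ℕ) :
    (SSub.ofRen r : SSub B).up k = .ofRen (upRen k r) := by
  ext i <;> simp only [SSub.up, SSub.ofRen, upDim, upShp, upRen] <;> split <;> rfl

theorem Ty.rename_eq_subst (r : ℕ → ℕ) (t : Ty B) : t.rename r = t.subst (.ofRen r) := by
  induction t using Ty.ind generalizing r <;>
    simp_all [Ty.rename, Ty.subst, SSub.up_ofRen, Shp.rename_eq_subst]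
  all_goals simp_all [SSub.ofRen]

theorem SSub.up_comp_ofRen (k : ℕ) (r : ℕ → ℕ) (σ : SSub B) :
    (SSub.comp (.ofRen r) σ).up k = SSub.comp (.ofRen (upRen k r)) (σ.up k) := by
  ext i <;> by_cases h : i < k <;>
    simp [SSub.up, SSub.ofRen, SSub.comp, upDim, upShp, upRen, h, Dim.subst, Shp.subst, Ty.subst]

/-- Passing below a binder renames the values of a substitution, so the composition law is built up
in stages: a renaming followed by a substitution here, a substitution followed by a renaming in
`Ty.rename_subst`, and the general case in `Ty.subst_subst`, each resting on the earlier ones. -/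
theorem Ty.subst_rename (r : ℕ → ℕ) (σ : SSub B) (t : Ty B) :
    (t.rename r).subst σ = t.subst (.comp (.ofRen r) σ) := by
  induction t using Ty.ind generalizing r σ <;>
    simp_all [Ty.rename, Ty.subst, SSub.up_comp_ofRen, Shp.rename_eq_subst, Shp.subst_subst]
  all_goals simp [SSub.comp, SSub.ofRen, Ty.subst]

theorem SSub.up_comp_ofRen' (k : ℕ) (r : ℕ → ℕ) (σ : SSub B) :
    (σ.comp (.ofRen r)).up k = (σ.up k).comp (.ofRen (upRen k r)) := by
  have key : ∀ j, upRen k r (j + k) = r j + k := by simp [upRen]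
  ext i <;> by_cases h : i < k <;>
    simp [SSub.up, SSub.comp, upDim, upShp, h, Dim.subst, Shp.subst, Ty.subst,
      Dim.rename_eq_subst, Shp.rename_eq_subst, Dim.subst_subst, Shp.subst_subst,
      Ty.rename_eq_subst]
  · simp [SSub.ofRen, upRen, h]
  · simp [SSub.ofRen, Dim.subst, key]
  · simp [SSub.ofRen, upRen, h]
  · simp [SSub.ofRen, Dim.subst, Shp.subst, key]
  · simp [SSub.ofRen, upRen, h]
  -- The type component is renamed by `r` and then weakened on one side, weakened and then renamed
  -- by `upRen k r` on the other. Both are compositions of two renamings, so the law for a renaming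
  -- on the left already covers them.
  have e₁ := Ty.subst_rename r (.ofRen (· + k)) (σ.ty (i - k))
  have e₂ := Ty.subst_rename (· + k) (.ofRen (upRen k r)) (σ.ty (i - k))
  simp only [Ty.rename_eq_subst] at e₁ e₂
  rw [e₁, e₂]
  simp [SSub.ofRen, SSub.comp, Dim.subst, Shp.subst, Ty.subst, key]

theorem Ty.rename_subst (r : ℕ → ℕ) (σ : SSub B) (t : Ty B) :
    (t.subst σ).subst (.ofRen r) = t.subst (σ.comp (.ofRen r)) := by
  induction t using Ty.ind generalizing r σ <;>
    simp_all [Ty.subst, SSub.up_comp_ofRen', SSub.up_ofRen, Shp.subst_subst]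
  all_goals simp [SSub.comp, SSub.ofRen]

theorem SSub.up_comp (k : ℕ) (σ σ' : SSub B) :
    (σ.comp σ').up k = (σ.up k).comp (σ'.up k) := by
  ext i <;> by_cases h : i < k <;>
    simp [SSub.up, SSub.comp, upDim, upShp, h, Dim.subst, Shp.subst, Ty.subst,
      Dim.rename_eq_subst, Shp.rename_eq_subst, Dim.subst_subst, Shp.subst_subst,
      Ty.rename_eq_subst, Ty.rename_subst]
  rw [← Ty.rename_eq_subst, Ty.subst_rename]
  congr 1
  ext j <;> simp [SSub.ofRen, SSub.comp, Dim.subst, Shp.subst, Ty.subst, upDim, upShp,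
      Dim.rename_eq_subst, Shp.rename_eq_subst]

theorem Ty.subst_subst (σ σ' : SSub B) (t : Ty B) :
    (t.subst σ).subst σ' = t.subst (σ.comp σ') := by
  induction t using Ty.ind generalizing σ σ' <;>
    simp_all [Ty.subst, SSub.up_comp, Shp.subst_subst]
  all_goals simp [SSub.comp]

theorem SSub.up_id (k : ℕ) : (SSub.id : SSub B).up k = .id := by
  ext i <;> by_cases h : i < k <;>
    simp [SSub.up, SSub.id, upDim, upShp, h, Dim.rename, Shp.rename, Ty.rename] <;> omega

@[simp] theorem Ty.subst_id (t : Ty B) : t.subst .id = t := by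
  induction t using Ty.ind with
  | hf ins out h h' => simpa [Ty.subst, h'] using map_eq_self h
  | _ => simp_all [Ty.subst, SSub.up_id] <;> simp [SSub.id]

@[simp] theorem Ty.shift_zero (t : Ty B) : t.shift 0 = t := by
  rw [Ty.shift, Ty.rename_eq_subst]; exact t.subst_id

theorem SSub.up_zero (σ : SSub B) : σ.up 0 = σ := by
  ext i
  · simp [SSub.up, upDim, Dim.rename_eq_subst]
  · simp [SSub.up, upShp, Shp.rename_eq_subst]
  · exact Ty.shift_zero _

/-- Weakening commutes with substitution. -/
theorem Ty.subst_shift (k : ℕ) (σ : SSub B) (t : Ty B) :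
    (t.shift k).subst (σ.up k) = (t.subst σ).shift k := by
  rw [Ty.shift, Ty.shift, Ty.subst_rename, Ty.rename_eq_subst, Ty.rename_subst]
  congr 1
  ext j <;> simp [SSub.up, SSub.ofRen, SSub.comp, upDim, upShp, Dim.subst, Shp.subst, Ty.subst,
      Dim.rename_eq_subst, Shp.rename_eq_subst, Ty.rename_eq_subst]

/-- Substituting for newly introduced variables does nothing. -/
theorem Ty.subst_inst_shift (as : List (SArg B)) (t : Ty B) :
    (t.shift as.length).subst (.inst as) = t := by
  rw [Ty.shift, Ty.subst_rename]
  refine Eq.trans ?_ t.subst_id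
  congr 1
  ext j <;> simp [SSub.inst, SSub.ofRen, SSub.comp, Dim.subst, Shp.subst, Ty.subst, SSub.id]

theorem Ty.rawShape_rename (r : ℕ → ℕ) (t : Ty B) :
    (t.rename r).rawShape = t.rawShape.rename r := by
  cases t <;> simp [Ty.rename, Ty.rawShape, Shp.rename]

/-- Only a type variable needs coherence: its raw shape is the shape variable of the same number,
which is replaced by `σ.shape i`, whereas the substituted type contributes the raw shape of `σ.ty
i`. -/
theorem Ty.rawShape_subst {σ : SSub B} (h : σ.Coherent) (t : Ty B) :
    (t.subst σ).rawShape = t.rawShape.subst σ.dim σ.shape := by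
  cases t with
  | var i => exact h i
  | _ => simp [Ty.subst, Ty.rawShape, Shp.subst]

theorem SSub.Coherent.up {σ : SSub B} (h : σ.Coherent) (k : ℕ) : (σ.up k).Coherent := by
  intro i
  by_cases hi : i < k
  · simp [SSub.up, upShp, hi, Ty.rawShape]
  · simp only [SSub.up, upShp, hi, if_false, Ty.rawShape_rename]
    rw [h]

theorem SSub.coherent_ofRen (r : ℕ → ℕ) : (SSub.ofRen r : SSub B).Coherent := fun _ => rfl

theorem SArg.rawShape_toTy (a : SArg B) : a.toTy.rawShape = a.toShape := by
  cases a <;> rfl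

/-- The default types that `SArg.toTy` gives to index arguments have the raw shape that
`SArg.toShape` assigns to the same arguments, so coherence holds even at variables of the wrong
sort. -/
theorem SSub.coherent_inst (as : List (SArg B)) : (SSub.inst as).Coherent := by
  intro i
  simp only [SSub.inst]
  cases as[i]?
  · rfl
  · exact SArg.rawShape_toTy _

/-- Substitution in a static argument. -/
def SArg.subst (σ : SSub B) : SArg B → SArg B
  | .dim d => .dim (d.subst σ.dim)
  | .shape s => .shape (s.subst σ.dim σ.shape)
  | .ty t => .ty (t.subst σ)

/-- Below `as.length` both sides select the same substituted argument; above it, the weakening in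
`σ.up` is undone by the instantiation. Coherence enters where a type argument is read as a shape. -/
theorem SSub.inst_comp {σ : SSub B} (hσ : σ.Coherent) (as : List (SArg B)) :
    (SSub.inst as).comp σ = (σ.up as.length).comp (.inst (as.map (SArg.subst σ))) := by
  have hS (s : Shp) : s = s.subst .var .var := by simp
  have hD (s : Dim) : s = s.subst .var := by simp
  ext i
  · by_cases h : i < as.length
    · simp only [SSub.comp, SSub.inst, SSub.up, upDim, h, if_true, Dim.subst]
      cases ha : as[i] <;> simp [h, ha, SArg.subst, SArg.toDim, Dim.subst]
    · simp only [SSub.comp, SSub.inst, SSub.up, upDim, h, if_false, Dim.rename_eq_subst,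
        Dim.subst_subst]
      rw [List.getElem?_eq_none (by omega)]
      conv_lhs => simp [Dim.subst]; rw [hD (σ.dim _)]
      congr 1
      funext j
      simp [Dim.subst]
  · by_cases h : i < as.length
    · simp only [SSub.comp, SSub.inst, SSub.up, upShp, h, if_true, Shp.subst]
      cases ha : as[i] <;>
        simp [h, ha, SArg.subst, SArg.toShape, Shp.subst, Ty.rawShape_subst hσ]
    · simp only [SSub.comp, SSub.inst, SSub.up, upShp, h, if_false, Shp.rename_eq_subst,
        Shp.subst_subst]
      rw [List.getElem?_eq_none (by omega)]
      conv_lhs => simp [Shp.subst]; rw [hS (σ.shape _)]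
      congr 1 <;>
      · funext j
        simp [Shp.subst, Dim.subst]
  · by_cases h : i < as.length
    · simp only [SSub.comp, SSub.inst, SSub.up, h, if_true, Ty.subst]
      cases ha : as[i] <;>
        simp [h, ha, SArg.subst, SArg.toTy, Ty.subst, SSub.up]
    · have e : ((σ.up as.length).comp (.inst (as.map (SArg.subst σ)))).ty i
          = ((σ.ty (i - as.length)).shift as.length).subst (.inst (as.map (SArg.subst σ))) := by
        simp [SSub.comp, SSub.up, h, Ty.shift]
      rw [e]
      -- The weakening has to be by the length of the substituted argument list, the one that is
      -- instantiated, before the two can cancel.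
      conv_rhs => rw [← List.length_map (as := as) (SArg.subst σ)]
      rw [Ty.subst_inst_shift]
      simp [SSub.comp, SSub.inst, List.getElem?_eq_none (Nat.le_of_not_lt h), Ty.subst]

theorem Ty.subst_instTy {σ : SSub B} (hσ : σ.Coherent) (ts : List (Ty B)) (t : Ty B) :
    (t.subst (.instTy ts)).subst σ
      = (t.subst (σ.up ts.length)).subst (.instTy (ts.map (Ty.subst σ))) := by
  have := SSub.inst_comp hσ (ts.map .ty)
  rw [Ty.subst_subst, Ty.subst_subst, SSub.instTy, SSub.instTy, this]
  simp [Function.comp_def, SArg.subst]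

theorem Shp.subst_instTy {σ : SSub B} (hσ : σ.Coherent) (ts : List (Ty B)) (s : Shp) :
    (s.subst (SSub.instTy ts).dim (SSub.instTy ts).shape).subst σ.dim σ.shape
      = (s.subst (σ.up ts.length).dim (σ.up ts.length).shape).subst
        (SSub.instTy (ts.map (Ty.subst σ))).dim (SSub.instTy (ts.map (Ty.subst σ))).shape := by
  -- An array type with a dummy element type turns the law for types into the law for its shape
  -- component.
  have := Ty.subst_instTy hσ ts (.arr (.var 0) s)
  simp only [Ty.subst, Ty.arr.injEq] at this
  exact this.2

theorem Ty.subst_instIdx {σ : SSub B} (hσ : σ.Coherent) (is : List Idx) (t : Ty B) :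
    (t.subst (.instIdx is)).subst σ
      = (t.subst (σ.up is.length)).subst (.instIdx (is.map (Idx.subst σ.dim σ.shape))) := by
  have := SSub.inst_comp hσ (is.map Idx.toSArg)
  have e : SArg.subst σ ∘ Idx.toSArg = Idx.toSArg ∘ Idx.subst σ.dim σ.shape := by
    funext i; cases i <;> rfl
  rw [Ty.subst_subst, Ty.subst_subst, SSub.instIdx, SSub.instIdx, this]
  simp [e]

theorem Shp.subst_instIdx {σ : SSub B} (hσ : σ.Coherent) (is : List Idx) (s : Shp) :
    (s.subst (SSub.instIdx (B := B) is).dim (SSub.instIdx (B := B) is).shape).subst σ.dim σ.shape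
      = (s.subst (σ.up is.length).dim (σ.up is.length).shape).subst
        (SSub.instIdx (B := B) (is.map (Idx.subst σ.dim σ.shape))).dim
        (SSub.instIdx (B := B) (is.map (Idx.subst σ.dim σ.shape))).shape := by
  have := Ty.subst_instIdx hσ is (.arr (.var 0) s)
  simp only [Ty.subst, Ty.arr.injEq] at this
  exact this.2

end

end Remora

-- Denotations of shapes, type equivalence, kinding, and erased substitutions.

namespace Remora

/-! ### Equality of shapes -/

theorem Shp.eval_append (v : ℕ → ℕ) (w : ℕ → List ℕ) (s t : Shp) :
    (Shp.app [s, t]).eval v w = s.eval v w ++ t.eval v w := by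
  simp [Shp.eval, Shp.evalApp]

@[simp] theorem eval_lit (v : ℕ → ℕ) (w : ℕ → List ℕ) (ns : List ℕ) :
    (lit ns).eval v w = ns := by
  simp [lit, Shp.eval, Function.comp_def, Dim.eval]

theorem Shp.append_congr {s s' t t' : Shp} (h : s ≈ s') (h' : t ≈ t') :
    Shp.app [s, t] ≈ Shp.app [s', t'] := fun v w => by
  rw [Shp.eval_append, Shp.eval_append, h v w, h' v w]

theorem lit_append (ns ns' : List ℕ) : Shp.app [lit ns, lit ns'] ≈ lit (ns ++ ns') := fun v w => by
  simp [Shp.eval_append]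

theorem Shp.nil_append (s : Shp) : Shp.app [lit [], s] ≈ s := fun v w => by
  simp [Shp.eval_append]

theorem Shp.append_nil (s : Shp) : Shp.app [s, lit []] ≈ s := fun v w => by
  simp [Shp.eval_append]

theorem lit_injective {ns ns' : List ℕ} (h : lit ns ≈ lit ns') : ns = ns' := by
  simpa using h (fun _ => 0) (fun _ => [])

/-- Cancellation in the free monoid, valuation by valuation. It recovers the frame of an argument
from its whole shape and its cell shape. -/
theorem Shp.append_right_cancel {s s' t : Shp} (h : Shp.app [s, t] ≈ Shp.app [s', t]) : s ≈ s' :=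
  fun v w => by simpa [Shp.eval_append] using h v w

theorem Shp.subst_congr {s s' : Shp} (h : s ≈ s') (σ : ℕ → Dim) (θ : ℕ → Shp) :
    s.subst σ θ ≈ s'.subst σ θ := fun v w => by
  rw [Shp.eval_subst, Shp.eval_subst]; exact h _ _

@[simp] theorem lit_subst (ns : List ℕ) (σ : ℕ → Dim) (θ : ℕ → Shp) :
    (lit ns).subst σ θ = lit ns := by
  simp [lit, Shp.subst, Function.comp_def, Dim.subst]

theorem Shp.append_subst (s t : Shp) (σ : ℕ → Dim) (θ : ℕ → Shp) :
    (Shp.app [s, t]).subst σ θ = .app [s.subst σ θ, t.subst σ θ] := by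
  simp [Shp.subst]

/-! ### Well-sorted indices -/

theorem Dim.evalSum_congr {v v' : ℕ → ℕ} {ds : List Dim} (h : ∀ d ∈ ds, d.eval v = d.eval v') :
    Dim.evalSum v ds = Dim.evalSum v' ds := by
  induction ds <;> simp_all [Dim.evalSum]

theorem Shp.evalApp_congr {v v' : ℕ → ℕ} {w w' : ℕ → List ℕ} {ss : List Shp}
    (h : ∀ s ∈ ss, s.eval v w = s.eval v' w') : Shp.evalApp v w ss = Shp.evalApp v' w' ss := by
  induction ss <;> simp_all [Shp.evalApp]

theorem Dim.eval_le_evalSum {v : ℕ → ℕ} {d : Dim} {ds : List Dim} (h : d ∈ ds) :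
    d.eval v ≤ Dim.evalSum v ds := by
  induction ds with
  | nil => simp at h
  | cons a l ih =>
    rcases List.mem_cons.1 h with rfl | h
    · simp [Dim.evalSum]
    · have := ih h
      simp only [Dim.evalSum]; omega

theorem Shp.eval_sublist_evalApp {v : ℕ → ℕ} {w : ℕ → List ℕ} {s : Shp} {ss : List Shp}
    (h : s ∈ ss) : (s.eval v w).Sublist (Shp.evalApp v w ss) := by
  induction ss with
  | nil => simp at h
  | cons a l ih =>
    rcases List.mem_cons.1 h with rfl | h
    · exact List.sublist_append_left _ _
    · exact (ih h).trans (List.sublist_append_right _ _)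

theorem Dim.WS.eval_congr {Θ : SCtx} {v v' : ℕ → ℕ}
    (hv : ∀ i, Θ[i]? = some (.sort .dim) → v i = v' i) {d : Dim} (h : d.WS Θ) :
    d.eval v = d.eval v' := by
  induction d using Dim.ind with
  | hv i => exact hv i h
  | hn n => rfl
  | ha ds ih => exact Dim.evalSum_congr fun d hd => ih d hd ((Dim.wss_iff Θ ds).1 h d hd)

theorem Shp.WS.eval_congr {Θ : SCtx} {v v' : ℕ → ℕ} {w w' : ℕ → List ℕ}
    (hv : ∀ i, Θ[i]? = some (.sort .dim) → v i = v' i)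
    (hw : ∀ i, Θ[i]? = some (.sort .shape) → w i = w' i) {s : Shp} (h : s.WS Θ) :
    s.eval v w = s.eval v' w' := by
  induction s using Shp.ind with
  | hv i => exact hw i h
  | hs ds =>
    simp only [Shp.eval, Dim.evals_eq_map]
    exact List.map_congr_left fun d hd => Dim.WS.eval_congr hv ((Dim.wss_iff Θ ds).1 h d hd)
  | ha ss ih => exact Shp.evalApp_congr fun s hs => ih s hs ((Shp.wss_iff Θ ss).1 h s hs)

theorem Dim.exists_le_eval_of_not_ws {Θ : SCtx} {d : Dim} (h : ¬ d.WS Θ) :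
    ∃ i, Θ[i]? ≠ some (.sort .dim) ∧ ∀ v, v i ≤ d.eval v := by
  induction d using Dim.ind with
  | hv i => exact ⟨i, h, fun v => le_rfl⟩
  | hn n => exact absurd trivial h
  | ha ds ih =>
    simp only [Dim.WS, Dim.wss_iff, not_forall] at h
    obtain ⟨d, hd, h⟩ := h
    obtain ⟨i, hi, h⟩ := ih d hd h
    exact ⟨i, hi, fun v => (h v).trans (Dim.eval_le_evalSum hd)⟩

/-- Sums and appends never lose any of their parts, so an offending variable bounds the denotation
from below: a dimension variable through the sum of the entries, a shape variable through the
length. -/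
theorem Shp.exists_le_eval_of_not_ws {Θ : SCtx} {s : Shp} (h : ¬ s.WS Θ) :
    (∃ i, Θ[i]? ≠ some (.sort .dim) ∧ ∀ v w, v i ≤ (s.eval v w).sum) ∨
      ∃ i, Θ[i]? ≠ some (.sort .shape) ∧ ∀ v w, (w i).length ≤ (s.eval v w).length := by
  induction s using Shp.ind with
  | hv i => exact .inr ⟨i, h, fun v w => le_rfl⟩
  | hs ds =>
    simp only [Shp.WS, Dim.wss_iff, not_forall] at h
    obtain ⟨d, hd, h⟩ := h
    obtain ⟨i, hi, h⟩ := Dim.exists_le_eval_of_not_ws h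
    refine .inl ⟨i, hi, fun v w => (h v).trans ?_⟩
    rw [Shp.eval, Dim.evals_eq_map]
    exact List.single_le_sum (by simp) _ (List.mem_map_of_mem hd)
  | ha ss ih =>
    simp only [Shp.WS, Shp.wss_iff, not_forall] at h
    obtain ⟨s, hs, h⟩ := h
    rcases ih s hs h with ⟨i, hi, h⟩ | ⟨i, hi, h⟩
    · exact .inl ⟨i, hi, fun v w =>
        (h v w).trans ((Shp.eval_sublist_evalApp hs).sum_le_sum (by simp))⟩
    · exact .inr ⟨i, hi, fun v w =>
        (h v w).trans (Shp.eval_sublist_evalApp hs).length_le⟩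

/-- Equal shapes have the same free variables. -/
theorem Shp.WS.congr {Θ : SCtx} {s s' : Shp} (h : s.WS Θ) (e : s ≈ s') : s'.WS Θ := by
  by_contra h'
  rcases Shp.exists_le_eval_of_not_ws h' with ⟨i, hi, h'⟩ | ⟨i, hi, h'⟩
  -- The offending dimension variable gets a value one above the sum of the entries of `s` at the
  -- zero valuation. The well-sorted `s` cannot see this change, but the sum of the entries of `s'`
  -- is at least that value.
  · have h₁ := h' (Function.update 0 i ((s.eval 0 fun _ => []).sum + 1)) fun _ => []
    have h₂ : ∀ j, Θ[j]? = some (.sort .dim) →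
        Function.update (0 : ℕ → ℕ) i ((s.eval 0 fun _ => []).sum + 1) j = 0 :=
      fun j hj => Function.update_of_ne (by rintro rfl; exact hi hj) _ _
    rw [← e, h.eval_congr (v' := 0) (w' := fun _ => []) h₂ fun _ _ => rfl] at h₁
    simp at h₁
  -- The same argument with lengths: the offending shape variable gets a list one longer than the
  -- value of `s`.
  · have h₁ := h' 0 (Function.update (fun _ => []) i
      (List.replicate ((s.eval 0 fun _ => []).length + 1) 0))
    have h₂ : ∀ j, Θ[j]? = some (.sort .shape) → Function.update (fun _ => []) i
        (List.replicate ((s.eval 0 fun _ => []).length + 1) 0) j = (fun _ => []) j :=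
      fun j hj => Function.update_of_ne (by rintro rfl; exact hi hj) _ _
    rw [← e, h.eval_congr (v' := 0) (w' := fun _ => []) (fun _ _ => rfl) h₂] at h₁
    simp at h₁

/-- A closed shape denotes a literal. -/
theorem Shp.WS.exists_lit {s : Shp} (h : s.WS []) : ∃ ns, s ≈ lit ns :=
  ⟨s.eval 0 fun _ => [], fun v w => by
    rw [eval_lit]; exact h.eval_congr (fun i hi => by simp at hi) fun i hi => by simp at hi⟩

theorem Dim.WS.subst {Θ Θ' : SCtx} {σ : ℕ → Dim}
    (hσ : ∀ i, Θ[i]? = some (.sort .dim) → (σ i).WS Θ') {d : Dim} (h : d.WS Θ) :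
    (d.subst σ).WS Θ' := by
  induction d using Dim.ind with
  | hv i => exact hσ i h
  | hn n => trivial
  | ha ds ih =>
    simp only [Dim.WS, Dim.subst, Dim.wss_iff, Dim.substs_eq_map, List.forall_mem_map] at h ⊢
    exact fun d hd => ih d hd (h d hd)

theorem Shp.WS.subst {Θ Θ' : SCtx} {σ : ℕ → Dim} {θ : ℕ → Shp}
    (hσ : ∀ i, Θ[i]? = some (.sort .dim) → (σ i).WS Θ')
    (hθ : ∀ i, Θ[i]? = some (.sort .shape) → (θ i).WS Θ') {s : Shp} (h : s.WS Θ) :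
    (s.subst σ θ).WS Θ' := by
  induction s using Shp.ind with
  | hv i => exact hθ i h
  | hs ds =>
    simp only [Shp.WS, Shp.subst, Dim.wss_iff, Dim.substs_eq_map, List.forall_mem_map] at h ⊢
    exact fun d hd => Dim.WS.subst hσ (h d hd)
  | ha ds ih =>
    simp only [Shp.WS, Shp.subst, Shp.wss_iff, Shp.substs_eq_map, List.forall_mem_map] at h ⊢
    exact fun d hd => ih d hd (h d hd)

/-! ### Type equivalence -/

section
variable {B : Type}

theorem forall₂_of_zip {α β : Type} {R : α → β → Prop} {l : List α} {l' : List β}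
    (hl : l.length = l'.length) (h : ∀ p ∈ l.zip l', R p.1 p.2) : List.Forall₂ R l l' :=
  List.forall₂_iff_zip.2 ⟨hl, fun hp => h _ hp⟩

theorem forall₂_transfer {α β : Type} {P : α → Prop} {Q : β → Prop} {l : List α} {l' : List β}
    (h : List.Forall₂ (fun a b => P a → Q b) l l') (hP : ∀ a ∈ l, P a) : ∀ b ∈ l', Q b := by
  induction h with
  | nil => simp
  | cons h _ ih => simp_all

theorem forall₂_map_eq {α β γ : Type} {R : α → β → Prop} {f : α → γ} {g : β → γ}
    {l : List α} {l' : List β} (h : List.Forall₂ R l l') (hR : ∀ a b, R a b → f a = g b) :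
    l.map f = l'.map g := by
  induction h with
  | nil => rfl
  | cons h _ ih => simp [hR _ _ h, ih]

theorem TEqv.fn_forall₂ {ins ins' : List (Ty B)} {out out' : Ty B}
    (h : List.Forall₂ TEqv ins ins') (ho : TEqv out out') :
    TEqv (.fn ins out) (.fn ins' out') :=
  .fn h.length_eq (fun _ hp => (List.forall₂_iff_zip.1 h).2 hp) ho

theorem TEqv.fn_inv {ins : List (Ty B)} {out t : Ty B} (h : TEqv (.fn ins out) t) :
    ∃ ins' out', t = .fn ins' out' ∧ List.Forall₂ TEqv ins ins' ∧ TEqv out out' := by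
  cases h with
  | refl => exact ⟨_, _, rfl, List.forall₂_same.2 fun _ _ => .refl _, .refl _⟩
  | fn hl h ho => exact ⟨_, _, rfl, forall₂_of_zip hl h, ho⟩

theorem TEqv.arr_inv {t t' : Ty B} {s : Shp} (h : TEqv (.arr t s) t') :
    ∃ u s', t' = .arr u s' ∧ TEqv t u ∧ s ≈ s' := by
  cases h with
  | refl => exact ⟨_, _, rfl, .refl _, Setoid.refl _⟩
  | arr h hs => exact ⟨_, _, rfl, h, hs⟩

theorem TEqv.univ_inv {ks : List Kind} {t t' : Ty B} (h : TEqv (.univ ks t) t') :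
    ∃ u, t' = .univ ks u ∧ TEqv t u := by
  cases h with
  | refl => exact ⟨_, rfl, .refl _⟩
  | univ h => exact ⟨_, rfl, h⟩

theorem TEqv.pi_inv {γs : List IxSort} {t t' : Ty B} (h : TEqv (.pi γs t) t') :
    ∃ u, t' = .pi γs u ∧ TEqv t u := by
  cases h with
  | refl => exact ⟨_, rfl, .refl _⟩
  | pi h => exact ⟨_, rfl, h⟩

theorem TEqv.sigma_inv {γs : List IxSort} {t t' : Ty B} (h : TEqv (.sigma γs t) t') :
    ∃ u, t' = .sigma γs u ∧ TEqv t u := by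
  cases h with
  | refl => exact ⟨_, rfl, .refl _⟩
  | sigma h => exact ⟨_, rfl, h⟩

theorem TEqv.arr_arr {t t' : Ty B} {s s' : Shp} :
    TEqv (.arr t s) (.arr t' s') ↔ TEqv t t' ∧ s ≈ s' := by
  refine ⟨fun h => ?_, fun h => .arr h.1 h.2⟩
  obtain ⟨_, _, e, h₁, h₂⟩ := h.arr_inv
  cases e
  exact ⟨h₁, h₂⟩

theorem TEqv.fn_fn {ins ins' : List (Ty B)} {out out' : Ty B} :
    TEqv (.fn ins out) (.fn ins' out') ↔ List.Forall₂ TEqv ins ins' ∧ TEqv out out' := by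
  refine ⟨fun h => ?_, fun h => .fn_forall₂ h.1 h.2⟩
  obtain ⟨_, _, e, h₁, h₂⟩ := h.fn_inv
  cases e
  exact ⟨h₁, h₂⟩

theorem TEqv.symm {t t' : Ty B} (h : TEqv t t') : TEqv t' t := by
  induction h with
  | refl => exact .refl _
  | arr _ hs ih => exact .arr ih (Setoid.symm hs)
  | fn hl _ _ ih iho => exact .fn_forall₂ (forall₂_of_zip (R := fun a b => TEqv b a) hl ih).flip iho
  | univ _ ih => exact .univ ih
  | pi _ ih => exact .pi ih
  | sigma _ ih => exact .sigma ih

/-- Neither symmetry nor transitivity is a constructor of `TEqv`, so a derivation can be inverted by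
its outermost constructor. Both are recovered by induction, here by inverting the second derivation.
-/
theorem TEqv.trans {t t' t'' : Ty B} (h : TEqv t t') (h' : TEqv t' t'') : TEqv t t'' := by
  induction h generalizing t'' with
  | refl => exact h'
  | arr _ hs ih =>
    obtain ⟨u, s', rfl, hu, hs'⟩ := h'.arr_inv
    exact .arr (ih hu) (Setoid.trans hs hs')
  | fn hl h _ ih iho =>
    obtain ⟨u, s', rfl, hu, ho⟩ := h'.fn_inv
    have h₁ := forall₂_of_zip (R := fun a b => ∀ {c}, TEqv b c → TEqv a c) hl ih
    refine .fn_forall₂ ?_ (iho ho)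
    clear hl ih h' h
    induction h₁ generalizing u with
    | nil => cases hu; exact .nil
    | cons h _ ih => cases hu with | cons h₁ h₂ => exact .cons (h h₁) (ih _ h₂)
  | univ _ ih =>
    obtain ⟨u, rfl, hu⟩ := h'.univ_inv
    exact .univ (ih hu)
  | pi _ ih =>
    obtain ⟨u, rfl, hu⟩ := h'.pi_inv
    exact .pi (ih hu)
  | sigma _ ih =>
    obtain ⟨u, rfl, hu⟩ := h'.sigma_inv
    exact .sigma (ih hu)

theorem TEqv.subst {t t' : Ty B} (h : TEqv t t') (σ : SSub B) : TEqv (t.subst σ) (t'.subst σ) := by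
  induction h generalizing σ with
  | refl => exact .refl _
  | arr _ hs ih => exact .arr (ih σ) (Shp.subst_congr hs _ _)
  | fn hl _ _ ih iho =>
    simp only [Ty.subst, Ty.substs_eq_map]
    refine .fn_forall₂ ?_ (iho σ)
    rw [List.forall₂_map_left_iff, List.forall₂_map_right_iff]
    exact forall₂_of_zip hl fun p hp => ih p hp σ
  | univ _ ih => exact .univ (ih _)
  | pi _ ih => exact .pi (ih _)
  | sigma _ ih => exact .sigma (ih _)

theorem Shp.toE_eq_iff {s s' : Shp} : s.toE = s'.toE ↔ s ≈ s' :=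
  ⟨fun h => Quotient.exact h, fun h => Quotient.sound h⟩

/-- Equivalent types share their outermost constructor, and the shapes of equivalent array types lie
in one class, which is all that erasure records. -/
theorem TEqv.erase_eq {t t' : Ty B} (h : TEqv t t') : t.erase = t'.erase := by
  cases h with
  | arr _ hs => exact Shp.toE_eq_iff.2 hs
  | _ => rfl

theorem TEqv.argShapes_eq {t : Ty B} {s : Shp} {ins : List (Ty B)} {out : Ty B}
    (h : TEqv (.arr (.fn ins out) s) t) : argShapes t = ins.map Ty.erase := by
  obtain ⟨_, _, rfl, h, _⟩ := h.arr_inv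
  obtain ⟨_, _, rfl, h, _⟩ := h.fn_inv
  exact (forall₂_map_eq h fun _ _ h => h.erase_eq).symm

/-! ### Kinding -/

/-- The array case is the one with content: it rests on `Shp.WS.congr`. Inversion yields types only
up to equivalence, and the typing rules for literals ask for their kinds again. -/
theorem HasKind.congr {t t' : Ty B} {Θ : SCtx} {k : Kind} (hk : HasKind Θ t k)
    (h : TEqv t t') : HasKind Θ t' k := by
  induction h generalizing Θ k with
  | refl => exact hk
  | arr _ hs ih => cases hk with | arr h₁ h₂ => exact .arr (ih h₁) (h₂.congr hs)
  | fn hl _ _ ih iho =>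
    cases hk with
    | fn h₁ h₂ => exact .fn (forall₂_transfer (forall₂_of_zip hl fun p hp => ih p hp) h₁) (iho h₂)
  | univ _ ih => cases hk with | univ h => exact .univ (ih h)
  | pi _ ih => cases hk with | pi h => exact .pi (ih h)
  | sigma _ ih => cases hk with | sigma h => exact .sigma (ih h)

theorem upRen_spec {α : Type} {Θ Θ' : List α} {r : ℕ → ℕ}
    (hr : ∀ i s, Θ[i]? = some s → Θ'[r i]? = some s) (Ξ : List α) (i : ℕ) (s : α)
    (h : (Ξ ++ Θ)[i]? = some s) : (Ξ ++ Θ')[upRen Ξ.length r i]? = some s := by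
  by_cases hi : i < Ξ.length
  · rw [List.getElem?_append_left hi] at h
    simp only [upRen, hi, if_true]
    rw [List.getElem?_append_left hi, h]
  · rw [List.getElem?_append_right (by omega)] at h
    simp only [upRen, hi, if_false]
    rw [List.getElem?_append_right (by omega), Nat.add_sub_cancel]
    exact hr _ _ h

theorem HasKind.rename {Θ Θ' : SCtx} {t : Ty B} {k : Kind} (h : HasKind Θ t k) {r : ℕ → ℕ}
    (hr : ∀ i s, Θ[i]? = some s → Θ'[r i]? = some s) : HasKind Θ' (t.rename r) k := by
  induction h generalizing Θ' r with
  | var h => exact .var (hr _ _ h)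
  | base => exact .base
  | fn _ _ ih iho =>
    refine .fn ?_ (iho hr)
    simp only [Ty.renames_eq_map, List.forall_mem_map]
    exact fun t ht => ih t ht hr
  | @univ _ ks t _ ih =>
    refine .univ (ih ?_); simpa using upRen_spec hr (ks.map SEntry.kind)
  | @pi _ ks t _ ih =>
    refine .pi (ih ?_); simpa using upRen_spec hr (ks.map SEntry.sort)
  | @sigma _ ks t _ ih =>
    refine .sigma (ih ?_); simpa using upRen_spec hr (ks.map SEntry.sort)
  | arr _ hs ih =>
    refine .arr (ih hr) ?_
    rw [Shp.rename_eq_subst]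
    exact hs.subst (σ := fun i => .var (r i)) (θ := fun i => .var (r i))
      (fun i h => hr _ _ h) fun i h => hr _ _ h

/-- `σ` maps the static variables of `Θ` to indices and types over `Θ'`. -/
structure SSub.Typed (Θ Θ' : SCtx) (σ : SSub B) : Prop where
  dim : ∀ i, Θ[i]? = some (.sort .dim) → (σ.dim i).WS Θ'
  shape : ∀ i, Θ[i]? = some (.sort .shape) → (σ.shape i).WS Θ'
  ty : ∀ i k, Θ[i]? = some (.kind k) → HasKind Θ' (σ.ty i) k
  coherent : σ.Coherent

theorem SSub.Typed.ofRen {Θ Θ' : SCtx} {r : ℕ → ℕ}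
    (hr : ∀ i s, Θ[i]? = some s → Θ'[r i]? = some s) :
    (SSub.ofRen r : SSub B).Typed Θ Θ' :=
  ⟨fun _ h => hr _ _ h, fun _ h => hr _ _ h, fun _ _ h => .var (hr _ _ h), SSub.coherent_ofRen r⟩

theorem shift_spec {α : Type} (Ξ Θ : List α) (i : ℕ) (s : α) (h : Θ[i]? = some s) :
    (Ξ ++ Θ)[i + Ξ.length]? = some s := by
  rw [List.getElem?_append_right (by omega), Nat.add_sub_cancel, h]

theorem HasKind.shift {Θ : SCtx} {t : Ty B} {k : Kind} (h : HasKind Θ t k) (Ξ : SCtx) :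
    HasKind (Ξ ++ Θ) (t.shift Ξ.length) k :=
  h.rename (shift_spec Ξ Θ)

theorem SSub.Typed.up {Θ Θ' : SCtx} {σ : SSub B} (h : σ.Typed Θ Θ') (Ξ : SCtx) :
    (σ.up Ξ.length).Typed (Ξ ++ Θ) (Ξ ++ Θ') := by
  refine ⟨fun i hi => ?_, fun i hi => ?_, fun i k hi => ?_, h.coherent.up _⟩
  all_goals
    by_cases hl : i < Ξ.length
    · rw [List.getElem?_append_left hl, ← List.getElem?_append_left (l₂ := Θ') hl] at hi
      first
        | simp only [SSub.up, upDim, hl, if_true]; exact hi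
        | simp only [SSub.up, upShp, hl, if_true]; exact hi
        | simp only [SSub.up, hl, if_true]; exact .var hi
    rw [List.getElem?_append_right (by omega)] at hi
  · simp only [SSub.up, upDim, hl, if_false, Dim.rename_eq_subst]
    exact (h.dim _ hi).subst (σ := fun i => .var (i + Ξ.length)) fun i hi => shift_spec Ξ Θ' _ _ hi
  · simp only [SSub.up, upShp, hl, if_false, Shp.rename_eq_subst]
    exact (h.shape _ hi).subst (σ := fun i => .var (i + Ξ.length))
      (θ := fun i => .var (i + Ξ.length)) (fun i hi => shift_spec Ξ Θ' _ _ hi)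
      fun i hi => shift_spec Ξ Θ' _ _ hi
  · simp only [SSub.up, hl, if_false]
    exact (h.ty _ _ hi).shift Ξ

theorem HasKind.subst {Θ Θ' : SCtx} {t : Ty B} {k : Kind} (h : HasKind Θ t k) {σ : SSub B}
    (hσ : σ.Typed Θ Θ') : HasKind Θ' (t.subst σ) k := by
  induction h generalizing Θ' σ with
  | var h => exact hσ.ty _ _ h
  | base => exact .base
  | fn _ _ ih iho =>
    refine .fn ?_ (iho hσ)
    simp only [Ty.substs_eq_map, List.forall_mem_map]
    exact fun t ht => ih t ht hσ
  | @univ _ ks t _ ih => refine .univ (ih ?_); simpa using hσ.up (ks.map SEntry.kind)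
  | @pi _ ks t _ ih => refine .pi (ih ?_); simpa using hσ.up (ks.map SEntry.sort)
  | @sigma _ ks t _ ih => refine .sigma (ih ?_); simpa using hσ.up (ks.map SEntry.sort)
  | arr _ hs ih => exact .arr (ih hσ) (hs.subst hσ.dim hσ.shape)

/-- `σ` is the identity on the variables of `Θ`. -/
def SSub.FixesOn (Θ : SCtx) (σ : SSub B) : Prop :=
  ∀ i s, Θ[i]? = some s → σ.dim i = .var i ∧ σ.shape i = .var i ∧ σ.ty i = .var i

theorem SSub.FixesOn.up {Θ : SCtx} {σ : SSub B} (h : σ.FixesOn Θ) (Ξ : SCtx) :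
    (σ.up Ξ.length).FixesOn (Ξ ++ Θ) := by
  intro i s hi
  by_cases hl : i < Ξ.length
  · simp [SSub.up, upDim, upShp, hl]
  · rw [List.getElem?_append_right (by omega)] at hi
    have hl' : i - Ξ.length + Ξ.length = i := by omega
    simp [SSub.up, upDim, upShp, hl, h _ _ hi, Dim.rename, Shp.rename, Ty.rename, hl']

theorem Dim.WS.subst_eq {Θ : SCtx} {d : Dim} (h : d.WS Θ) {σ : SSub B} (hσ : σ.FixesOn Θ) :
    d.subst σ.dim = d := by
  induction d using Dim.ind with
  | hv i => exact (hσ i _ h).1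
  | hn n => rfl
  | ha ds ih =>
    simp only [Dim.subst, Dim.substs_eq_map, Dim.add.injEq]
    exact map_eq_self fun d hd => ih d hd ((Dim.wss_iff Θ ds).1 h d hd)

theorem Shp.WS.subst_eq {Θ : SCtx} {s : Shp} (h : s.WS Θ) {σ : SSub B} (hσ : σ.FixesOn Θ) :
    s.subst σ.dim σ.shape = s := by
  induction s using Shp.ind with
  | hv i => exact (hσ i _ h).2.1
  | hs ds =>
    simp only [Shp.subst, Dim.substs_eq_map, Shp.shp.injEq]
    exact map_eq_self fun d hd => ((Dim.wss_iff Θ ds).1 h d hd).subst_eq hσ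
  | ha ds ih =>
    simp only [Shp.subst, Shp.substs_eq_map, Shp.app.injEq]
    exact map_eq_self fun d hd => ih d hd ((Shp.wss_iff Θ ds).1 h d hd)

theorem HasKind.subst_eq {Θ : SCtx} {t : Ty B} {k : Kind} (h : HasKind Θ t k) {σ : SSub B}
    (hσ : σ.FixesOn Θ) : t.subst σ = t := by
  induction h generalizing σ with
  | var h => exact (hσ _ _ h).2.2
  | base => rfl
  | fn _ _ ih iho =>
    simp only [Ty.subst, Ty.substs_eq_map, iho hσ, map_eq_self fun t ht => ih t ht hσ]
  | @univ _ ks t _ ih =>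
    simp only [Ty.subst]; rw [ih]; simpa using hσ.up (ks.map SEntry.kind)
  | @pi _ ks t _ ih =>
    simp only [Ty.subst]; rw [ih]; simpa using hσ.up (ks.map SEntry.sort)
  | @sigma _ ks t _ ih =>
    simp only [Ty.subst]; rw [ih]; simpa using hσ.up (ks.map SEntry.sort)
  | arr _ hs ih => simp only [Ty.subst, ih hσ, hs.subst_eq hσ]

/-- The types of primitive operators are closed, so a substitution leaves the signature intact. -/
theorem HasKind.closed_subst {t : Ty B} {k : Kind} (h : HasKind [] t k) (σ : SSub B) :
    t.subst σ = t := h.subst_eq fun i s hi => by simp at hi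

theorem zip_mem {α β : Type} {l : List α} {l' : List β} {i : ℕ} (h : i < l.length)
    (h' : i < l'.length) : (l[i], l'[i]) ∈ l.zip l' :=
  List.mem_iff_getElem.2 ⟨i, by simp [h, h'], by simp⟩

theorem SSub.Typed.instTy {Θ : SCtx} {ts : List (Ty B)} {ks : List Kind}
    (hl : ts.length = ks.length) (h : ∀ p ∈ ts.zip ks, HasKind Θ p.1 p.2) :
    (SSub.instTy ts).Typed (ks.map .kind ++ Θ) Θ := by
  have key : ∀ i s, (ks.map SEntry.kind ++ Θ)[i]? = some s →
      (∃ (h : i < ts.length) (h' : i < ks.length), s = .kind ks[i]) ∨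
      (ts.length ≤ i ∧ Θ[i - ts.length]? = some s) := by
    intro i s hi
    by_cases hl' : i < ts.length
    · rw [List.getElem?_append_left (by simp; omega)] at hi
      simp [hl ▸ hl'] at hi
      exact .inl ⟨hl', hl ▸ hl', hi.symm⟩
    · rw [List.getElem?_append_right (by simp; omega)] at hi
      exact .inr ⟨by omega, by simpa [hl] using hi⟩
  refine ⟨fun i hi => ?_, fun i hi => ?_, fun i k hi => ?_, SSub.coherent_inst _⟩
  all_goals obtain ⟨h₁, h₂, h₃⟩ | ⟨h₁, h₂⟩ := key i _ hi
  · cases h₃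
  · simpa [SSub.instTy, SSub.inst, h₁, Dim.WS, Shp.WS] using h₂
  · cases h₃
  · simpa [SSub.instTy, SSub.inst, h₁, Dim.WS, Shp.WS] using h₂
  · cases h₃
    have := h (ts[i], ks[i]) (zip_mem h₁ h₂)
    simpa [SSub.instTy, SSub.inst, h₁, SArg.toTy] using this
  · simpa [SSub.instTy, SSub.inst, h₁] using .var h₂

theorem SSub.Typed.instIdx {Θ : SCtx} {is : List Idx} {γs : List IxSort}
    (hl : is.length = γs.length) (h : ∀ p ∈ is.zip γs, p.1.HasSort Θ p.2) :
    (SSub.instIdx is : SSub B).Typed (γs.map .sort ++ Θ) Θ := by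
  have key : ∀ i s, (γs.map SEntry.sort ++ Θ)[i]? = some s →
      (∃ (h : i < is.length) (γ : IxSort), is[i].HasSort Θ γ ∧ s = .sort γ) ∨
      (is.length ≤ i ∧ Θ[i - is.length]? = some s) := by
    intro i s hi
    by_cases hl' : i < is.length
    · rw [List.getElem?_append_left (by simp; omega)] at hi
      simp [hl ▸ hl'] at hi
      have := h (is[i], γs[i]) (zip_mem hl' (hl ▸ hl'))
      exact .inl ⟨hl', γs[i], this, hi.symm⟩
    · rw [List.getElem?_append_right (by simp; omega)] at hi
      exact .inr ⟨by omega, by simpa [hl] using hi⟩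
  refine ⟨fun i hi => ?_, fun i hi => ?_, fun i k hi => ?_, SSub.coherent_inst _⟩
  all_goals obtain ⟨h₁, γ, h₂, h₃⟩ | ⟨h₁, h₂⟩ := key i _ hi
  · cases h₃
    cases e : is[i] <;> simp [e, Idx.HasSort] at h₂
    simpa [SSub.instIdx, SSub.inst, h₁, e, Idx.toSArg, SArg.toDim] using h₂
  · simpa [SSub.instIdx, SSub.inst, h₁, Dim.WS, Shp.WS] using h₂
  · cases h₃
    cases e : is[i] <;> simp [e, Idx.HasSort] at h₂
    simpa [SSub.instIdx, SSub.inst, h₁, e, Idx.toSArg, SArg.toShape] using h₂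
  · simpa [SSub.instIdx, SSub.inst, h₁, Dim.WS, Shp.WS] using h₂
  · cases h₃
  · simpa [SSub.instIdx, SSub.inst, h₁] using .var h₂

/-! ### Erased substitutions -/

/-- Erasure of a static substitution. -/
def SSub.toE (σ : SSub B) : ESub := ⟨fun i => (σ.dim i).toE, fun i => (σ.shape i).toE⟩

/-- Erased substitution works with chosen representatives; they may be exchanged for the original
indices because only denotations count. -/
theorem Dim.out_toE_eval (v : ℕ → ℕ) (d : Dim) : (Quotient.out d.toE).eval v = d.eval v :=
  Quotient.exact (Quotient.out_eq d.toE) v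

theorem Shp.out_toE (s : Shp) : Quotient.out s.toE ≈ s := Quotient.exact (Quotient.out_eq s.toE)

theorem Dim.subst_toE (σ : SSub B) (d : Dim) : d.toE.subst σ.toE = (d.subst σ.dim).toE :=
  Quotient.sound fun v => by
    rw [Dim.eval_subst, Dim.eval_subst]; simp only [SSub.toE, Dim.out_toE_eval]

theorem Shp.subst_toE (σ : SSub B) (s : Shp) :
    s.toE.subst σ.toE = (s.subst σ.dim σ.shape).toE :=
  Quotient.sound fun v w => by
    rw [Shp.eval_subst, Shp.eval_subst]
    simp only [SSub.toE, Dim.out_toE_eval, Shp.out_toE _ v w]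

theorem Idx.subst_toE (σ : SSub B) (i : Idx) :
    i.toE.subst σ.toE = (i.subst σ.dim σ.shape).toE := by
  cases i <;> simp [Idx.toE, EIdx.subst, Idx.subst, Dim.subst_toE, Shp.subst_toE]

/-- The erased substitution has no type component. Coherence ensures that its shape component
already contains the erasure of whatever replaces a type variable. -/
theorem Ty.subst_erase {σ : SSub B} (hσ : σ.Coherent) (t : Ty B) :
    (t.subst σ).erase = t.erase.subst σ.toE := by
  rw [Ty.erase, Ty.rawShape_subst hσ, Ty.erase, Shp.subst_toE]

theorem SSub.toE_ofRen (r : ℕ → ℕ) : (SSub.ofRen r : SSub B).toE = .ofRen r := rfl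

theorem SSub.toE_up (k : ℕ) (σ : SSub B) : (σ.up k).toE = σ.toE.up k := by
  have h₁ (d : Dim) (r : ℕ → ℕ) : d.toE.subst (.ofRen r) = (d.rename r).toE := by
    rw [Dim.rename_eq_subst, ← SSub.toE_ofRen (B := B), Dim.subst_toE]; rfl
  have h₂ (s : Shp) (r : ℕ → ℕ) : s.toE.subst (.ofRen r) = (s.rename r).toE := by
    rw [Shp.rename_eq_subst, ← SSub.toE_ofRen (B := B), Shp.subst_toE]; rfl
  simp only [SSub.toE, SSub.up, ESub.up, upDim, upShp, h₁, h₂, ESub.mk.injEq]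
  constructor <;> (funext i; split <;> rfl)

/-- This is what makes an index application a faithful erasure of a type application: instantiating
type variables becomes instantiating shape variables with the erasures of the types. The defaults
used at the dimension sort agree on both sides. -/
theorem SSub.toE_instTy (ts : List (Ty B)) :
    (SSub.instTy ts).toE = .inst (ts.map fun t => .shape t.erase) := by
  simp only [SSub.toE, SSub.instTy, SSub.inst, ESub.inst, ESub.mk.injEq]
  constructor <;> (funext i; by_cases h : i < ts.length <;> simp [h]; rfl)

theorem SSub.toE_instIdx (is : List Idx) :
    (SSub.instIdx is : SSub B).toE = .inst (is.map Idx.toE) := by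
  simp only [SSub.toE, SSub.instIdx, SSub.inst, ESub.inst, ESub.mk.injEq]
  constructor <;>
  · funext i
    by_cases h : i < is.length
    · cases e : is[i] <;> simp [h, e] <;> rfl
    · simp [h]

theorem SSub.toE_id : (SSub.id : SSub B).toE = .id := rfl

end

end Remora

-- Explicit terms: values, renaming, and inversion of typing.

namespace Remora

section
variable {L : Lang}

/-! ### Lists of expressions and atoms -/

@[simp] theorem Expr.renames_eq_map (r q : ℕ → ℕ) (es : List (Expr L)) :
    Expr.renames r q es = es.map (Expr.rename r q) := by
  induction es <;> simp_all [Expr.renames]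

@[simp] theorem Atom.renames_eq_map (r q : ℕ → ℕ) (as : List (Atom L)) :
    Atom.renames r q as = as.map (Atom.rename r q) := by
  induction as <;> simp_all [Atom.renames]

@[simp] theorem Expr.substs_eq_map (σ : SSub L.Base) (ρ : TSub L) (es : List (Expr L)) :
    Expr.substs σ ρ es = es.map (Expr.subst σ ρ) := by
  induction es <;> simp_all [Expr.substs]

@[simp] theorem Atom.substs_eq_map (σ : SSub L.Base) (ρ : TSub L) (as : List (Atom L)) :
    Atom.substs σ ρ as = as.map (Atom.subst σ ρ) := by
  induction as <;> simp_all [Atom.substs]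

@[simp] theorem Expr.erases_eq_map (es : List (Expr L)) :
    Expr.erases es = es.map Expr.erase := by
  induction es <;> simp_all [Expr.erases]

@[simp] theorem Atom.erases_eq_map (as : List (Atom L)) :
    Atom.erases as = as.map Atom.erase := by
  induction as <;> simp_all [Atom.erases]

@[simp] theorem EExpr.renames_eq_map (r q : ℕ → ℕ) (es : List (EExpr L)) :
    EExpr.renames r q es = es.map (EExpr.rename r q) := by
  induction es <;> simp_all [EExpr.renames]

@[simp] theorem EAtom.renames_eq_map (r q : ℕ → ℕ) (as : List (EAtom L)) :
    EAtom.renames r q as = as.map (EAtom.rename r q) := by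
  induction as <;> simp_all [EAtom.renames]

@[simp] theorem EArg.renames_eq_map (r q : ℕ → ℕ) (as : List (EArg L)) :
    EArg.renames r q as = as.map (EArg.rename r q) := by
  induction as <;> simp_all [EArg.renames]

@[simp] theorem EExpr.substs_eq_map (σ : ESub) (ρ : ETSub L) (es : List (EExpr L)) :
    EExpr.substs σ ρ es = es.map (EExpr.subst σ ρ) := by
  induction es <;> simp_all [EExpr.substs]

@[simp] theorem EAtom.substs_eq_map (σ : ESub) (ρ : ETSub L) (as : List (EAtom L)) :
    EAtom.substs σ ρ as = as.map (EAtom.subst σ ρ) := by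
  induction as <;> simp_all [EAtom.substs]

@[simp] theorem EArg.substs_eq_map (σ : ESub) (ρ : ETSub L) (as : List (EArg L)) :
    EArg.substs σ ρ as = as.map (EArg.subst σ ρ) := by
  induction as <;> simp_all [EArg.substs]

@[simp] theorem Atom.areVals_iff (as : List (Atom L)) : Atom.AreVals as ↔ ∀ a ∈ as, a.IsVal := by
  induction as <;> simp_all [Atom.AreVals]

@[simp] theorem EAtom.areVals_iff (as : List (EAtom L)) :
    EAtom.AreVals as ↔ ∀ a ∈ as, a.IsVal := by
  induction as <;> simp_all [EAtom.AreVals]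

/-! ### Induction on terms -/

section
variable {P : Expr L → Prop} {Q : Atom L → Prop}

mutual
theorem Expr.ind (hvar : ∀ x τ, P (.var x τ))
    (harr : ∀ ns as τ, (∀ a ∈ as, Q a) → P (.array ns as τ))
    (hfr : ∀ ns es τ, (∀ e ∈ es, P e) → P (.frame ns es τ))
    (happ : ∀ f es τ, P f → (∀ e ∈ es, P e) → P (.app f es τ))
    (htapp : ∀ f ts τ, P f → P (.tapp f ts τ)) (hiapp : ∀ f is τ, P f → P (.iapp f is τ))
    (hunb : ∀ k s b τb τ, P s → P b → P (.unbox k s b τb τ))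
    (hconst : ∀ c τ, Q (.const c τ)) (hop : ∀ o τ, Q (.op o τ))
    (hlam : ∀ τs e τ, P e → Q (.lam τs e τ)) (htlam : ∀ ks e τ, P e → Q (.tlam ks e τ))
    (hilam : ∀ γs e τ, P e → Q (.ilam γs e τ)) (hbox : ∀ is e τσ τ, P e → Q (.box is e τσ τ)) :
    ∀ e, P e
  | .var x τ => hvar x τ
  | .array ns as τ => harr ns as τ
    (Atom.ind_list hvar harr hfr happ htapp hiapp hunb hconst hop hlam htlam hilam hbox as)
  | .frame ns es τ => hfr ns es τ
    (Expr.ind_list hvar harr hfr happ htapp hiapp hunb hconst hop hlam htlam hilam hbox es)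
  | .app f es τ => happ f es τ
    (Expr.ind hvar harr hfr happ htapp hiapp hunb hconst hop hlam htlam hilam hbox f)
    (Expr.ind_list hvar harr hfr happ htapp hiapp hunb hconst hop hlam htlam hilam hbox es)
  | .tapp f ts τ => htapp f ts τ
    (Expr.ind hvar harr hfr happ htapp hiapp hunb hconst hop hlam htlam hilam hbox f)
  | .iapp f is τ => hiapp f is τ
    (Expr.ind hvar harr hfr happ htapp hiapp hunb hconst hop hlam htlam hilam hbox f)
  | .unbox k s b τb τ => hunb k s b τb τ
    (Expr.ind hvar harr hfr happ htapp hiapp hunb hconst hop hlam htlam hilam hbox s)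
    (Expr.ind hvar harr hfr happ htapp hiapp hunb hconst hop hlam htlam hilam hbox b)
theorem Atom.ind (hvar : ∀ x τ, P (.var x τ))
    (harr : ∀ ns as τ, (∀ a ∈ as, Q a) → P (.array ns as τ))
    (hfr : ∀ ns es τ, (∀ e ∈ es, P e) → P (.frame ns es τ))
    (happ : ∀ f es τ, P f → (∀ e ∈ es, P e) → P (.app f es τ))
    (htapp : ∀ f ts τ, P f → P (.tapp f ts τ)) (hiapp : ∀ f is τ, P f → P (.iapp f is τ))
    (hunb : ∀ k s b τb τ, P s → P b → P (.unbox k s b τb τ))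
    (hconst : ∀ c τ, Q (.const c τ)) (hop : ∀ o τ, Q (.op o τ))
    (hlam : ∀ τs e τ, P e → Q (.lam τs e τ)) (htlam : ∀ ks e τ, P e → Q (.tlam ks e τ))
    (hilam : ∀ γs e τ, P e → Q (.ilam γs e τ)) (hbox : ∀ is e τσ τ, P e → Q (.box is e τσ τ)) :
    ∀ a, Q a
  | .const c τ => hconst c τ
  | .op o τ => hop o τ
  | .lam τs e τ => hlam τs e τ
    (Expr.ind hvar harr hfr happ htapp hiapp hunb hconst hop hlam htlam hilam hbox e)
  | .tlam ks e τ => htlam ks e τ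
    (Expr.ind hvar harr hfr happ htapp hiapp hunb hconst hop hlam htlam hilam hbox e)
  | .ilam γs e τ => hilam γs e τ
    (Expr.ind hvar harr hfr happ htapp hiapp hunb hconst hop hlam htlam hilam hbox e)
  | .box is e τσ τ => hbox is e τσ τ
    (Expr.ind hvar harr hfr happ htapp hiapp hunb hconst hop hlam htlam hilam hbox e)
theorem Expr.ind_list (hvar : ∀ x τ, P (.var x τ))
    (harr : ∀ ns as τ, (∀ a ∈ as, Q a) → P (.array ns as τ))
    (hfr : ∀ ns es τ, (∀ e ∈ es, P e) → P (.frame ns es τ))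
    (happ : ∀ f es τ, P f → (∀ e ∈ es, P e) → P (.app f es τ))
    (htapp : ∀ f ts τ, P f → P (.tapp f ts τ)) (hiapp : ∀ f is τ, P f → P (.iapp f is τ))
    (hunb : ∀ k s b τb τ, P s → P b → P (.unbox k s b τb τ))
    (hconst : ∀ c τ, Q (.const c τ)) (hop : ∀ o τ, Q (.op o τ))
    (hlam : ∀ τs e τ, P e → Q (.lam τs e τ)) (htlam : ∀ ks e τ, P e → Q (.tlam ks e τ))
    (hilam : ∀ γs e τ, P e → Q (.ilam γs e τ)) (hbox : ∀ is e τσ τ, P e → Q (.box is e τσ τ)) :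
    ∀ es : List (Expr L), ∀ e ∈ es, P e
  | [] => by simp
  | e :: es => List.forall_mem_cons.2
    ⟨Expr.ind hvar harr hfr happ htapp hiapp hunb hconst hop hlam htlam hilam hbox e,
      Expr.ind_list hvar harr hfr happ htapp hiapp hunb hconst hop hlam htlam hilam hbox es⟩
theorem Atom.ind_list (hvar : ∀ x τ, P (.var x τ))
    (harr : ∀ ns as τ, (∀ a ∈ as, Q a) → P (.array ns as τ))
    (hfr : ∀ ns es τ, (∀ e ∈ es, P e) → P (.frame ns es τ))
    (happ : ∀ f es τ, P f → (∀ e ∈ es, P e) → P (.app f es τ))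
    (htapp : ∀ f ts τ, P f → P (.tapp f ts τ)) (hiapp : ∀ f is τ, P f → P (.iapp f is τ))
    (hunb : ∀ k s b τb τ, P s → P b → P (.unbox k s b τb τ))
    (hconst : ∀ c τ, Q (.const c τ)) (hop : ∀ o τ, Q (.op o τ))
    (hlam : ∀ τs e τ, P e → Q (.lam τs e τ)) (htlam : ∀ ks e τ, P e → Q (.tlam ks e τ))
    (hilam : ∀ γs e τ, P e → Q (.ilam γs e τ)) (hbox : ∀ is e τσ τ, P e → Q (.box is e τσ τ)) :
    ∀ as : List (Atom L), ∀ a ∈ as, Q a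
  | [] => by simp
  | a :: as => List.forall_mem_cons.2
    ⟨Atom.ind hvar harr hfr happ htapp hiapp hunb hconst hop hlam htlam hilam hbox a,
      Atom.ind_list hvar harr hfr happ htapp hiapp hunb hconst hop hlam htlam hilam hbox as⟩
end

end

/-! ### Values -/

theorem Expr.isVal_erase (e : Expr L) : e.erase.IsVal ↔ e.IsVal := by
  induction e using Expr.ind (Q := fun a : Atom L => a.erase.IsVal ↔ a.IsVal) <;>
    simp_all [Expr.erase, Expr.IsVal, EExpr.IsVal, Atom.erase, Atom.IsVal, EAtom.IsVal]

theorem Atom.isVal_erase (a : Atom L) : a.erase.IsVal ↔ a.IsVal := by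
  cases a <;> simp [Atom.erase, Atom.IsVal, EAtom.IsVal, Expr.isVal_erase]

/-- A value is an array literal, never a variable, so no substitution can destroy it. The typing
rules for type and index abstractions require their bodies to be values. -/
theorem Expr.IsVal.subst {e : Expr L} (h : e.IsVal) (σ : SSub L.Base) (ρ : TSub L) :
    (e.subst σ ρ).IsVal := by
  induction e using Expr.ind (Q := fun a : Atom L => a.IsVal → (a.subst σ ρ).IsVal) <;>
    simp_all [Expr.subst, Expr.IsVal, Atom.subst, Atom.IsVal]

/-! ### Renaming -/

theorem TSub.up_inl (k m : ℕ) (q : ℕ → ℕ) :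
    TSub.up (L := L) k m (fun x => .inl (q x)) = fun x => .inl (upRen m q x) := by
  funext i
  by_cases h : i < m <;> simp [TSub.up, upRen, h]

theorem upRen_zero (q : ℕ → ℕ) : upRen 0 q = q := by
  funext i; simp [upRen]

theorem Idx.rename_eq_subst (r : ℕ → ℕ) (i : Idx) :
    i.rename r = i.subst (fun i => .var (r i)) fun i => .var (r i) := by
  cases i <;> simp [Idx.rename, Idx.subst, Dim.rename_eq_subst, Shp.rename_eq_subst]

theorem Expr.rename_eq_subst (r q : ℕ → ℕ) (e : Expr L) :
    e.rename r q = e.subst (.ofRen r) fun x => .inl (q x) := by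
  induction e using Expr.ind (Q := fun a : Atom L => ∀ r q,
      a.rename r q = a.subst (.ofRen r) fun x => .inl (q x)) generalizing r q <;>
    simp_all [Expr.rename, Expr.subst, Atom.rename, Atom.subst, SSub.up_ofRen, TSub.up_inl,
      Ty.rename_eq_subst, upRen_zero, Idx.rename_eq_subst]
  · intros; rfl
  · exact fun _ _ => rfl

theorem Expr.tag_rename (r q : ℕ → ℕ) (e : Expr L) : (e.rename r q).tag = e.tag.rename r := by
  cases e <;> simp [Expr.rename, Expr.tag]

theorem Ty.rename_erase {B : Type} (r : ℕ → ℕ) (t : Ty B) :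
    (t.rename r).erase = t.erase.subst (.ofRen r) := by
  rw [Ty.rename_eq_subst, Ty.subst_erase (SSub.coherent_ofRen r), SSub.toE_ofRen]

theorem argShapes_rename {B : Type} (r : ℕ → ℕ) (t : Ty B) :
    argShapes (t.rename r) = (argShapes t).map (EShp.subst (.ofRen r)) := by
  cases t with
  | arr t s => cases t <;> simp [Ty.rename, argShapes, Ty.rename_erase]
  | _ => simp [Ty.rename, argShapes]

/-- The condition `hG` concerns the default shape that `Expr.eraseArgs` uses once the list of
annotations is exhausted; as a closed literal it is fixed by every substitution. -/
theorem Expr.eraseArgs_map {F : Expr L → Expr L} {G : EShp → EShp} {H : EArg L → EArg L}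
    {es : List (Expr L)} (h : ∀ e ∈ es, ∀ s, EArg.mk (F e).erase (G s) = H (.mk e.erase s))
    (hG : G (lit []).toE = (lit []).toE) (ss : List EShp) :
    Expr.eraseArgs (es.map F) (ss.map G) = (Expr.eraseArgs es ss).map H := by
  induction es generalizing ss with
  | nil => rfl
  | cons e es ih =>
    simp only [List.map_cons, Expr.eraseArgs, ← h e (by simp)]
    rw [← ih fun e he => h e (by simp [he])]
    cases ss <;> simp [hG]

theorem lit_toE_subst (σ : SSub L.Base) (ns : List ℕ) :
    (lit ns).toE.subst σ.toE = (lit ns).toE := by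
  rw [Shp.subst_toE, lit_subst]

theorem Idx.rename_toE (r : ℕ → ℕ) (i : Idx) : (i.rename r).toE = i.toE.subst (.ofRen r) := by
  -- Indices do not involve base types, so an arbitrary set of base types serves for the
  -- substitution.
  rw [Idx.rename_eq_subst, ← SSub.toE_ofRen (B := Unit), Idx.subst_toE]; rfl

theorem Expr.erase_rename (r q : ℕ → ℕ) (e : Expr L) :
    (e.rename r q).erase = e.erase.rename r q := by
  induction e using Expr.ind (Q := fun a : Atom L => ∀ r q,
      (a.rename r q).erase = a.erase.rename r q) generalizing r q with
  | happ f es τ hf hes =>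
    simp only [Expr.rename, Expr.erase, EExpr.rename, hf, Ty.rename_erase, Expr.tag_rename,
      argShapes_rename, Expr.renames_eq_map, EArg.renames_eq_map]
    rw [Expr.eraseArgs_map (H := EArg.rename r q)]
    · exact fun e he s => by rw [EArg.rename, hes e he]
    · exact lit_toE_subst (L := L) (.ofRen r) []
  | _ => simp_all [Expr.rename, Expr.erase, EExpr.rename, Atom.rename, Atom.erase, EAtom.rename,
      Ty.rename_erase, Idx.rename_toE, EIdx.subst]

/-- Erasure of a substitution for term variables. -/
def TSub.toE (ρ : TSub L) : ETSub L := fun i => (ρ i).map (fun x => x) Expr.erase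

theorem TSub.toE_up (k m : ℕ) (ρ : TSub L) : (ρ.up k m).toE = ρ.toE.up k m := by
  funext i
  by_cases h : i < m
  · simp [TSub.toE, TSub.up, ETSub.up, h]
  · simp only [TSub.toE, TSub.up, ETSub.up, h, if_false]
    cases ρ (i - m) <;> simp [Expr.erase_rename]

theorem TSub.toE_id : (TSub.id : TSub L).toE = .id := rfl

theorem TSub.toE_inst (es : List (Expr L)) : (TSub.inst es).toE = .inst (es.map Expr.erase) := by
  funext i
  simp only [TSub.toE, TSub.inst, ETSub.inst, List.getElem?_map, List.length_map]
  cases es[i]? <;> rfl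

/-! ### Inversion of typing -/

/-- The premises of the syntax-directed typing rule for an expression. -/
def Expr.Inv (Θ : SCtx) (Γ : List L.Ty) : Expr L → Prop
  | .var x τ => ∃ τx, Γ[x]? = some τx ∧ TEqv τx τ
  | .array ns as τ => ∃ τa, HasKind Θ τa .atom ∧ (∀ a ∈ as, AHasTy Θ Γ a τa) ∧
      as.length = ns.prod ∧ TEqv (.arr τa (lit ns)) τ
  | .frame ns es τ => ∃ τc ιc, HasKind Θ (.arr τc ιc) .array ∧
      (∀ e ∈ es, HasTy Θ Γ e (.arr τc ιc)) ∧ es.length = ns.prod ∧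
      TEqv (.arr τc (.app [lit ns, ιc])) τ
  | .app f es τ => ∃ (ins : List (L.Ty × Shp)) (ιas : List Shp) (τo : L.Ty) (ιf ιo ιp : Shp),
      HasTy Θ Γ f (.arr (.fn (ins.map fun p => .arr p.1 p.2) (.arr τo ιo)) ιf) ∧
      es.length = ins.length ∧ ιas.length = ins.length ∧
      (∀ p ∈ es.zip (ins.zip ιas), HasTy Θ Γ p.1 (.arr p.2.1.1 (.app [p.2.2, p.2.1.2]))) ∧
      IsMaxShape ιp (ιf :: ιas) ∧ TEqv (.arr τo (.app [ιp, ιo])) τ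
  | .tapp f ts τ => ∃ ks τu ιu ιf, HasTy Θ Γ f (.arr (.univ ks (.arr τu ιu)) ιf) ∧
      ts.length = ks.length ∧ (∀ p ∈ ts.zip ks, HasKind Θ p.1 p.2) ∧
      TEqv (.arr (τu.subst (.instTy ts))
        (.app [ιf, ιu.subst (SSub.instTy ts).dim (SSub.instTy ts).shape])) τ
  | .iapp f is τ => ∃ γs τp ιp ιf, HasTy Θ Γ f (.arr (.pi γs (.arr τp ιp)) ιf) ∧
      is.length = γs.length ∧ (∀ p ∈ is.zip γs, p.1.HasSort Θ p.2) ∧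
      TEqv (.arr (τp.subst (.instIdx is))
        (.app [ιf, ιp.subst (SSub.instIdx (B := L.Base) is).dim
          (SSub.instIdx (B := L.Base) is).shape])) τ
  | .unbox k s b τb τ => ∃ γs τs τb' ιs ιb, k = γs.length ∧ τb = .arr τb' ιb ∧
      HasTy Θ Γ s (.arr (.sigma γs τs) ιs) ∧
      HasTy (γs.map .sort ++ Θ) (τs :: Γ.map (Ty.shift γs.length)) b
        ((Ty.arr τb' ιb).shift γs.length) ∧
      HasKind Θ (.arr τb' ιb) .array ∧ TEqv (.arr τb' (.app [ιs, ιb])) τ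

/-- The syntax-directed rules compare the computed type with the tag, and conversion changes neither
the premises nor the tag. The second component then says that all types of an expression are
equivalent to its tag, hence to each other. -/
theorem HasTy.inv {Θ : SCtx} {Γ : List L.Ty} {e : Expr L} {τ : L.Ty} (h : HasTy Θ Γ e τ) :
    e.Inv Θ Γ ∧ TEqv e.tag τ := by
  induction h using HasTy.rec (motive_2 := fun _ _ _ _ _ => True) with
  | eqv _ h' ih => exact ⟨ih.1, ih.2.trans h'⟩
  | var h h' => exact ⟨⟨_, h, h'⟩, .refl _⟩
  | array h₁ h₂ h₃ h₄ => exact ⟨⟨_, h₁, h₂, h₃, h₄⟩, .refl _⟩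
  | frame h₁ h₂ h₃ h₄ => exact ⟨⟨_, _, h₁, h₂, h₃, h₄⟩, .refl _⟩
  | app h₁ h₂ h₃ h₄ h₅ h₆ => exact ⟨⟨_, _, _, _, _, _, h₁, h₂, h₃, h₄, h₅, h₆⟩, .refl _⟩
  | tapp h₁ h₂ h₃ h₄ => exact ⟨⟨_, _, _, _, h₁, h₂, h₃, h₄⟩, .refl _⟩
  | iapp h₁ h₂ h₃ h₄ => exact ⟨⟨_, _, _, _, h₁, h₂, h₃, h₄⟩, .refl _⟩
  | unbox h₁ h₂ h₃ h₄ => exact ⟨⟨_, _, _, _, _, rfl, rfl, h₁, h₂, h₃, h₄⟩, .refl _⟩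
  | _ => trivial

/-- The premises of the syntax-directed typing rule for an atom. -/
def Atom.Inv (Θ : SCtx) (Γ : List L.Ty) : Atom L → L.Ty → Prop
  | .const c _, τ => TEqv (.base (L.constTy c)) τ
  | .op o _, τ => TEqv (L.sig o) τ
  | .lam τs e _, τ => ∃ τo, (∀ t ∈ τs, HasKind Θ t .array) ∧ HasTy Θ (τs ++ Γ) e τo ∧
      TEqv (.fn τs τo) τ
  | .tlam ks e _, τ => ∃ τb, e.IsVal ∧
      HasTy (ks.map .kind ++ Θ) (Γ.map (Ty.shift ks.length)) e τb ∧ TEqv (.univ ks τb) τ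
  | .ilam γs e _, τ => ∃ τb, e.IsVal ∧
      HasTy (γs.map .sort ++ Θ) (Γ.map (Ty.shift γs.length)) e τb ∧ TEqv (.pi γs τb) τ
  | .box is e τσ τx, τ => ∃ γs τb, τσ = .sigma γs τb ∧ is.length = γs.length ∧
      (∀ p ∈ is.zip γs, p.1.HasSort Θ p.2) ∧ HasKind Θ (.sigma γs τb) .atom ∧
      HasTy Θ Γ e (τb.subst (.instIdx is)) ∧ TEqv (.sigma γs τb) τx ∧ TEqv (.sigma γs τb) τ

/-- A conversion is absorbed into the equivalence at the end of `Atom.Inv`. That is why this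
predicate, unlike `Expr.Inv`, takes the type as an argument. A box keeps the equivalence with its
tag as well. -/
theorem AHasTy.inv {Θ : SCtx} {Γ : List L.Ty} {a : Atom L} {τ : L.Ty} (h : AHasTy Θ Γ a τ) :
    a.Inv Θ Γ τ := by
  induction h using AHasTy.rec (motive_1 := fun _ _ _ _ _ => True)
  case eqv => trivial
  case eqv Θ Γ a τ τ' h h' ih =>
    cases a with
    | const => exact TEqv.trans ih h'
    | op => exact TEqv.trans ih h'
    | lam => obtain ⟨_, h₁, h₂, h₃⟩ := ih; exact ⟨_, h₁, h₂, h₃.trans h'⟩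
    | tlam => obtain ⟨_, h₁, h₂, h₃⟩ := ih; exact ⟨_, h₁, h₂, h₃.trans h'⟩
    | ilam => obtain ⟨_, h₁, h₂, h₃⟩ := ih; exact ⟨_, h₁, h₂, h₃.trans h'⟩
    | box =>
      obtain ⟨_, _, h₁, h₂, h₃, h₄, h₅, h₆, h₇⟩ := ih
      exact ⟨_, _, h₁, h₂, h₃, h₄, h₅, h₆, h₇.trans h'⟩
  case const h => exact h
  case op h => exact h
  case lam h₁ h₂ h₃ _ => exact ⟨_, h₁, h₂, h₃⟩
  case tlam h₁ h₂ h₃ _ => exact ⟨_, h₁, h₂, h₃⟩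
  case ilam h₁ h₂ h₃ _ => exact ⟨_, h₁, h₂, h₃⟩
  case box h₁ h₂ h₃ h₄ h₅ _ => exact ⟨_, _, rfl, h₁, h₂, h₃, h₄, h₅, h₅⟩
  all_goals trivial

theorem exists_of_length_eq_zip {α β : Type} {l : List α} {l' : List β}
    (h : l.length = l'.length) {b : β} (hb : b ∈ l') : ∃ a, (a, b) ∈ l.zip l' := by
  obtain ⟨i, hi, rfl⟩ := List.mem_iff_getElem.1 hb
  exact ⟨l[i], zip_mem (h ▸ hi) hi⟩

end

end Remora

-- The substitution lemma, with commutation of erasure.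

namespace Remora

section
variable {L : Lang}

/-! ### Substitution preserves typing and commutes with erasure -/

theorem IsMaxShape.subst {m : Shp} {ss : List Shp} (h : IsMaxShape m ss) (σ : ℕ → Dim)
    (θ : ℕ → Shp) : IsMaxShape (m.subst σ θ) (ss.map (Shp.subst σ θ)) := by
  refine ⟨List.mem_map_of_mem h.1, ?_⟩
  simp only [List.forall_mem_map]
  intro s hs
  obtain ⟨r, hr⟩ := h.2 s hs
  refine ⟨r.subst σ θ, ?_⟩
  rw [← Shp.append_subst]
  exact Shp.subst_congr hr σ θ

/-- A class `P` of typed substitutions that is closed under passing below binders. -/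
structure SubstClass
    (P : SCtx → List L.Ty → SCtx → List L.Ty → SSub L.Base → TSub L → Prop) : Prop where
  typed : ∀ {Θ Γ Θ' Γ' σ ρ}, P Θ Γ Θ' Γ' σ ρ → σ.Typed Θ Θ'
  var : ∀ {Θ Γ Θ' Γ' σ ρ}, P Θ Γ Θ' Γ' σ ρ → ∀ {x τ}, Γ[x]? = some τ →
    (∃ y, ρ x = .inl y ∧ Γ'[y]? = some (τ.subst σ)) ∨
      ∃ e, ρ x = .inr e ∧ HasTy Θ' Γ' e (τ.subst σ)
  up : ∀ {Θ Γ Θ' Γ' σ ρ} (Ξ : SCtx) (Δ : List L.Ty), P Θ Γ Θ' Γ' σ ρ →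
    P (Ξ ++ Θ) (Δ ++ Γ.map (Ty.shift Ξ.length)) (Ξ ++ Θ')
      (Δ.map (Ty.subst (σ.up Ξ.length)) ++ Γ'.map (Ty.shift Ξ.length))
      (σ.up Ξ.length) (ρ.up Ξ.length Δ.length)

theorem SubstClass.up_kinds {P : SCtx → List L.Ty → SCtx → List L.Ty → SSub L.Base → TSub L → Prop}
    (hP : SubstClass P) {Θ Γ Θ' Γ' σ ρ} (h : P Θ Γ Θ' Γ' σ ρ) (ks : List Kind) :
    P (ks.map .kind ++ Θ) (Γ.map (Ty.shift ks.length)) (ks.map .kind ++ Θ')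
      (Γ'.map (Ty.shift ks.length)) (σ.up ks.length) (ρ.up ks.length 0) := by
  simpa using hP.up (ks.map .kind) [] h

theorem SubstClass.up_sorts {P : SCtx → List L.Ty → SCtx → List L.Ty → SSub L.Base → TSub L → Prop}
    (hP : SubstClass P) {Θ Γ Θ' Γ' σ ρ} (h : P Θ Γ Θ' Γ' σ ρ) (γs : List IxSort)
    (Δ : List L.Ty) :
    P (γs.map .sort ++ Θ) (Δ ++ Γ.map (Ty.shift γs.length)) (γs.map .sort ++ Θ')
      (Δ.map (Ty.subst (σ.up γs.length)) ++ Γ'.map (Ty.shift γs.length))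
      (σ.up γs.length) (ρ.up γs.length Δ.length) := by
  simpa using hP.up (γs.map .sort) Δ h

theorem SubstClass.up_terms {P : SCtx → List L.Ty → SCtx → List L.Ty → SSub L.Base → TSub L → Prop}
    (hP : SubstClass P) {Θ Γ Θ' Γ' σ ρ} (h : P Θ Γ Θ' Γ' σ ρ) (Δ : List L.Ty) :
    P Θ (Δ ++ Γ) Θ' (Δ.map (Ty.subst σ) ++ Γ') σ (ρ.up 0 Δ.length) := by
  simpa [SSub.up_zero, show (Ty.shift 0 : L.Ty → L.Ty) = id from funext Ty.shift_zero]
    using hP.up [] Δ h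

theorem Ty.subst_fn_arr (σ : SSub L.Base) (ins : List (L.Ty × Shp)) :
    (ins.map fun p => Ty.arr p.1 p.2).map (Ty.subst σ)
      = (ins.map fun p => (p.1.subst σ, p.2.subst σ.dim σ.shape)).map fun p => Ty.arr p.1 p.2 := by
  simp [Ty.subst]

/-- The tag is only equivalent to the function type, but equivalent input types have the same
erasure. Hence the annotations of an application depend on the type of its function alone. -/
theorem HasTy.argShapes_tag {Θ : SCtx} {Γ : List L.Ty} {e : Expr L} {ins : List L.Ty} {out : L.Ty}
    {s : Shp} (h : HasTy Θ Γ e (.arr (.fn ins out) s)) : argShapes e.tag = ins.map Ty.erase :=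
  h.inv.2.symm.argShapes_eq

theorem idx_hasSort_subst {Θ Θ' : SCtx} {σ : SSub L.Base} (hσ : σ.Typed Θ Θ') {i : Idx}
    {γ : IxSort} (h : i.HasSort Θ γ) : (i.subst σ.dim σ.shape).HasSort Θ' γ := by
  cases i <;> cases γ <;> simp only [Idx.HasSort, Idx.subst] at h ⊢
  · exact h.subst hσ.dim
  · exact h.subst hσ.dim hσ.shape

theorem zip_forall_map {α β γ δ : Type} {f : α → γ} {g : β → δ} {l : List α} {l' : List β}
    {Q : γ × δ → Prop} (h : ∀ p ∈ l.zip l', Q (f p.1, g p.2)) :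
    ∀ p ∈ (l.map f).zip (l'.map g), Q p := by
  rw [List.zip_map]
  simpa only [List.forall_mem_map, Prod.map] using h

/-- Lifting a substitution below a binder weakens the expressions in it, and weakening is itself an
instance of the statement. Abstracting over the class `P` allows one induction to serve for
renamings first and for all typed substitutions afterwards. Typing and erasure go together because
the erasure of a substituted application contains annotations that are determined by the type of the
substituted function. -/
theorem SubstClass.hasTy_subst
    {P : SCtx → List L.Ty → SCtx → List L.Ty → SSub L.Base → TSub L → Prop} (hP : SubstClass P)
    {Θ : SCtx} {Γ : List L.Ty} {e : Expr L} {τ : L.Ty} (h : HasTy Θ Γ e τ) :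
    ∀ {Θ' Γ' σ ρ}, P Θ Γ Θ' Γ' σ ρ → HasTy Θ' Γ' (e.subst σ ρ) (τ.subst σ) ∧
      (e.subst σ ρ).erase = e.erase.subst σ.toE ρ.toE := by
  induction h using HasTy.rec (motive_2 := fun Θ Γ a τ _ =>
    ∀ {Θ' Γ' σ ρ}, P Θ Γ Θ' Γ' σ ρ → AHasTy Θ' Γ' (a.subst σ ρ) (τ.subst σ) ∧
      (a.subst σ ρ).erase = a.erase.subst σ.toE ρ.toE)
  case eqv =>
    rename_i h ih
    intro Θ' Γ' σ ρ hp
    exact ⟨(ih hp).1.eqv (h.subst σ), (ih hp).2⟩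
  case var =>
    rename_i h₁ h₂
    intro Θ' Γ' σ ρ hp
    rcases hP.var hp h₁ with ⟨y, e, h⟩ | ⟨e', e, h⟩
    · simp only [Expr.subst, e, Expr.erase, EExpr.subst, TSub.toE, Sum.map_inl, and_true]
      exact .var h (h₂.subst σ)
    · simp only [Expr.subst, e, Expr.erase, EExpr.subst, TSub.toE, Sum.map_inr, and_true]
      exact h.eqv (h₂.subst σ)
  case array =>
    rename_i hk _ hl h ih
    intro Θ' Γ' σ ρ hp
    simp only [Expr.subst, Expr.erase, EExpr.subst, Atom.substs_eq_map, Atom.erases_eq_map,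
      EAtom.substs_eq_map, List.map_map, EExpr.array.injEq, true_and]
    refine ⟨.array (hk.subst (hP.typed hp)) ?_ (by simpa using hl) ?_, ?_⟩
    · simp only [List.forall_mem_map]
      exact fun a ha => (ih a ha hp).1
    · simpa [Ty.subst] using h.subst σ
    · exact List.map_congr_left fun a ha => (ih a ha hp).2
  case frame =>
    rename_i hk _ hl h ih
    intro Θ' Γ' σ ρ hp
    have hσ := hP.typed hp
    simp only [Expr.subst, Expr.erase, EExpr.subst, Expr.substs_eq_map, Expr.erases_eq_map,
      EExpr.substs_eq_map, List.map_map, EExpr.frame.injEq, Ty.subst_erase hσ.coherent, true_and]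
    refine ⟨.frame (hk.subst hσ) ?_ (by simpa using hl) ?_, ?_⟩
    · simp only [List.forall_mem_map]
      exact fun a ha => (ih a ha hp).1
    · simpa [Ty.subst, Shp.append_subst] using h.subst σ
    · exact List.map_congr_left fun a ha => (ih a ha hp).2
  case app =>
    rename_i Θ Γ f es ins ιas τo ιf ιo ιp τ h₁ h₂ h₃ h₄ h₅ h₆ ih₁ ih₂
    intro Θ' Γ' σ ρ hp
    have hσ := hP.typed hp
    have hf := (ih₁ hp).1
    simp only [Ty.subst, Ty.substs_eq_map, Ty.subst_fn_arr] at hf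
    constructor
    · simp only [Expr.subst, Expr.substs_eq_map]
      refine .app (ιas := ιas.map (Shp.subst σ.dim σ.shape)) hf (by simpa using h₂)
        (by simpa using h₃) ?_ (h₅.subst σ.dim σ.shape) ?_
      · rw [List.zip_map]
        refine zip_forall_map fun p hpz => ?_
        have := (ih₂ p hpz hp).1
        simpa [Ty.subst, Shp.append_subst] using this
      · simpa [Ty.subst, Shp.append_subst] using h₆.subst σ
    · have hes : ∀ e ∈ es, (e.subst σ ρ).erase = e.erase.subst σ.toE ρ.toE := by
        intro e he
        obtain ⟨x, hx⟩ := exists_of_length_eq_zip (l := ins.zip ιas) (l' := es)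
          (by simp [h₂, h₃]) he
        have hx' : (e, x) ∈ es.zip (ins.zip ιas) := by
          rw [← List.zip_swap]; exact List.mem_map.2 ⟨_, hx, rfl⟩
        exact (ih₂ _ hx' hp).2
      simp only [Expr.subst, Expr.erase, EExpr.subst, Expr.substs_eq_map, EArg.substs_eq_map,
        Ty.subst_erase hσ.coherent, (ih₁ hp).2, hf.argShapes_tag, h₁.argShapes_tag]
      rw [← Expr.eraseArgs_map (H := EArg.subst σ.toE ρ.toE) (F := Expr.subst σ ρ)
        (G := EShp.subst σ.toE) (fun e he s => by rw [EArg.subst, hes e he])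
        (lit_toE_subst σ [])]
      congr 2
      simp only [List.map_map]
      refine List.map_congr_left fun p _ => ?_
      exact Ty.subst_erase hσ.coherent (.arr p.1 p.2)
  case tapp =>
    rename_i f ks ts τu ιu ιf τ _ hl hk h ih
    intro Θ' Γ' σ ρ hp
    have hσ := hP.typed hp
    simp only [Expr.subst, Expr.erase, EExpr.subst, (ih hp).2, Ty.substs_eq_map, List.map_map,
      Ty.subst_erase hσ.coherent]
    refine ⟨.tapp (ih hp).1 (by simpa using hl) ?_ ?_, ?_⟩
    · rw [← List.map_id ks]
      exact zip_forall_map fun p hpz => (hk p hpz).subst hσ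
    · have := h.subst σ
      simpa only [Ty.subst, Shp.append_subst, Ty.subst_instTy hσ.coherent,
        Shp.subst_instTy hσ.coherent, hl] using this
    · congr 1
      refine List.map_congr_left fun t _ => ?_
      simp [EIdx.subst, Ty.subst_erase hσ.coherent]
  case iapp =>
    rename_i f γs is τp ιp ιf τ _ hl hk h ih
    intro Θ' Γ' σ ρ hp
    have hσ := hP.typed hp
    simp only [Expr.subst, Expr.erase, EExpr.subst, (ih hp).2, List.map_map,
      Ty.subst_erase hσ.coherent]
    refine ⟨.iapp (ih hp).1 (by simpa using hl) ?_ ?_, ?_⟩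
    · rw [← List.map_id γs]
      exact zip_forall_map fun p hpz => idx_hasSort_subst hσ (hk p hpz)
    · have := h.subst σ
      simpa only [Ty.subst, Shp.append_subst, Ty.subst_instIdx hσ.coherent,
        Shp.subst_instIdx hσ.coherent, hl] using this
    · congr 1
      exact List.map_congr_left fun t _ => (Idx.subst_toE σ t).symm
  case unbox =>
    rename_i γs s b τs τb ιs ιb τ _ _ hk h ih₁ ih₂
    intro Θ' Γ' σ ρ hp
    have hσ := hP.typed hp
    have hb := ih₂ (hP.up_sorts hp γs [τs])
    simp only [Expr.subst, Expr.erase, EExpr.subst, (ih₁ hp).2, Ty.subst_erase hσ.coherent]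
    constructor
    · have := hb.1
      -- The unboxing rule wants the type of the body as a weakening, which records that it does not
      -- mention the bound index variables; substitution preserves this form.
      rw [Ty.subst_shift] at this
      refine HasTy.unbox (ih₁ hp).1 this (hk.subst hσ) ?_
      simpa only [Ty.subst, Shp.append_subst] using h.subst σ
    · have := hb.2
      rw [SSub.toE_up, TSub.toE_up] at this
      simp only [List.length_singleton] at this
      rw [this]
  case eqv =>
    rename_i h ih
    intro Θ' Γ' σ ρ hp
    exact ⟨(ih hp).1.eqv (h.subst σ), (ih hp).2⟩
  case const =>
    rename_i h _ _ σ ρ hp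
    exact ⟨.const (h.subst σ), rfl⟩
  case op =>
    rename_i h _ _ σ ρ hp
    refine ⟨.op ?_, rfl⟩
    have := h.subst σ
    rwa [(L.sig_kind _).closed_subst] at this
  case lam =>
    rename_i h₁ _ h₃ ih _ _ σ ρ hp
    have hb := ih (hP.up_terms hp _)
    simp only [Atom.subst, Atom.erase, EAtom.subst, Ty.substs_eq_map, List.length_map]
    refine ⟨.lam ?_ hb.1 ?_, ?_⟩
    · simp only [List.forall_mem_map]
      exact fun t ht => (h₁ t ht).subst (hP.typed hp)
    · simpa only [Ty.subst, Ty.substs_eq_map] using h₃.subst σ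
    · rw [hb.2, TSub.toE_up]
  case tlam =>
    rename_i hv _ h ih _ _ σ ρ hp
    have hb := ih (hP.up_kinds hp _)
    simp only [Atom.subst, Atom.erase, EAtom.subst]
    refine ⟨.tlam (hv.subst _ _) hb.1 (h.subst σ), ?_⟩
    rw [hb.2, TSub.toE_up, SSub.toE_up]
  case ilam =>
    rename_i hv _ h ih _ _ σ ρ hp
    have hb := ih (hP.up_sorts hp _ [])
    simp only [Atom.subst, Atom.erase, EAtom.subst]
    refine ⟨.ilam (hv.subst _ _) hb.1 (h.subst σ), ?_⟩
    have hb := hb.2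
    rw [TSub.toE_up, SSub.toE_up] at hb
    exact congrArg _ hb
  case box =>
    rename_i γs is _ _ _ hl hs hk _ h ih _ _ σ ρ hp
    have hσ := hP.typed hp
    simp only [Atom.subst, Atom.erase, EAtom.subst, (ih hp).2, List.map_map]
    refine ⟨AHasTy.box (γs := γs) (by simpa using hl) ?_ (hk.subst hσ) ?_ (h.subst σ), ?_⟩
    · rw [← List.map_id γs]
      exact zip_forall_map fun p hpz => idx_hasSort_subst hσ (hs p hpz)
    · have := (ih hp).1
      rwa [Ty.subst_instIdx hσ.coherent, hl] at this
    · congr 1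
      exact List.map_congr_left fun t _ => (Idx.subst_toE σ t).symm

/-- The typed renamings. -/
def IsRenaming (Θ : SCtx) (Γ : List L.Ty) (Θ' : SCtx) (Γ' : List L.Ty) (σ : SSub L.Base)
    (ρ : TSub L) : Prop :=
  ∃ r q : ℕ → ℕ, (∀ i s, Θ[i]? = some s → Θ'[r i]? = some s) ∧
    (∀ x t, Γ[x]? = some t → Γ'[q x]? = some (t.rename r)) ∧ σ = .ofRen r ∧
    ρ = fun x => .inl (q x)

theorem IsRenaming.substClass : SubstClass (IsRenaming (L := L)) where
  typed := by rintro _ _ _ _ _ _ ⟨r, q, hr, hq, rfl, rfl⟩; exact .ofRen hr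
  var := by
    rintro _ _ _ _ _ _ ⟨r, q, hr, hq, rfl, rfl⟩ x τ h
    exact .inl ⟨_, rfl, by rw [hq _ _ h, Ty.rename_eq_subst]⟩
  up := by
    rintro Θ Γ Θ' Γ' _ _ Ξ Δ ⟨r, q, hr, hq, rfl, rfl⟩
    refine ⟨upRen Ξ.length r, upRen Δ.length q, upRen_spec hr Ξ, ?_, SSub.up_ofRen _ _,
      TSub.up_inl _ _ _⟩
    intro x t h
    by_cases hx : x < Δ.length
    · rw [List.getElem?_append_left hx] at h
      rw [List.getElem?_append_left (by simp [upRen, hx])]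
      rw [upRen, if_pos hx, SSub.up_ofRen, List.getElem?_map, h, Ty.rename_eq_subst]
      rfl
    · rw [List.getElem?_append_right (by omega)] at h
      rw [List.getElem?_append_right (by simp [upRen, hx])]
      simp only [List.getElem?_map, Option.map_eq_some_iff] at h
      obtain ⟨t', h, rfl⟩ := h
      simp only [upRen, hx, if_false, List.length_map, Nat.add_sub_cancel, List.getElem?_map,
        hq _ _ h, Option.map_some]
      rw [Ty.rename_eq_subst _ t', ← Ty.subst_shift, SSub.up_ofRen, ← Ty.rename_eq_subst]

/-- Weakening is the instance for renamings, and it is what closes the class of general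
substitutions under binders in `IsSubst.substClass`. -/
theorem HasTy.shift {Θ : SCtx} {Γ : List L.Ty} {e : Expr L} {τ : L.Ty} (h : HasTy Θ Γ e τ)
    (Ξ : SCtx) (Δ : List L.Ty) :
    HasTy (Ξ ++ Θ) (Δ ++ Γ.map (Ty.shift Ξ.length)) (e.rename (· + Ξ.length) (· + Δ.length))
      (τ.shift Ξ.length) := by
  rw [Expr.rename_eq_subst, Ty.shift, Ty.rename_eq_subst]
  refine (IsRenaming.substClass.hasTy_subst h ⟨_, _, shift_spec Ξ Θ, ?_, rfl, rfl⟩).1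
  intro x t hx
  rw [shift_spec Δ _ _ (t.shift Ξ.length) (by simp [hx]), Ty.shift]

/-- The typed substitutions. -/
structure IsSubst (Θ : SCtx) (Γ : List L.Ty) (Θ' : SCtx) (Γ' : List L.Ty) (σ : SSub L.Base)
    (ρ : TSub L) : Prop where
  typed : σ.Typed Θ Θ'
  var : ∀ {x τ}, Γ[x]? = some τ → (∃ y, ρ x = .inl y ∧ Γ'[y]? = some (τ.subst σ)) ∨
      ∃ e, ρ x = .inr e ∧ HasTy Θ' Γ' e (τ.subst σ)

theorem IsSubst.substClass : SubstClass (IsSubst (L := L)) where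
  typed h := h.typed
  var h := h.var
  up := by
    intro Θ Γ Θ' Γ' σ ρ Ξ Δ h
    refine ⟨h.typed.up Ξ, fun {x τ} hx => ?_⟩
    by_cases hl : x < Δ.length
    · rw [List.getElem?_append_left hl] at hx
      refine .inl ⟨x, by simp [TSub.up, hl], ?_⟩
      rw [List.getElem?_append_left (by simpa using hl)]
      simp [hx]
    · rw [List.getElem?_append_right (by omega)] at hx
      simp only [List.getElem?_map, Option.map_eq_some_iff] at hx
      obtain ⟨t, hx, rfl⟩ := hx
      rw [Ty.subst_shift]
      rcases h.var hx with ⟨y, e, hy⟩ | ⟨e', e, he⟩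
      · refine .inl ⟨y + Δ.length, by simp [TSub.up, hl, e], ?_⟩
        rw [List.getElem?_append_right (by simp)]
        simp [hy]
      · refine .inr ⟨_, by simp only [TSub.up, hl, if_false, e]; rfl, ?_⟩
        simpa using he.shift Ξ (Δ.map (Ty.subst (σ.up Ξ.length)))

theorem HasTy.subst {Θ Θ' : SCtx} {Γ Γ' : List L.Ty} {e : Expr L} {τ : L.Ty}
    (h : HasTy Θ Γ e τ) {σ : SSub L.Base} {ρ : TSub L} (hs : IsSubst Θ Γ Θ' Γ' σ ρ) :
    HasTy Θ' Γ' (e.subst σ ρ) (τ.subst σ) :=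
  (IsSubst.substClass.hasTy_subst h hs).1

theorem HasTy.erase_subst {Θ Θ' : SCtx} {Γ Γ' : List L.Ty} {e : Expr L} {τ : L.Ty}
    (h : HasTy Θ Γ e τ) {σ : SSub L.Base} {ρ : TSub L} (hs : IsSubst Θ Γ Θ' Γ' σ ρ) :
    (e.subst σ ρ).erase = e.erase.subst σ.toE ρ.toE :=
  (IsSubst.substClass.hasTy_subst h hs).2

/-- Substitution of closed terms for all term variables. -/
theorem IsSubst.inst {Θ Θ' : SCtx} {Γ : List L.Ty} {σ : SSub L.Base} (hσ : σ.Typed Θ Θ')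
    {es : List (Expr L)} (hl : es.length = Γ.length)
    (h : ∀ p ∈ es.zip Γ, HasTy Θ' [] p.1 (p.2.subst σ)) : IsSubst Θ Γ Θ' [] σ (.inst es) := by
  refine ⟨hσ, fun {x τ} hx => .inr ?_⟩
  obtain ⟨hx', rfl⟩ := List.getElem?_eq_some_iff.1 hx
  have hx'' : x < es.length := hl ▸ hx'
  exact ⟨es[x], by simp [TSub.inst, hx''], h _ (zip_mem hx'' hx')⟩

theorem IsSubst.of_nil {Θ Θ' : SCtx} {σ : SSub L.Base} (hσ : σ.Typed Θ Θ') (ρ : TSub L) :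
    IsSubst Θ [] Θ' [] σ ρ := ⟨hσ, fun {x τ} hx => by simp at hx⟩

theorem SSub.Typed.id (Θ : SCtx) : (SSub.id : SSub L.Base).Typed Θ Θ :=
  .ofRen (r := fun i => i) fun _ _ h => h

end

end Remora

-- The individual reduction rules: types of the results and their erasures.

namespace Remora

/-! ### Cells -/

section
variable {α β : Type}

theorem mem_of_mem_cell {m j : ℕ} {l : List α} {x : α} (h : x ∈ cell m l j) : x ∈ l :=
  List.mem_of_mem_drop (List.mem_of_mem_take h)

theorem length_cell {c m j : ℕ} {l : List α} (hl : l.length = c * m) (hj : j < c) :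
    (cell m l j).length = m := by
  have := Nat.mul_le_mul_right m (Nat.succ_le_of_lt hj)
  rw [Nat.succ_mul] at this
  simp only [cell, List.length_take, List.length_drop, hl]
  omega

theorem map_cell (f : α → β) (m j : ℕ) (l : List α) :
    (cell m l j).map f = cell m (l.map f) j := by
  simp [cell, List.map_take, List.map_drop]

theorem mem_of_mem_replicateCells {c m k : ℕ} {l : List α} {x : α}
    (h : x ∈ replicateCells c m k l) : x ∈ l := by
  simp only [replicateCells, List.mem_flatMap, List.mem_flatten, List.mem_replicate] at h
  obtain ⟨j, _, _, ⟨_, rfl⟩, h⟩ := h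
  exact mem_of_mem_cell h

theorem length_replicateCells {c m : ℕ} (k : ℕ) {l : List α} (hl : l.length = c * m) :
    (replicateCells c m k l).length = c * (k * m) := by
  simp only [replicateCells, List.length_flatMap]
  rw [List.map_congr_left (g := fun _ => k * m)]
  · simp
  · intro j hj
    simp [length_cell hl (List.mem_range.1 hj)]

theorem map_replicateCells (f : α → β) (c m k : ℕ) (l : List α) :
    (replicateCells c m k l).map f = replicateCells c m k (l.map f) := by
  simp [replicateCells, List.map_flatMap, List.map_flatten, map_cell]

theorem prod_mul_copies {n np : List ℕ} (h : n <+: np) : n.prod * copies np n = np.prod := by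
  obtain ⟨r, rfl⟩ := h
  simp [copies]

end

section
variable {L : Lang}

/-! ### Erasure of argument values -/

/-- Erasure of an argument value. -/
def ArgVal.erase (a : ArgVal L) : EArgVal L :=
  ⟨a.frame, a.cellDims, a.atoms.map Atom.erase, a.shape.toE⟩

theorem ArgVal.erase_expr (a : ArgVal L) : a.expr.erase = a.erase.expr := by
  simp [ArgVal.expr, EArgVal.expr, ArgVal.erase, Expr.erase]

theorem ArgVal.ok_erase (a : ArgVal L) : a.erase.Ok ↔ a.Ok := by
  simp [ArgVal.Ok, EArgVal.Ok, ArgVal.erase, Atom.isVal_erase, Shp.toE_eq_iff]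

theorem eraseArgs_args (F : ArgVal L → Expr L) (args : List (ArgVal L)) :
    Expr.eraseArgs (args.map F) ((args.map ArgVal.inTy).map Ty.erase)
      = args.map fun a => .mk (F a).erase a.shape.toE := by
  induction args with
  | nil => rfl
  | cons a args ih =>
    simp only [List.map_cons, Expr.eraseArgs, List.headD_cons, List.tail_cons, ih]
    rfl

/-- Here the tag of the function literally lists the `inTy` of the arguments, so the annotation of
each argument is the class of its own `shape`. -/
theorem erase_app (ns : List ℕ) (fs : List (Atom L)) (args : List (ArgVal L)) (τo : L.Ty) (ιf : Shp)
    (F : ArgVal L → Expr L) (τ : L.Ty) :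
    (Expr.app (.array ns fs (.arr (.fn (args.map ArgVal.inTy) τo) ιf)) (args.map F) τ).erase
      = .app (.array ns (fs.map Atom.erase)) (args.map fun a => .mk (F a).erase a.shape.toE)
        τ.erase := by
  simp [Expr.erase, Expr.tag, argShapes, ← eraseArgs_args]

theorem erase_app_args (ns : List ℕ) (fs : List (Atom L)) (args : List (ArgVal L)) (τo : L.Ty)
    (ιf : Shp) (τ : L.Ty) :
    (Expr.app (.array ns fs (.arr (.fn (args.map ArgVal.inTy) τo) ιf))
        (args.map ArgVal.expr) τ).erase
      = .app (.array ns (fs.map Atom.erase)) ((args.map ArgVal.erase).map EArgVal.arg) τ.erase := by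
  rw [erase_app, List.map_map]
  congr 2
  funext a
  rw [ArgVal.erase_expr]
  rfl

theorem erase_app_lift (np ns : List ℕ) (fs : List (Atom L)) (args : List (ArgVal L)) (τo : L.Ty)
    (ιf : Shp) (τ : L.Ty) :
    (Expr.app (.array ns fs (.arr (.fn (args.map ArgVal.inTy) τo) ιf))
        (args.map (ArgVal.lift np)) τ).erase
      = .app (.array ns (fs.map Atom.erase)) ((args.map ArgVal.erase).map (EArgVal.lift np))
        τ.erase := by
  rw [erase_app, List.map_map]
  congr 2
  funext a
  simp [ArgVal.lift, EArgVal.lift, ArgVal.erase, Expr.erase, map_replicateCells]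

theorem erase_app_cell (j : ℕ) (ns : List ℕ) (fs : List (Atom L)) (args : List (ArgVal L))
    (τo : L.Ty) (ιf : Shp) (τ : L.Ty) :
    (Expr.app (.array ns fs (.arr (.fn (args.map ArgVal.inTy) τo) ιf))
        (args.map (ArgVal.cellExpr j)) τ).erase
      = .app (.array ns (fs.map Atom.erase)) ((args.map ArgVal.erase).map (EArgVal.cellArg j))
        τ.erase := by
  rw [erase_app, List.map_map]
  congr 2
  funext a
  simp [ArgVal.cellExpr, EArgVal.cellArg, ArgVal.erase, Expr.erase, map_cell]

theorem map_erase_expr (args : List (ArgVal L)) :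
    (args.map ArgVal.expr).map Expr.erase = (args.map ArgVal.erase).map EArgVal.expr := by
  simp [ArgVal.erase_expr]

theorem map_erase_frame (args : List (ArgVal L)) :
    (args.map ArgVal.erase).map EArgVal.frame = args.map ArgVal.frame := by
  simp [ArgVal.erase]

/-! ### Inversion for applications of array literals -/

theorem HasTy.array_inv {Θ : SCtx} {Γ : List L.Ty} {ns : List ℕ} {as : List (Atom L)}
    {τ t : L.Ty} {s : Shp} (h : HasTy Θ Γ (.array ns as τ) (.arr t s)) :
    HasKind Θ t .atom ∧ (∀ a ∈ as, AHasTy Θ Γ a t) ∧ as.length = ns.prod ∧ s ≈ lit ns := by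
  obtain ⟨⟨τa, hk, ha, hl, h₁⟩, h₂⟩ := h.inv
  obtain ⟨h₃, h₄⟩ := TEqv.arr_arr.1 (h₁.trans h₂)
  exact ⟨hk.congr h₃, fun a m => (ha a m).eqv h₃, hl, Setoid.symm h₄⟩

theorem HasTy.array' {Θ : SCtx} {Γ : List L.Ty} {ns : List ℕ} {as : List (Atom L)} {t : L.Ty}
    {s s' : Shp} (hk : HasKind Θ t .atom) (ha : ∀ a ∈ as, AHasTy Θ Γ a t)
    (hl : as.length = ns.prod) (h : lit ns ≈ s) (h' : lit ns ≈ s') :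
    HasTy Θ Γ (.array ns as (.arr t s)) (.arr t s') :=
  (HasTy.array hk ha hl (.arr (.refl _) h)).eqv (.arr (.refl _) (Setoid.trans (Setoid.symm h) h'))

/-- The typing rule and the lifting rule choose their maxima separately. Once the shapes are known
to be literals, the two maxima are prefixes of each other, hence equal. -/
theorem eq_of_isMaxShape {m : Shp} {ss : List Shp} {np : List ℕ} {frames : List (List ℕ)}
    (hm : IsMaxShape m ss) (hp : IsPrincipal np frames)
    (h : List.Forall₂ (fun s n => s ≈ lit n) ss frames) : m ≈ lit np := by
  obtain ⟨i, hi, rfl⟩ := List.mem_iff_getElem.1 hm.1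
  obtain ⟨j, hj, rfl⟩ := List.mem_iff_getElem.1 hp.1
  have hl := h.length_eq
  have h₁ := h.get hi (hl ▸ hi)
  have h₂ := h.get (hl ▸ hj) hj
  obtain ⟨r, hr⟩ := hm.2 _ (List.getElem_mem (hl ▸ hj))
  have h₃ : frames[j] <+: frames[i]'(hl ▸ hi) := by
    have e := hr (fun _ => 0) (fun _ => [])
    rw [Shp.eval_append] at e
    simp only [List.get_eq_getElem] at h₁ h₂
    rw [h₁ _ _, h₂ _ _, eval_lit, eval_lit] at e
    exact ⟨_, e⟩
  have h₄ := hp.2 _ (List.getElem_mem (hl ▸ hi))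
  rw [h₃.eq_of_length (le_antisymm h₃.length_le h₄.length_le)]
  exact h₁

/-- What the typing of an application of an array to array values says about the parts. -/
theorem HasTy.app_inv {nf : List ℕ} {fs : List (Atom L)} {args : List (ArgVal L)} {τo : L.Ty}
    {ιf : Shp} {τ τ' : L.Ty} (h : HasTy [] [] (.app (.array nf fs
      (.arr (.fn (args.map ArgVal.inTy) τo) ιf)) (args.map ArgVal.expr) τ) τ')
    (hok : ∀ a ∈ args, a.Ok) :
    HasKind [] (.fn (args.map ArgVal.inTy) τo) .atom ∧
    (∀ x ∈ fs, AHasTy [] [] x (.fn (args.map ArgVal.inTy) τo)) ∧ fs.length = nf.prod ∧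
    (∀ a ∈ args, HasTy [] [] a.expr (.arr a.elt (lit (a.frame ++ a.cellDims)))) ∧
    TEqv τ τ' ∧ ∃ τr ιo, τo = .arr τr ιo ∧
      ∀ np, IsPrincipal np (nf :: args.map ArgVal.frame) →
        TEqv (.arr τr (.app [lit np, ιo])) τ := by
  obtain ⟨⟨ins, ιas, τo', ιf', ιo', ιp, hf, hl₁, hl₂, hes, hm, ht⟩, h'⟩ := h.inv
  obtain ⟨h₀, h₂⟩ := TEqv.arr_arr.1 hf.inv.2
  obtain ⟨h₁, h₃⟩ := TEqv.fn_fn.1 h₀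
  obtain ⟨hk, hfs, hlen, hιf⟩ := (hf.eqv (TEqv.arr h₀ h₂).symm).array_inv
  obtain ⟨τr, ιo, rfl, h₄, h₅⟩ := h₃.symm.arr_inv
  have hargs : ∀ i (hi : i < args.length) (hi' : i < ιas.length),
      HasTy [] [] args[i].expr (.arr args[i].elt (lit (args[i].frame ++ args[i].cellDims))) ∧
      ιas[i] ≈ lit args[i].frame := by
    intro i hi hi'
    have hi'' : i < ins.length := by omega
    have hz : (args[i].expr, (ins[i], ιas[i])) ∈ (args.map ArgVal.expr).zip (ins.zip ιas) := by
      refine List.mem_iff_getElem.2 ⟨i, by simp [hi, hi', hi''], by simp⟩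
    have hty := hes _ hz
    have he := h₁.get (i := i) (by simpa using hi) (by simpa using hi'')
    simp only [List.get_eq_getElem, List.getElem_map, ArgVal.inTy] at he
    obtain ⟨he₁, he₂⟩ := TEqv.arr_arr.1 he
    have hs : lit args[i].cellDims ≈ ins[i].2 :=
      Setoid.trans (Setoid.symm (hok _ (List.getElem_mem hi)).2) he₂
    have hsh := hty.array_inv.2.2.2
    refine ⟨hty.eqv (.arr he₁.symm hsh), ?_⟩
    -- The dimensions of the literal are its frame followed by its cell dimensions, while its type
    -- has the shape `ιas[i]` followed by the input shape. The cell dimensions denote the input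
    -- shape, so the two frames agree.
    refine Shp.append_right_cancel (t := ins[i].2) (Setoid.trans hsh ?_)
    exact Setoid.trans (Setoid.symm (lit_append _ _)) (Shp.append_congr (Setoid.refl _) hs)
  refine ⟨hk, hfs, hlen, ?_, h', τr, ιo, rfl, fun np hnp => ?_⟩
  · intro a ha
    obtain ⟨i, hi, rfl⟩ := List.mem_iff_getElem.1 ha
    exact (hargs i hi (by simp at hl₁; omega)).1
  · refine TEqv.trans (.arr h₄.symm (Shp.append_congr ?_ (Setoid.symm h₅))) ht
    -- The frame of the function and the frames just found show that the principal shape of the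
    -- typing rule denotes `np`.
    refine Setoid.symm (eq_of_isMaxShape hm hnp (.cons (Setoid.trans (Setoid.symm h₂) hιf) ?_))
    refine List.forall₂_iff_get.2 ⟨by simpa using hl₂.trans hl₁.symm, fun i hi hi' => ?_⟩
    simpa using (hargs i (by simpa using hi') hi).2

/-- Typing of an application all of whose frames are equal. -/
theorem HasTy.app_of_frames_eq {f : Expr L} {np : List ℕ} {args : List (ArgVal L)}
    {F : ArgVal L → Expr L} {τr : L.Ty} {ιo : Shp} {τ : L.Ty}
    (hf : HasTy [] [] f (.arr (.fn (args.map ArgVal.inTy) (.arr τr ιo)) (lit np)))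
    (hF : ∀ a ∈ args, HasTy [] [] (F a) (.arr a.elt (.app [lit np, a.shape])))
    (h : TEqv (.arr τr (.app [lit np, ιo])) τ) : HasTy [] [] (.app f (args.map F) τ) τ := by
  refine HasTy.app (ins := args.map fun a => (a.elt, a.shape)) (ιf := lit np)
    (ιas := args.map fun _ => lit np) (by rw [List.map_map]; exact hf) (by simp)
    (by simp) ?_ ⟨List.mem_cons_self, ?_⟩ h
  · rw [List.zip_map', List.zip_map']
    simpa only [List.forall_mem_map] using hF
  · simp only [List.forall_mem_cons, List.forall_mem_map]
    have : ∃ r, Shp.app [lit np, r] ≈ lit np := ⟨_, Shp.append_nil _⟩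
    exact ⟨this, fun _ _ => this⟩

theorem HasTy.lift {a : ArgVal L} (hok : a.Ok)
    (h : HasTy [] [] a.expr (.arr a.elt (lit (a.frame ++ a.cellDims)))) {np : List ℕ}
    (hp : a.frame <+: np) : HasTy [] [] (a.lift np) (.arr a.elt (.app [lit np, a.shape])) := by
  obtain ⟨hk, ha, hl, _⟩ := h.array_inv
  rw [List.prod_append] at hl
  refine .array' hk (fun x hx => ha x (mem_of_mem_replicateCells hx)) ?_ (Setoid.refl _) ?_
  · rw [length_replicateCells _ hl, List.prod_append, ← prod_mul_copies hp, Nat.mul_assoc]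
  · exact Setoid.trans (Setoid.symm (lit_append _ _))
      (Shp.append_congr (Setoid.refl _) (Setoid.symm hok.2))

theorem HasTy.cellExpr {a : ArgVal L} (hok : a.Ok)
    (h : HasTy [] [] a.expr (.arr a.elt (lit (a.frame ++ a.cellDims)))) {j : ℕ}
    (hj : j < a.frame.prod) :
    HasTy [] [] (a.cellExpr j) (.arr a.elt (.app [lit [], a.shape])) := by
  obtain ⟨hk, ha, hl, _⟩ := h.array_inv
  rw [List.prod_append] at hl
  refine .array' hk (fun x hx => ha x (mem_of_mem_cell hx)) (length_cell hl hj) (Setoid.refl _) ?_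
  exact Setoid.trans (Setoid.symm hok.2) (Setoid.symm (Shp.nil_append _))

theorem HasTy.of_frame_nil {a : ArgVal L} (hok : a.Ok)
    (h : HasTy [] [] a.expr (.arr a.elt (lit (a.frame ++ a.cellDims)))) (hf : a.frame = []) :
    HasTy [] [] a.expr a.inTy := by
  rw [hf, List.nil_append] at h
  exact h.eqv (.arr (.refl _) (Setoid.symm hok.2))

theorem isPrincipal_of_eq {n : List ℕ} {args : List (ArgVal L)} (h : ∀ a ∈ args, a.frame = n) :
    IsPrincipal n (n :: args.map ArgVal.frame) := by
  refine ⟨List.mem_cons_self, ?_⟩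
  simp only [List.forall_mem_cons, List.forall_mem_map, List.prefix_refl, true_and]
  exact fun a ha => (h a ha).symm ▸ List.prefix_refl _

theorem forall₂_hasTy {args : List (ArgVal L)} {ts : List L.Ty}
    (h : List.Forall₂ TEqv ts (args.map ArgVal.inTy))
    (ha : ∀ a ∈ args, HasTy [] [] a.expr a.inTy) :
    List.Forall₂ (HasTy [] []) (args.map ArgVal.expr) ts := by
  rw [List.forall₂_map_left_iff]
  rw [List.forall₂_map_right_iff] at h
  exact (List.forall₂_and_left _ _ |>.2 ⟨ha, h.flip⟩).imp fun _ _ h => h.1.eqv h.2.symm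

/-! ### The reduction rules preserve types and commute with erasure -/

/-- The number of cells is right because each frame is a prefix of `np`, so its product times the
number of copies is `np.prod`. Once all frames are `np`, the principal frame and the type of the
result are unchanged. -/
theorem HasTy.step_lift {nf np : List ℕ} {fs : List (Atom L)} {args : List (ArgVal L)} {τo : L.Ty}
    {ιf : Shp} {τ τ' : L.Ty} (h : HasTy [] [] (.app (.array nf fs
      (.arr (.fn (args.map ArgVal.inTy) τo) ιf)) (args.map ArgVal.expr) τ) τ')
    (hok : ∀ a ∈ args, a.Ok) (hp : IsPrincipal np (nf :: args.map ArgVal.frame)) :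
    HasTy [] [] (.app (.array np (replicateCells nf.prod 1 (copies np nf) fs)
          (.arr (.fn (args.map ArgVal.inTy) τo) (lit np))) (args.map (ArgVal.lift np)) τ) τ' := by
  obtain ⟨hk, hfs, hl, hargs, hτ, τr, ιo, rfl, hnp⟩ := h.app_inv hok
  refine (HasTy.app_of_frames_eq (np := np) (.array' hk
    (fun x hx => hfs x (mem_of_mem_replicateCells hx)) ?_ (Setoid.refl _) (Setoid.refl _))
    (fun a ha => (hargs a ha).lift (hok a ha) ?_) (hnp np hp)).eqv hτ
  · rw [length_replicateCells _ (by simpa using hl), Nat.mul_one,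
      prod_mul_copies (hp.2 _ List.mem_cons_self)]
  · exact hp.2 _ (List.mem_cons_of_mem _ (List.mem_map_of_mem ha))

/-- The second conclusion provides the dimensions `no` of a result cell. The erased rule has to find
them by splitting the shape of the whole result, since it has no function type to consult. -/
theorem HasTy.step_map {nf : List ℕ} {fs : List (Atom L)} {args : List (ArgVal L)} {τo : L.Ty}
    {ιf : Shp} {τ τ' : L.Ty} (h : HasTy [] [] (.app (.array nf fs
      (.arr (.fn (args.map ArgVal.inTy) τo) ιf)) (args.map ArgVal.expr) τ) τ')
    (hok : ∀ a ∈ args, a.Ok) (hf : ∀ a ∈ args, a.frame = nf) :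
    HasTy [] [] (.frame nf ((List.range nf.prod).map fun j =>
          .app (.array [] (cell 1 fs j) (.arr (.fn (args.map ArgVal.inTy) τo) (lit [])))
            (args.map (ArgVal.cellExpr j)) τo) τ) τ' ∧
      ∃ no, τo.erase = (lit no).toE ∧ τ.erase = (lit (nf ++ no)).toE := by
  obtain ⟨hk, hfs, hl, hargs, hτ, τr, ιo, rfl, hnp⟩ := h.app_inv hok
  have hτ' := hnp nf (isPrincipal_of_eq hf)
  have hko : HasKind [] (Ty.arr τr ιo) .array := by cases hk with | fn _ h => exact h
  constructor
  · refine (HasTy.frame hko ?_ (by simp) hτ').eqv hτ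
    simp only [List.forall_mem_map, List.mem_range]
    intro j hj
    refine HasTy.app_of_frames_eq (np := []) (.array' hk
      (fun x hx => hfs x (mem_of_mem_cell hx)) ?_ (Setoid.refl _) (Setoid.refl _))
      (fun a ha => (hargs a ha).cellExpr (hok a ha) ?_) (.arr (.refl _) (Shp.nil_append _))
    · rw [length_cell (by simpa using hl) hj]; rfl
    · rwa [hf a ha]
  -- The output type is closed, so its shape denotes a literal.
  · obtain ⟨no, hno⟩ : ∃ no, ιo ≈ lit no := by
      cases hko with | arr _ h => exact h.exists_lit
    refine ⟨no, Shp.toE_eq_iff.2 hno, ?_⟩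
    rw [← hτ'.erase_eq]
    exact Shp.toE_eq_iff.2 (Setoid.trans (Shp.append_congr (Setoid.refl _) hno) (lit_append _ _))

theorem HasTy.step_beta {τs' : List L.Ty} {e : Expr L} {τl : L.Ty} {args : List (ArgVal L)}
    {τo : L.Ty} {ιf : Shp} {τ τ' : L.Ty} (h : HasTy [] [] (.app (.array [] [.lam τs' e τl]
      (.arr (.fn (args.map ArgVal.inTy) τo) ιf)) (args.map ArgVal.expr) τ) τ')
    (hok : ∀ a ∈ args, a.Ok) (hf : ∀ a ∈ args, a.frame = []) :
    HasTy [] [] (e.subst .id (.inst (args.map ArgVal.expr))) τ' ∧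
      (e.subst .id (.inst (args.map ArgVal.expr))).erase
        = e.erase.subst .id (.inst ((args.map ArgVal.erase).map EArgVal.expr)) := by
  obtain ⟨hk, hfs, hl, hargs, hτ, τr, ιo, rfl, hnp⟩ := h.app_inv hok
  obtain ⟨τb, _, hb, ht⟩ := (hfs _ (List.mem_singleton_self _)).inv
  obtain ⟨h₁, h₂⟩ := TEqv.fn_fn.1 ht
  have h₃ := forall₂_hasTy h₁ fun a ha => (hargs a ha).of_frame_nil (hok a ha) (hf a ha)
  rw [List.append_nil] at hb
  have hs := IsSubst.inst (SSub.Typed.id (L := L) []) h₃.length_eq fun p hp => by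
    rw [Ty.subst_id]; exact (List.forall₂_iff_zip.1 h₃).2 hp
  constructor
  · have := hb.subst hs
    rw [Ty.subst_id] at this
    -- With all frames scalar the principal frame is `[]`, so the application has the output type of
    -- the function up to a trivial prefix.
    refine this.eqv (h₂.trans (.trans (.arr (.refl _) ?_)
      ((hnp [] (isPrincipal_of_eq hf)).trans hτ)))
    exact Setoid.symm (Shp.nil_append _)
  · rw [hb.erase_subst hs, SSub.toE_id, TSub.toE_inst, map_erase_expr]

/-- Inversion makes the tag of the function equivalent to the signature of the operator. The
arguments therefore have the input types of the signature, where the assumptions on `δ` and `δE`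
apply. -/
theorem HasTy.step_delta (D : OpSem L) {o : L.Op} {τl : L.Ty} {args : List (ArgVal L)}
    {τo : L.Ty} {ιf : Shp} {τ τ' : L.Ty} (h : HasTy [] [] (.app (.array [] [.op o τl]
      (.arr (.fn (args.map ArgVal.inTy) τo) ιf)) (args.map ArgVal.expr) τ) τ')
    (hok : ∀ a ∈ args, a.Ok) (hf : ∀ a ∈ args, a.frame = []) :
    (∀ r, D.δ o (args.map ArgVal.expr) = some r → HasTy [] [] r τ') ∧
      D.δE o ((args.map ArgVal.erase).map EArgVal.expr)
        = (D.δ o (args.map ArgVal.expr)).map Expr.erase := by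
  obtain ⟨hk, hfs, hl, hargs, hτ, τr, ιo, rfl, hnp⟩ := h.app_inv hok
  have ht : TEqv (L.sig o) _ := (hfs _ (List.mem_singleton_self _)).inv
  obtain ⟨ins, out, ho, h₁, h₂⟩ := ht.symm.fn_inv
  have h₃ := forall₂_hasTy (ts := ins) (h₁.flip.imp fun _ _ h => h.symm)
    fun a ha => (hargs a ha).of_frame_nil (hok a ha) (hf a ha)
  have hv : ∀ v ∈ args.map ArgVal.expr, v.IsVal := by
    simp only [List.forall_mem_map]
    exact fun a ha => by simpa [ArgVal.expr, Expr.IsVal] using (hok a ha).1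
  constructor
  · intro r hr
    refine (D.δ_type o ins out ho _ h₃.length_eq hv
      (fun p hp => (List.forall₂_iff_zip.1 h₃).2 hp) r hr).2.eqv
      (h₂.symm.trans (.trans (.arr (.refl _) ?_) ((hnp [] (isPrincipal_of_eq hf)).trans hτ)))
    exact Setoid.symm (Shp.nil_append _)
  · rw [← map_erase_expr, D.δ_erase o ins out ho _ h₃.length_eq hv
      fun p hp => (List.forall₂_iff_zip.1 h₃).2 hp]

theorem HasTy.step_tbeta {ns : List ℕ} {fs : List (List Kind × Expr L × L.Ty)} {τf : L.Ty}
    {ts : List L.Ty} {τ τ' : L.Ty}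
    (h : HasTy [] [] (.tapp (.array ns (fs.map fun x => .tlam x.1 x.2.1 x.2.2) τf) ts τ) τ') :
    HasTy [] [] (.frame ns (fs.map fun x => x.2.1.subst (.instTy ts) .id) τ) τ' ∧
      ∀ x ∈ fs, (x.2.1.subst (.instTy ts) .id).erase
        = x.2.1.erase.subst (.inst (ts.map fun t => .shape t.erase)) .id := by
  obtain ⟨⟨ks, τu, ιu, ιf, hf, hl, hts, ht⟩, hτ⟩ := h.inv
  obtain ⟨hk, ha, hlen, hs⟩ := hf.array_inv
  simp only [List.forall_mem_map, List.length_map] at ha hlen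
  have hσ := SSub.Typed.instTy hl hts
  have key : ∀ x ∈ fs, HasTy (ks.map .kind ++ []) [] x.2.1 (.arr τu ιu) := by
    intro x hx
    obtain ⟨τb, _, hb, he⟩ := (ha x hx).inv
    obtain ⟨_, e, he⟩ := he.univ_inv
    injection e with e₁ e₂
    subst e₁ e₂
    exact hb.eqv he
  constructor
  · refine (HasTy.frame (τc := τu.subst (.instTy ts))
      (ιc := ιu.subst (SSub.instTy ts).dim (SSub.instTy ts).shape) ?_ ?_ (by simpa using hlen)
      (.trans (.arr (.refl _) (Shp.append_congr (Setoid.symm hs) (Setoid.refl _))) ht)).eqv hτ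
    · cases hk with | univ hk => exact hk.subst hσ
    · simp only [List.forall_mem_map]
      exact fun x hx => (key x hx).subst (.of_nil hσ _)
  · intro x hx
    rw [(key x hx).erase_subst (.of_nil hσ _), SSub.toE_instTy, TSub.toE_id]

theorem HasTy.step_ibeta {ns : List ℕ} {fs : List (List IxSort × Expr L × L.Ty)} {τf : L.Ty}
    {is : List Idx} {τ τ' : L.Ty}
    (h : HasTy [] [] (.iapp (.array ns (fs.map fun x => .ilam x.1 x.2.1 x.2.2) τf) is τ) τ') :
    HasTy [] [] (.frame ns (fs.map fun x => x.2.1.subst (.instIdx is) .id) τ) τ' ∧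
      ∀ x ∈ fs, (x.2.1.subst (.instIdx is) .id).erase
        = x.2.1.erase.subst (.inst (is.map Idx.toE)) .id := by
  obtain ⟨⟨γs, τu, ιu, ιf, hf, hl, hts, ht⟩, hτ⟩ := h.inv
  obtain ⟨hk, ha, hlen, hs⟩ := hf.array_inv
  simp only [List.forall_mem_map, List.length_map] at ha hlen
  have hσ := SSub.Typed.instIdx (B := L.Base) hl hts
  have key : ∀ x ∈ fs, HasTy (γs.map .sort ++ []) [] x.2.1 (.arr τu ιu) := by
    intro x hx
    obtain ⟨τb, _, hb, he⟩ := (ha x hx).inv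
    obtain ⟨_, e, he⟩ := he.pi_inv
    injection e with e₁ e₂
    subst e₁ e₂
    exact hb.eqv he
  constructor
  · refine (HasTy.frame (τc := τu.subst (.instIdx is)) (ιc := ιu.subst
      (SSub.instIdx (B := L.Base) is).dim (SSub.instIdx (B := L.Base) is).shape) ?_ ?_
      (by simpa using hlen)
      (.trans (.arr (.refl _) (Shp.append_congr (Setoid.symm hs) (Setoid.refl _))) ht)).eqv hτ
    · cases hk with | pi hk => exact hk.subst hσ
    · simp only [List.forall_mem_map]
      exact fun x hx => (key x hx).subst (.of_nil hσ _)
  · intro x hx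
    rw [(key x hx).erase_subst (.of_nil hσ _), SSub.toE_instIdx, TSub.toE_id]

/-- The hypothesis on `ι` fixes the dimensions from the tag, so the result is typed even without
cells; if there are cells, each contributes `ns'.prod` atoms by its own typing. -/
theorem HasTy.step_collapse {ns ns' : List ℕ} {cells : List (List (Atom L) × L.Ty)} {τa : L.Ty}
    {ι : Shp} {τ' : L.Ty}
    (h : HasTy [] [] (.frame ns (cells.map fun c => .array ns' c.1 c.2) (.arr τa ι)) τ')
    (hι : ι ≈ lit (ns ++ ns')) :
    HasTy [] [] (.array (ns ++ ns') (cells.map Prod.fst).flatten (.arr τa ι)) τ' := by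
  obtain ⟨⟨τc, ιc, hk, hes, hl, ht⟩, hτ⟩ := h.inv
  simp only [List.forall_mem_map, List.length_map] at hes hl
  refine (HasTy.array (τa := τc) (by cases hk with | arr hk _ => exact hk) ?_ ?_
    (.arr (TEqv.arr_arr.1 ht).1 (Setoid.symm hι))).eqv hτ
  · simp only [List.mem_flatten, List.mem_map]
    rintro a ⟨_, ⟨c, hc, rfl⟩, ha⟩
    exact (hes c hc).array_inv.2.1 a ha
  · rw [List.length_flatten, List.map_map, List.map_congr_left (f := List.length ∘ Prod.fst)
      (g := fun _ => ns'.prod) fun c hc => (hes c hc).array_inv.2.2.1]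
    simp [hl]

theorem HasTy.step_unbox {k : ℕ} {ns : List ℕ} {boxes : List (List Idx × Expr L × L.Ty × L.Ty)}
    {b : Expr L} {τs τb τ τ' : L.Ty} (h : HasTy [] [] (.unbox k (.array ns
      (boxes.map fun x => .box x.1 x.2.1 x.2.2.1 x.2.2.2) τs) b τb τ) τ') :
    HasTy [] [] (.frame ns (boxes.map fun x => b.subst (.instIdx x.1) (.inst [x.2.1])) τ) τ' ∧
      (∀ x ∈ boxes, (b.subst (.instIdx x.1) (.inst [x.2.1])).erase
        = b.erase.subst (.inst (x.1.map Idx.toE)) (.inst [x.2.1.erase])) ∧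
      τ.erase = (lit ns).toE.append τb.erase := by
  obtain ⟨⟨γs, τs, τb', ιs, ιb, rfl, rfl, hs, hb, hk, ht⟩, hτ⟩ := h.inv
  obtain ⟨_, ha, hlen, hns⟩ := hs.array_inv
  simp only [List.forall_mem_map, List.length_map] at ha hlen
  have key : ∀ x ∈ boxes, IsSubst (γs.map .sort ++ []) (τs :: ([] : List L.Ty).map
      (Ty.shift γs.length)) [] [] (.instIdx x.1) (.inst [x.2.1]) ∧ x.1.length = γs.length := by
    intro x hx
    obtain ⟨γs', τb, _, hl, hs, _, he, _, ht⟩ := (ha x hx).inv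
    obtain ⟨_, e, ht⟩ := ht.sigma_inv
    injection e with e₁ e₂
    subst e₁ e₂
    refine ⟨.inst (.instIdx hl hs) rfl ?_, hl⟩
    simpa using he.eqv (ht.subst _)
  have ht' := TEqv.trans (.arr (.refl _)
    (Shp.append_congr (Setoid.symm hns) (Setoid.refl ιb))) ht
  refine ⟨(HasTy.frame hk ?_ (by simpa using hlen) ht').eqv hτ, ?_, ?_⟩
  · simp only [List.forall_mem_map]
    intro x hx
    have := hb.subst (key x hx).1
    -- The body's type is a weakening by as many variables as the box supplies indices, so
    -- instantiating those variables removes it.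
    have e : γs.length = (x.1.map (Idx.toSArg (B := L.Base))).length := by
      simp [(key x hx).2]
    rwa [e, SSub.instIdx, Ty.subst_inst_shift] at this
  · intro x hx
    rw [hb.erase_subst (key x hx).1, SSub.toE_instIdx, TSub.toE_inst]
    rfl
  · rw [← ht'.erase_eq]
    exact Shp.toE_eq_iff.2 (Setoid.symm (Shp.append_congr (Shp.out_toE _) (Shp.out_toE _)))

end

end Remora

-- The two simulations and the bisimulation.

namespace Remora

section
variable {L : Lang}

/-! ### Forward simulation and subject reduction -/

/-- The annotations depend on positions only, so one decomposition is valid for every expression put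
into the hole, before and after its step. -/
theorem eraseArgs_append_cons (vs : List (Expr L)) (ss : List EShp) (es : List (Expr L)) :
    ∃ vs' t es', vs'.map EArg.expr = vs.map Expr.erase ∧
      ∀ e : Expr L, Expr.eraseArgs (vs ++ e :: es) ss = vs' ++ .mk e.erase t :: es' := by
  induction vs generalizing ss with
  | nil => exact ⟨[], _, _, rfl, fun _ => rfl⟩
  | cons v vs ih =>
    obtain ⟨vs', t, es', h, h'⟩ := ih ss.tail
    exact ⟨.mk v.erase (ss.headD (lit []).toE) :: vs', t, es', by simp [h, EArg.expr],
      fun e => by simp [Expr.eraseArgs, h']⟩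

theorem forall₂_replace {α β : Type} {R : α → β → Prop} {vs es : List α} {a a' : α} {l : List β}
    (h : List.Forall₂ R (vs ++ a :: es) l) (ha : ∀ b, R a b → R a' b) :
    List.Forall₂ R (vs ++ a' :: es) l := by
  induction vs generalizing l with
  | nil => cases h with | cons h₁ h₂ => exact .cons (ha _ h₁) h₂
  | cons v vs ih => cases h with | cons h₁ h₂ => exact .cons h₁ (ih h₂)

theorem forall_mem_replace {α : Type} {p : α → Prop} {vs as : List α} {a a' : α}
    (h : ∀ x ∈ vs ++ a :: as, p x) (ha : p a') : ∀ x ∈ vs ++ a' :: as, p x := by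
  intro x hx
  simp only [List.mem_append, List.mem_cons] at hx h
  rcases hx with hx | rfl | hx
  · exact h x (.inl hx)
  · exact ha
  · exact h x (.inr (.inr hx))

theorem erase_frame_map {α β : Type} {F : α → Expr L} {G : β → EExpr L} (p : α → β) {l : List α}
    (h : ∀ x ∈ l, (F x).erase = G (p x)) (ns : List ℕ) (τ : L.Ty) :
    (Expr.frame ns (l.map F) τ).erase = .frame τ.erase ((l.map p).map G) := by
  simp only [Expr.erase, Expr.erases_eq_map, List.map_map]
  congr 1
  exact List.map_congr_left h

theorem erase_array_map {α β : Type} {F : α → Atom L} {G : β → EAtom L} (p : α → β) {l : List α}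
    (h : ∀ x ∈ l, (F x).erase = G (p x)) (ns : List ℕ) (τ : L.Ty) :
    (Expr.array ns (l.map F) τ).erase = .array ns ((l.map p).map G) := by
  simp only [Expr.erase, Atom.erases_eq_map, List.map_map]
  congr 1
  exact List.map_congr_left h

theorem erase_map_cells {nf : List ℕ} {fs : List (Atom L)} {args : List (ArgVal L)} {τo : L.Ty}
    {τ : L.Ty} :
    (Expr.frame nf ((List.range nf.prod).map fun j =>
        .app (.array [] (cell 1 fs j) (.arr (.fn (args.map ArgVal.inTy) τo) (lit [])))
          (args.map (ArgVal.cellExpr j)) τo) τ).erase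
      = .frame τ.erase ((List.range nf.prod).map fun j =>
        .app (.array [] (cell 1 (fs.map Atom.erase) j))
          ((args.map ArgVal.erase).map (EArgVal.cellArg j)) τo.erase) := by
  -- Erasure is unfolded at the frame only; the applications in the cells must stay folded for
  -- `erase_app_cell`.
  simp only [Expr.erase.eq_3, Expr.erases_eq_map, List.map_map]
  congr 1
  refine List.map_congr_left fun j _ => ?_
  rw [Function.comp_apply, erase_app_cell, map_cell, List.map_map]

/-- Subject reduction and simulation share one induction: in function position, the annotations of
the new erasure agree with the old ones because the stepped function has kept its type. -/
theorem HasTy.step {D : OpSem L} {e e' : Expr L} (hs : Step D e e') {τ : L.Ty}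
    (h : HasTy [] [] e τ) : HasTy [] [] e' τ ∧ EStep D e.erase e'.erase := by
  induction hs generalizing τ with
  | @lift nf np fs τs τo ιf args τ hfs hok hτs hp hne =>
    subst hτs
    refine ⟨h.step_lift hok hp, ?_⟩
    rw [erase_app_args, erase_app_lift, map_replicateCells]
    refine .lift ?_ ?_ (by rwa [map_erase_frame]) (by rwa [map_erase_frame])
    · simpa [Atom.isVal_erase] using hfs
    · simpa [ArgVal.ok_erase] using hok
  | @map nf fs τs τo ιf args τ hfs hok hτs hnf hf =>
    subst hτs
    obtain ⟨h₁, no, h₂, h₃⟩ := h.step_map hok hf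
    refine ⟨h₁, ?_⟩
    rw [erase_app_args]
    rw [erase_map_cells, h₂]
    refine .map ?_ ?_ hnf ?_ h₃
    · simpa [Atom.isVal_erase] using hfs
    · simpa [ArgVal.ok_erase] using hok
    · simpa [ArgVal.erase] using hf
  | beta hok hτs hf hl =>
    subst hτs
    obtain ⟨h₁, h₂⟩ := h.step_beta hok hf
    refine ⟨h₁, ?_⟩
    rw [erase_app_args, h₂]
    refine .beta ?_ ?_ (by simpa using hl)
    · simpa [ArgVal.ok_erase] using hok
    · simpa [ArgVal.erase] using hf
  | delta hok hτs hf hr =>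
    subst hτs
    obtain ⟨h₁, h₂⟩ := h.step_delta D hok hf
    refine ⟨h₁ _ hr, ?_⟩
    rw [erase_app_args]
    refine .delta ?_ ?_ (by rw [h₂, hr]; rfl)
    · simpa [ArgVal.ok_erase] using hok
    · simpa [ArgVal.erase] using hf
  | @tbeta ns fs τf ts τt hl =>
    obtain ⟨h₁, h₂⟩ := h.step_tbeta
    refine ⟨h₁, ?_⟩
    rw [erase_frame_map (fun x => (x.1.length, x.2.1.erase))
      (G := fun x => x.2.subst (.inst (ts.map fun t => .shape t.erase)) .id) h₂]
    simp only [Expr.erase.eq_5]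
    rw [erase_array_map (fun x => (x.1.length, x.2.1.erase))
      (G := fun x => EAtom.ilam x.1 x.2) fun _ _ => rfl]
    exact .ibeta (by simpa only [List.forall_mem_map, List.length_map] using hl)
  | @ibeta ns fs τf is τt hl =>
    obtain ⟨h₁, h₂⟩ := h.step_ibeta
    refine ⟨h₁, ?_⟩
    rw [erase_frame_map (fun x => (x.1.length, x.2.1.erase))
      (G := fun x => x.2.subst (.inst (is.map Idx.toE)) .id) h₂]
    simp only [Expr.erase.eq_6]
    rw [erase_array_map (fun x => (x.1.length, x.2.1.erase))
      (G := fun x => EAtom.ilam x.1 x.2) fun _ _ => rfl]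
    exact .ibeta (by simpa only [List.forall_mem_map, List.length_map] using hl)
  | @collapse ns ns' cells τa ι hv hι =>
    refine ⟨h.step_collapse hι, ?_⟩
    rw [erase_frame_map (fun c => c.1.map Atom.erase) (G := fun c => EExpr.array ns' c)
      fun _ _ => by simp [Expr.erase]]
    simp only [Expr.erase.eq_2, Atom.erases_eq_map, List.map_flatten]
    rw [List.map_map (f := Prod.fst)]
    refine .collapse ?_ (Shp.toE_eq_iff.2 hι)
    simpa only [List.forall_mem_map, Atom.isVal_erase] using hv
  | @unbox k ns boxes b τs τb τt hb =>
    obtain ⟨h₁, h₂, h₃⟩ := h.step_unbox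
    refine ⟨h₁, ?_⟩
    rw [erase_frame_map (fun x => (x.1.map Idx.toE, x.2.1.erase))
      (G := fun x => b.erase.subst (.inst x.1) (.inst [x.2])) h₂, h₃]
    simp only [Expr.erase.eq_7]
    rw [erase_array_map (fun x => (x.1.map Idx.toE, x.2.1.erase))
      (G := fun x => EAtom.box x.1 x.2) fun _ _ => rfl]
    exact .unbox (by simpa only [List.forall_mem_map, List.length_map, Expr.isVal_erase] using hb)
  | @inBox ns vs as is e e' τσ τx τ hv _ ih =>
    obtain ⟨⟨τa, hk, ha, hl, ht⟩, hτ⟩ := h.inv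
    obtain ⟨γs, τb, rfl, h₁, h₂, h₃, h₄, h₅, h₈⟩ :=
      (ha (.box is e τσ τx) (by simp)).inv
    obtain ⟨h₆, h₇⟩ := ih h₄
    constructor
    · refine (HasTy.array hk (forall_mem_replace ha ?_) (by simpa using hl) ht).eqv hτ
      -- The box is rebuilt at its own tag and then converted to the element type of the array; both
      -- are equivalent to the ascribed sum type.
      exact (AHasTy.box h₁ h₂ h₃ h₆ h₅).eqv (h₅.symm.trans h₈)
    · simp only [Expr.erase, Atom.erases_eq_map, List.map_append, List.map_cons, Atom.erase]
      exact .inBox (by simpa [Atom.isVal_erase] using hv) h₇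
  | inFrame hv _ ih =>
    obtain ⟨⟨τc, ιc, hk, hes, hl, ht⟩, hτ⟩ := h.inv
    obtain ⟨h₁, h₂⟩ := ih (hes _ (by simp))
    constructor
    · exact (HasTy.frame hk (forall_mem_replace hes h₁) (by simpa using hl) ht).eqv hτ
    · simp only [Expr.erase, Expr.erases_eq_map, List.map_append, List.map_cons]
      exact .inFrame (by simpa [Expr.isVal_erase] using hv) h₂
  | inFun _ ih =>
    obtain ⟨⟨ins, ιas, τo, ιf, ιo, ιp, hf, hl, hl', hes, hm, ht⟩, hτ⟩ := h.inv
    obtain ⟨h₁, h₂⟩ := ih hf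
    refine ⟨(HasTy.app h₁ hl hl' hes hm ht).eqv hτ, ?_⟩
    simp only [Expr.erase, hf.argShapes_tag, h₁.argShapes_tag]
    exact .inFun h₂
  | @inArg f vs es e e' τ hf hv _ ih =>
    obtain ⟨⟨ins, ιas, τo, ιf, ιo, ιp, hf', hl, hl', hes, hm, ht⟩, hτ⟩ := h.inv
    have h₂ := forall₂_of_zip
      (R := fun e (p : (L.Ty × Shp) × Shp) => HasTy [] [] e (.arr p.1.1 (.app [p.2, p.1.2])))
      (by simp [hl, hl']) hes
    have h₃ := forall₂_replace h₂ (a' := e') fun _ h => (ih h).1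
    constructor
    · exact (HasTy.app hf' (by simpa using hl) hl'
        (fun p hp => (List.forall₂_iff_zip.1 h₃).2 hp) hm ht).eqv hτ
    · obtain ⟨vs', t, es', h₄, h₅⟩ := eraseArgs_append_cons vs (argShapes f.tag) es
      simp only [Expr.erase, h₅]
      refine .inArg ((Expr.isVal_erase f).2 hf) ?_ ?_
      · have : ∀ v ∈ vs'.map EArg.expr, v.IsVal := by
          rw [h₄]; simpa [Expr.isVal_erase] using hv
        simpa using this
      · obtain ⟨p, hp⟩ := exists_of_length_eq_zip (l := ins.zip ιas) (l' := vs ++ e :: es)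
          (by simp [hl, hl']) (b := e) (by simp)
        have hp' : (e, p) ∈ (vs ++ e :: es).zip (ins.zip ιas) := by
          rw [← List.zip_swap]; exact List.mem_map.2 ⟨_, hp, rfl⟩
        exact (ih (hes _ hp')).2
  | inTApp _ ih =>
    obtain ⟨⟨ks, τu, ιu, ιf, hf, hl, hts, ht⟩, hτ⟩ := h.inv
    exact ⟨(HasTy.tapp (ih hf).1 hl hts ht).eqv hτ, .inIApp (ih hf).2⟩
  | inIApp _ ih =>
    obtain ⟨⟨ks, τu, ιu, ιf, hf, hl, hts, ht⟩, hτ⟩ := h.inv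
    exact ⟨(HasTy.iapp (ih hf).1 hl hts ht).eqv hτ, .inIApp (ih hf).2⟩
  | inUnbox _ ih =>
    obtain ⟨⟨γs, τs, τb', ιs, ιb, rfl, rfl, hs, hb, hk, ht⟩, hτ⟩ := h.inv
    exact ⟨(HasTy.unbox (ih hs).1 hb hk ht).eqv hτ, .inUnbox (ih hs).2⟩

/-! ### Backward simulation -/

theorem erase_eq_array {e : Expr L} {ns : List ℕ} {as' : List (EAtom L)}
    (h : e.erase = .array ns as') : ∃ as τ, e = .array ns as τ ∧ as.map Atom.erase = as' := by
  cases e <;> simp [Expr.erase] at h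
  exact ⟨_, _, by rw [h.1], h.2⟩

theorem erase_eq_frame {e : Expr L} {s : EShp} {es' : List (EExpr L)}
    (h : e.erase = .frame s es') :
    ∃ ns es τ, e = .frame ns es τ ∧ es.map Expr.erase = es' ∧ τ.erase = s := by
  cases e <;> simp [Expr.erase] at h
  exact ⟨_, _, _, rfl, h.2, h.1⟩

theorem erase_eq_app {e : Expr L} {f' : EExpr L} {es' : List (EArg L)} {s : EShp}
    (h : e.erase = .app f' es' s) : ∃ f es τ, e = .app f es τ ∧ f.erase = f' ∧
      Expr.eraseArgs es (argShapes f.tag) = es' ∧ τ.erase = s := by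
  cases e <;> simp [Expr.erase] at h
  exact ⟨_, _, _, rfl, h⟩

theorem erase_eq_iapp {e : Expr L} {f' : EExpr L} {is' : List EIdx} {s : EShp}
    (h : e.erase = .iapp f' is' s) :
    (∃ f ts τ, e = .tapp f ts τ ∧ f.erase = f' ∧ ts.map (fun t => .shape t.erase) = is' ∧
      τ.erase = s) ∨
    ∃ f is τ, e = .iapp f is τ ∧ f.erase = f' ∧ is.map Idx.toE = is' ∧ τ.erase = s := by
  cases e <;> simp [Expr.erase] at h
  · exact .inl ⟨_, _, _, rfl, h⟩
  · exact .inr ⟨_, _, _, rfl, h⟩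

theorem erase_eq_unbox {e : Expr L} {k : ℕ} {e' b' : EExpr L} {s : EShp}
    (h : e.erase = .unbox k e' b' s) :
    ∃ e₀ b τb τ, e = .unbox k e₀ b τb τ ∧ e₀.erase = e' ∧ b.erase = b' ∧ τb.erase = s := by
  cases e <;> simp [Expr.erase] at h
  exact ⟨_, _, _, _, by rw [h.1], h.2⟩

theorem erase_eq_box {a : Atom L} {is' : List EIdx} {e' : EExpr L} (h : a.erase = .box is' e') :
    ∃ is e τσ τ, a = .box is e τσ τ ∧ is.map Idx.toE = is' ∧ e.erase = e' := by
  cases a <;> simp [Atom.erase] at h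
  exact ⟨_, _, _, _, rfl, h⟩

/-- The explicit argument values take frame and cell dimensions from the erased ones, atoms and tag
from the explicit literals, and element type and shape from the function's tag. -/
theorem exists_args {es : List (Expr L)} {τs : List L.Ty} {eargs : List (EArgVal L)}
    (hl : τs.length = es.length) (ha : ∀ t ∈ τs, ∃ u s, t = Ty.arr u s)
    (h : Expr.eraseArgs es (τs.map Ty.erase) = eargs.map EArgVal.arg) :
    ∃ args : List (ArgVal L), es = args.map ArgVal.expr ∧ τs = args.map ArgVal.inTy ∧
      args.map ArgVal.erase = eargs := by
  induction es generalizing τs eargs with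
  | nil =>
    cases τs with
    | cons => simp at hl
    | nil =>
      cases eargs with
      | cons => simp [Expr.eraseArgs] at h
      | nil => exact ⟨[], rfl, rfl, rfl⟩
  | cons e es ih =>
    cases τs with
    | nil => simp at hl
    | cons t τs =>
      cases eargs with
      | nil => simp [Expr.eraseArgs] at h
      | cons a eargs =>
        simp only [Expr.eraseArgs, List.map_cons, List.headD_cons, List.tail_cons,
          List.cons.injEq, EArgVal.arg, EArg.mk.injEq] at h
        obtain ⟨⟨h₁, h₂⟩, h₃⟩ := h
        obtain ⟨args, rfl, rfl, rfl⟩ := ih (by simpa using hl)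
          (fun t ht => ha t (List.mem_cons_of_mem _ ht)) h₃
        obtain ⟨u, s, rfl⟩ := ha t List.mem_cons_self
        obtain ⟨as, τ, rfl, h₄⟩ := erase_eq_array h₁
        refine ⟨⟨a.frame, a.cellDims, as, τ, u, s⟩ :: args, rfl, rfl, ?_⟩
        have h₂ : s.toE = a.shape := h₂
        rw [List.map_cons, ArgVal.erase, h₄, h₂]

/-- An erased redex only shows literals and annotations. The explicit rules moreover ask for a tag
that is syntactically a function type with array inputs; typing gives such a type up to equivalence,
and equivalence preserves these constructors. -/
theorem exists_app {e : Expr L} {τ' : L.Ty} {nf : List ℕ} {fs' : List (EAtom L)}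
    {eargs : List (EArgVal L)} {s : EShp} (ht : HasTy [] [] e τ')
    (h : e.erase = .app (.array nf fs') (eargs.map EArgVal.arg) s) :
    ∃ (fs : List (Atom L)) (args : List (ArgVal L)) (τo : L.Ty) (ιf : Shp) (τ : L.Ty),
      e = .app (.array nf fs (.arr (.fn (args.map ArgVal.inTy) τo) ιf)) (args.map ArgVal.expr) τ ∧
      fs.map Atom.erase = fs' ∧ args.map ArgVal.erase = eargs ∧ τ.erase = s := by
  obtain ⟨f, es, τ, rfl, hf, hes, hs⟩ := erase_eq_app h
  obtain ⟨fs, τf, rfl, hfs⟩ := erase_eq_array hf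
  obtain ⟨⟨ins, ιas, τo, ιf, ιo, ιp, hf', hl, -⟩, -⟩ := ht.inv
  obtain ⟨t, ιf', e, h₁, -⟩ := hf'.inv.2.symm.arr_inv
  obtain ⟨τs, τo', rfl, h₂, -⟩ := h₁.fn_inv
  simp only [Expr.tag] at e
  subst e
  have harr : ∀ t ∈ τs, ∃ u s, t = Ty.arr u s := by
    refine forall₂_transfer (P := fun t => ∃ u s, t = Ty.arr u s) (h₂.imp ?_)
      (List.forall_mem_map.2 fun p _ => ⟨_, _, rfl⟩)
    rintro _ b h ⟨u, s, rfl⟩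
    obtain ⟨_, _, e, -⟩ := h.arr_inv
    exact ⟨_, _, e⟩
  obtain ⟨args, rfl, rfl, rfl⟩ := exists_args (τs := τs)
    (by rw [← h₂.length_eq, List.length_map, hl]) harr hes
  exact ⟨fs, args, τo', ιf', τ, rfl, hfs, rfl, hs⟩

/-- The reverse of `eraseArgs_append_cons`: a hole in an erased argument list comes from a hole in
the explicit one, and refilling it changes nothing else. -/
theorem exists_eraseArgs {es : List (Expr L)} {ss : List EShp} {vs' es' : List (EArg L)}
    {e' : EExpr L} {t : EShp} (h : Expr.eraseArgs es ss = vs' ++ .mk e' t :: es') :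
    ∃ vs e es₁, es = vs ++ e :: es₁ ∧ e.erase = e' ∧ vs.map Expr.erase = vs'.map EArg.expr ∧
      ∀ e₁ : Expr L, Expr.eraseArgs (vs ++ e₁ :: es₁) ss = vs' ++ .mk e₁.erase t :: es' := by
  induction vs' generalizing es ss with
  | nil =>
    cases es with
    | nil => simp [Expr.eraseArgs] at h
    | cons e es =>
      simp only [Expr.eraseArgs, List.nil_append, List.cons.injEq, EArg.mk.injEq] at h
      exact ⟨[], e, es, rfl, h.1.1, rfl, fun e₁ => by
        simp only [List.nil_append, Expr.eraseArgs, h.1.2, h.2]⟩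
  | cons v vs' ih =>
    cases es with
    | nil => simp [Expr.eraseArgs] at h
    | cons e es =>
      simp only [Expr.eraseArgs, List.cons_append, List.cons.injEq] at h
      obtain ⟨vs, e₀, es₁, rfl, h₁, h₂, h₃⟩ := ih h.2
      exact ⟨e :: vs, e₀, es₁, rfl, h₁, by simp [h₂, ← h.1, EArg.expr],
        fun e₁ => by simp only [List.cons_append, Expr.eraseArgs, h₃, h.1]⟩

theorem exists_map_eq {α β : Type} {f : α → β} {l : List β} (h : ∀ b ∈ l, ∃ a, b = f a) :
    ∃ l₀ : List α, l = l₀.map f := by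
  induction l with
  | nil => exact ⟨[], rfl⟩
  | cons b l ih =>
    obtain ⟨a, rfl⟩ := h b List.mem_cons_self
    obtain ⟨l₀, rfl⟩ := ih fun b hb => h b (List.mem_cons_of_mem _ hb)
    exact ⟨a :: l₀, rfl⟩

/-- The explicit step erases to exactly the given target, not merely to some successor. In each case
the redex is reconstructed from the erasure, and typing supplies the side conditions that erasure
has dropped. -/
theorem EStep.reflect {D : OpSem L} {w w' : EExpr L} (hs : EStep D w w') {e : Expr L} {τ' : L.Ty}
    (ht : HasTy [] [] e τ') (he : e.erase = w) : ∃ e', Step D e e' ∧ e'.erase = w' := by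
  induction hs generalizing e τ' with
  | @lift nf np fs' eargs s hfs hok hp hne =>
    obtain ⟨fs, args, τo, ιf, τ, rfl, rfl, rfl, rfl⟩ := exists_app ht he
    rw [map_erase_frame] at hp hne
    refine ⟨_, .lift ?_ ?_ rfl hp hne, ?_⟩
    · simpa [Atom.isVal_erase] using hfs
    · simpa [ArgVal.ok_erase] using hok
    · rw [erase_app_lift, map_replicateCells]
  | @map nf no fs' eargs s hfs hok hnf hf hs =>
    obtain ⟨fs, args, τo, ιf, τ, rfl, rfl, rfl, rfl⟩ := exists_app ht he
    have hok : ∀ a ∈ args, a.Ok := by simpa [ArgVal.ok_erase] using hok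
    have hf : ∀ a ∈ args, a.frame = nf := by simpa [ArgVal.erase] using hf
    obtain ⟨-, no', h₂, h₃⟩ := ht.step_map hok hf
    -- The erased rule only knows that the result shape is `nf ++ no`; cancelling `nf` identifies
    -- `no` with the cell dimensions found from the type.
    have : no = no' := List.append_cancel_left (lit_injective (Shp.toE_eq_iff.1 (hs.symm.trans h₃)))
    subst this
    refine ⟨_, .map (by simpa [Atom.isVal_erase] using hfs) hok rfl hnf hf, ?_⟩
    rw [erase_map_cells, h₂]
  | @beta n e' eargs s hok hf hl =>
    obtain ⟨fs, args, τo, ιf, τ, rfl, hfs, rfl, rfl⟩ := exists_app ht he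
    have hok : ∀ a ∈ args, a.Ok := by simpa [ArgVal.ok_erase] using hok
    have hf : ∀ a ∈ args, a.frame = [] := by simpa [ArgVal.erase] using hf
    obtain ⟨a, rfl, ha⟩ := List.map_eq_singleton_iff.1 hfs
    cases a <;> simp [Atom.erase] at ha
    obtain ⟨rfl, rfl⟩ := ha
    exact ⟨_, .beta hok rfl hf (by simpa using hl), (ht.step_beta hok hf).2⟩
  | @delta o eargs s r hok hf hr =>
    obtain ⟨fs, args, τo, ιf, τ, rfl, hfs, rfl, rfl⟩ := exists_app ht he
    have hok : ∀ a ∈ args, a.Ok := by simpa [ArgVal.ok_erase] using hok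
    have hf : ∀ a ∈ args, a.frame = [] := by simpa [ArgVal.erase] using hf
    obtain ⟨a, rfl, ha⟩ := List.map_eq_singleton_iff.1 hfs
    cases a <;> simp [Atom.erase] at ha
    subst ha
    rw [(ht.step_delta D hok hf).2, Option.map_eq_some_iff] at hr
    obtain ⟨r, hr, rfl⟩ := hr
    exact ⟨_, .delta hok rfl hf hr, rfl⟩
  | @ibeta ns fs' is' s hl =>
    rcases erase_eq_iapp he with ⟨f, ts, τ, rfl, hf, rfl, rfl⟩ | ⟨f, is, τ, rfl, hf, rfl, rfl⟩
    · obtain ⟨as, τf, rfl, has⟩ := erase_eq_array hf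
      obtain ⟨⟨ks, τu, ιu, ιf, hf, -⟩, -⟩ := ht.inv
      have hty := hf.array_inv.2.1
      obtain ⟨fs, rfl⟩ : ∃ fs : List (List Kind × Expr L × L.Ty),
          as = fs.map fun x => .tlam x.1 x.2.1 x.2.2 := by
        refine exists_map_eq fun a ha => ?_
        have h₁ : a.erase ∈ fs'.map fun x => EAtom.ilam x.1 x.2 := has ▸ List.mem_map_of_mem ha
        obtain ⟨x, -, hx⟩ := List.mem_map.1 h₁
        have h₂ := (hty a ha).inv
        cases a <;> simp [Atom.erase] at hx
        · exact ⟨(_, _, _), rfl⟩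
        -- An index abstraction erases to the same atom, but its type would have to be both a
        -- product and a universal type.
        · obtain ⟨_, -, -, h⟩ := h₂
          obtain ⟨_, h, -⟩ := h.pi_inv
          cases h
      obtain rfl : fs.map (fun x => (x.1.length, x.2.1.erase)) = fs' := by
        refine List.map_injective_iff.2
          (?_ : (fun x : ℕ × EExpr L => EAtom.ilam x.1 x.2).Injective) ?_
        · rintro ⟨_, _⟩ ⟨_, _⟩ h; simpa using h
        · rw [← has]; simp [Atom.erase]
      exact ⟨_, .tbeta (by simpa only [List.forall_mem_map, List.length_map] using hl),
        erase_frame_map _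
          (G := fun x : ℕ × EExpr L => x.2.subst (.inst (ts.map fun t => .shape t.erase)) .id)
          ht.step_tbeta.2 _ _⟩
    · obtain ⟨as, τf, rfl, has⟩ := erase_eq_array hf
      obtain ⟨⟨γs, τu, ιu, ιf, hf, -⟩, -⟩ := ht.inv
      have hty := hf.array_inv.2.1
      obtain ⟨fs, rfl⟩ : ∃ fs : List (List IxSort × Expr L × L.Ty),
          as = fs.map fun x => .ilam x.1 x.2.1 x.2.2 := by
        refine exists_map_eq fun a ha => ?_
        have h₁ : a.erase ∈ fs'.map fun x => EAtom.ilam x.1 x.2 := has ▸ List.mem_map_of_mem ha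
        obtain ⟨x, -, hx⟩ := List.mem_map.1 h₁
        have h₂ := (hty a ha).inv
        cases a <;> simp [Atom.erase] at hx
        · obtain ⟨_, -, -, h⟩ := h₂
          obtain ⟨_, h, -⟩ := h.univ_inv
          cases h
        · exact ⟨(_, _, _), rfl⟩
      obtain rfl : fs.map (fun x => (x.1.length, x.2.1.erase)) = fs' := by
        refine List.map_injective_iff.2
          (?_ : (fun x : ℕ × EExpr L => EAtom.ilam x.1 x.2).Injective) ?_
        · rintro ⟨_, _⟩ ⟨_, _⟩ h; simpa using h
        · rw [← has]; simp [Atom.erase]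
      exact ⟨_, .ibeta (by simpa only [List.forall_mem_map, List.length_map] using hl),
        erase_frame_map _ (G := fun x : ℕ × EExpr L => x.2.subst (.inst (is.map Idx.toE)) .id)
          ht.step_ibeta.2 _ _⟩
  | @collapse ns ns' cells' s hv hs =>
    obtain ⟨ns₀, es, τ, rfl, hes, rfl⟩ := erase_eq_frame he
    obtain ⟨⟨τc, ιc, hk, hty, -, hτ⟩, -⟩ := ht.inv
    -- The explicit step uses the frame dimensions `ns₀` of the term and the cell dimensions `ns₁`
    -- of its closed cell type. If there are no cells, the erased rule may split the same shape
    -- differently, as `ns ++ ns'`.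
    obtain ⟨ns₁, hns₁⟩ : ∃ ns₁, ιc ≈ lit ns₁ := by
      cases hk with | arr _ h => exact h.exists_lit
    obtain ⟨τa, ι, rfl, -, hι⟩ := hτ.arr_inv
    have hι' : ι ≈ lit (ns₀ ++ ns₁) := Setoid.trans (Setoid.symm hι)
      (Setoid.trans (Shp.append_congr (Setoid.refl _) hns₁) (lit_append _ _))
    -- Only the concatenation occurs in the collapsed array, so agreement here is enough.
    have hns : ns₀ ++ ns₁ = ns ++ ns' :=
      lit_injective (Setoid.trans (Setoid.symm hι') (Shp.toE_eq_iff.1 hs))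
    obtain ⟨cells, rfl⟩ : ∃ cells : List (List (Atom L) × L.Ty),
        es = cells.map fun c => .array ns₁ c.1 c.2 := by
      refine exists_map_eq fun e he => ?_
      have h₁ : e.erase ∈ cells'.map fun c => EExpr.array ns' c := hes ▸ List.mem_map_of_mem he
      obtain ⟨c, -, hc⟩ := List.mem_map.1 h₁
      obtain ⟨as, τe, rfl, -⟩ := erase_eq_array hc.symm
      have := lit_injective (Setoid.trans (Setoid.symm (hty _ he).array_inv.2.2.2) hns₁)
      exact ⟨(as, τe), by rw [this]⟩
    obtain rfl : cells.map (fun c => c.1.map Atom.erase) = cells' := by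
      -- Projecting to the atoms discards the cell dimensions, which need not agree when the list of
      -- cells is empty.
      have := congrArg (List.map fun e : EExpr L => match e with
        | .array _ as => as
        | _ => []) hes
      simpa [Function.comp_def, Expr.erase] using this
    refine ⟨_, .collapse ?_ hι', ?_⟩
    · simpa only [List.forall_mem_map, Atom.isVal_erase] using hv
    · simp [Expr.erase, List.map_flatten, Function.comp_def, hns]
  | @unbox k ns boxes' b' s hb =>
    obtain ⟨e₀, b, τb, τ, rfl, h₀, rfl, rfl⟩ := erase_eq_unbox he
    obtain ⟨as, τs, rfl, has⟩ := erase_eq_array h₀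
    obtain ⟨boxes, rfl⟩ : ∃ boxes : List (List Idx × Expr L × L.Ty × L.Ty),
        as = boxes.map fun x => .box x.1 x.2.1 x.2.2.1 x.2.2.2 := by
      refine exists_map_eq fun a ha => ?_
      have h₁ : a.erase ∈ boxes'.map fun x => EAtom.box x.1 x.2 := has ▸ List.mem_map_of_mem ha
      obtain ⟨x, -, hx⟩ := List.mem_map.1 h₁
      obtain ⟨is, e, τσ, τx, rfl, -⟩ := erase_eq_box hx.symm
      exact ⟨(is, e, τσ, τx), rfl⟩
    obtain rfl : boxes.map (fun x => (x.1.map Idx.toE, x.2.1.erase)) = boxes' := by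
      refine List.map_injective_iff.2
        (?_ : (fun x : List EIdx × EExpr L => EAtom.box x.1 x.2).Injective) ?_
      · rintro ⟨_, _⟩ ⟨_, _⟩ h; simpa using h
      · rw [← has]; simp [Atom.erase]
    obtain ⟨-, h₂, h₃⟩ := ht.step_unbox
    refine ⟨_, .unbox (by
      simpa only [List.forall_mem_map, List.length_map, Expr.isVal_erase] using hb), ?_⟩
    rw [erase_frame_map (fun x => (x.1.map Idx.toE, x.2.1.erase))
      (G := fun x : List EIdx × EExpr L => b.erase.subst (.inst x.1) (.inst [x.2])) h₂, h₃]
  | @inBox ns vs' as' is' e₁ e₂ hv _ ih =>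
    obtain ⟨as, τ, rfl, has⟩ := erase_eq_array he
    obtain ⟨vs, as₁, rfl, rfl, h₁⟩ := List.map_eq_append_iff.1 has
    obtain ⟨a, as₂, rfl, h₂, rfl⟩ := List.map_eq_cons_iff.1 h₁
    obtain ⟨is, e₀, τσ, τx, rfl, rfl, rfl⟩ := erase_eq_box h₂
    obtain ⟨⟨τa, -, ha, -⟩, -⟩ := ht.inv
    obtain ⟨_, _, -, -, -, -, h₃, -⟩ := (ha (.box is e₀ τσ τx) (by simp)).inv
    obtain ⟨e', h₄, rfl⟩ := ih h₃ rfl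
    exact ⟨_, .inBox (by simpa [Atom.isVal_erase] using hv) h₄, by simp [Expr.erase, Atom.erase]⟩
  | @inFrame vs' es' e₁ e₂ s hv _ ih =>
    obtain ⟨ns, es, τ, rfl, hes, rfl⟩ := erase_eq_frame he
    obtain ⟨vs, es₁, rfl, rfl, h₁⟩ := List.map_eq_append_iff.1 hes
    obtain ⟨e₀, es₂, rfl, rfl, rfl⟩ := List.map_eq_cons_iff.1 h₁
    obtain ⟨⟨τc, ιc, -, hty, -⟩, -⟩ := ht.inv
    obtain ⟨e', h₄, rfl⟩ := ih (hty e₀ (by simp)) rfl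
    exact ⟨_, .inFrame (by simpa [Expr.isVal_erase] using hv) h₄, by simp [Expr.erase]⟩
  | inFun _ ih =>
    obtain ⟨f, es, τ, rfl, rfl, rfl, rfl⟩ := erase_eq_app he
    obtain ⟨⟨ins, ιas, τo, ιf, ιo, ιp, hf, -⟩, -⟩ := ht.inv
    obtain ⟨f', h₁, rfl⟩ := ih hf rfl
    refine ⟨_, .inFun h₁, ?_⟩
    -- By subject reduction `f'` has the type of `f`, so both tags yield the same annotations.
    simp only [Expr.erase, hf.argShapes_tag, (hf.step h₁).1.argShapes_tag]
  | inArg hf' hv _ ih =>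
    obtain ⟨f, es, τ, rfl, rfl, hes, rfl⟩ := erase_eq_app he
    obtain ⟨vs, e₀, es₁, rfl, rfl, h₁, h₂⟩ := exists_eraseArgs hes
    obtain ⟨⟨ins, ιas, τo, ιf, ιo, ιp, hf, hl, hl', hty, -⟩, -⟩ := ht.inv
    obtain ⟨p, hp⟩ := exists_of_length_eq_zip (l := ins.zip ιas) (l' := vs ++ e₀ :: es₁)
      (by simp [hl, hl']) (b := e₀) (by simp)
    have hp' : (e₀, p) ∈ (vs ++ e₀ :: es₁).zip (ins.zip ιas) := by
      rw [← List.zip_swap]; exact List.mem_map.2 ⟨_, hp, rfl⟩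
    obtain ⟨e', h₃, rfl⟩ := ih (hty _ hp') rfl
    refine ⟨_, .inArg ((Expr.isVal_erase f).1 hf') ?_ h₃, ?_⟩
    · have : ∀ v ∈ vs.map Expr.erase, v.IsVal := by rw [h₁]; simpa using hv
      simpa [Expr.isVal_erase] using this
    · simp [Expr.erase, h₂]
  | inIApp _ ih =>
    rcases erase_eq_iapp he with ⟨f, ts, τ, rfl, rfl, rfl, rfl⟩ | ⟨f, is, τ, rfl, rfl, rfl, rfl⟩
    · obtain ⟨⟨_, _, _, _, hf, -⟩, -⟩ := ht.inv
      obtain ⟨f', h₁, rfl⟩ := ih hf rfl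
      exact ⟨_, .inTApp h₁, rfl⟩
    · obtain ⟨⟨_, _, _, _, hf, -⟩, -⟩ := ht.inv
      obtain ⟨f', h₁, rfl⟩ := ih hf rfl
      exact ⟨_, .inIApp h₁, rfl⟩
  | inUnbox _ ih =>
    obtain ⟨e₀, b, τb, τ, rfl, rfl, rfl, rfl⟩ := erase_eq_unbox he
    obtain ⟨⟨_, _, _, _, _, -, -, hs, -⟩, -⟩ := ht.inv
    obtain ⟨e', h₁, rfl⟩ := ih hs rfl
    exact ⟨_, .inUnbox h₁, rfl⟩

/-! ### Erasure equivalence is a bisimulation -/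

/-- The erasure of an explicit state; an erased state itself. -/
def State.erased (s : State L) : EExpr L :=
  match s.1 with
  | .inl e => e.erase
  | .inr w => w

theorem ErasureEquiv.erased_eq {s w : State L} (h : ErasureEquiv s w) : s.erased = w.erased := by
  induction h with
  | rel s w h => obtain ⟨e, h₁, h₂⟩ := h; simp [State.erased, h₁, h₂]
  | refl => rfl
  | symm _ _ _ ih => exact ih.symm
  | trans _ _ _ _ _ ih₁ ih₂ => exact ih₁.trans ih₂

theorem State.exists_typed (s : State L) : ∃ e : Expr L, WellTyped e ∧ e.erase = s.erased := by
  obtain ⟨e | w, h⟩ := s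
  · exact ⟨e, h, rfl⟩
  · exact h

/-- The erased state of a state. -/
def State.toErased (s : State L) : State L := ⟨.inr s.erased, s.exists_typed⟩

theorem State.equiv_toErased (s : State L) : ErasureEquiv s s.toErased := by
  obtain ⟨e | w, h⟩ := s
  · exact .rel _ _ ⟨e, rfl, rfl⟩
  · exact .refl _

/-- Erasing preserves the class of a state, and every class contains the common erasure of its
members as a state, so that erasure is a complete invariant. -/
theorem erasureEquiv_iff {s w : State L} : ErasureEquiv s w ↔ s.erased = w.erased := by
  refine ⟨ErasureEquiv.erased_eq, fun h => ?_⟩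
  refine .trans _ _ _ s.equiv_toErased (.symm _ _ ?_)
  have : s.toErased = w.toErased := Subtype.ext (congrArg Sum.inr h)
  rw [this]
  exact w.equiv_toErased

/-- Transitions stay among the states: by subject reduction for an explicit state, and for an erased
one by reflecting the step to a typed expression whose successor erases to the target. -/
theorem State.trans_erased {D : OpSem L} {s : State L} {x : Expr L ⊕ EExpr L}
    (h : Trans D s.1 x) : ∃ u : State L, u.1 = x ∧ EStep D s.erased u.erased := by
  obtain ⟨e | w, hs⟩ := s
  · cases h with
    | explicit h =>
      obtain ⟨τ, hs⟩ := hs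
      exact ⟨⟨.inl _, τ, (hs.step h).1⟩, rfl, (hs.step h).2⟩
  · cases h with
    | erased h =>
      obtain ⟨e, ⟨τ, hs⟩, rfl⟩ := hs
      obtain ⟨e', h', rfl⟩ := h.reflect hs rfl
      exact ⟨⟨.inr _, e', ⟨τ, (hs.step h').1⟩, rfl⟩, rfl, h⟩

theorem State.exists_trans {D : OpSem L} {s : State L} {w' : EExpr L}
    (h : EStep D s.erased w') : ∃ v : State L, Trans D s.1 v.1 ∧ v.erased = w' := by
  obtain ⟨e | w, hs⟩ := s
  · obtain ⟨τ, hs⟩ := hs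
    obtain ⟨e', h', rfl⟩ := h.reflect hs rfl
    exact ⟨⟨.inl e', τ, (hs.step h').1⟩, .explicit h', rfl⟩
  · obtain ⟨u, hu, -⟩ := State.trans_erased (s := ⟨.inr w, hs⟩) (Trans.erased h)
    refine ⟨u, ?_, ?_⟩
    · rw [hu]; exact .erased h
    · simp [State.erased, hu]

theorem ErasureEquiv.simulate {D : OpSem L} {s w : State L} (h : ErasureEquiv s w)
    {x : Expr L ⊕ EExpr L} (hx : Trans D s.1 x) :
    ∃ u v : State L, u.1 = x ∧ Trans D w.1 v.1 ∧ ErasureEquiv u v := by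
  obtain ⟨u, hu, h'⟩ := State.trans_erased hx
  rw [h.erased_eq] at h'
  obtain ⟨v, hv, e⟩ := State.exists_trans h'
  exact ⟨u, v, hu, hv, erasureEquiv_iff.2 e.symm⟩

end

end Remora

-- The bisimulation theorem.

theorem mainTheorem4 (L : Remora.Lang) (D : Remora.OpSem L) (s w : Remora.State L)
    (h : Remora.ErasureEquiv s w) :
    ((∃ u v : Remora.State L, Remora.Trans D s.1 u.1 ∧ Remora.Trans D w.1 v.1 ∧
        Remora.ErasureEquiv u v) ∨
      (Remora.Stuck D s ∧ Remora.Stuck D w)) ∧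
    (∀ x, Remora.Trans D s.1 x → ∃ u v : Remora.State L, u.1 = x ∧
        Remora.Trans D w.1 v.1 ∧ Remora.ErasureEquiv u v) ∧
    (∀ y, Remora.Trans D w.1 y → ∃ u v : Remora.State L, v.1 = y ∧
        Remora.Trans D s.1 u.1 ∧ Remora.ErasureEquiv u v) := by
  have h₁ := fun x hx => h.simulate (D := D) (x := x) hx
  refine ⟨?_, h₁, fun y hy => ?_⟩
  -- If `s` has no transition, then neither has `w`, since a transition of `w` would be simulated by
  -- one of `s`.
  · by_cases hs : Remora.Stuck D s
    · refine .inr ⟨hs, fun y hy => ?_⟩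
      obtain ⟨_, v, -, hv, -⟩ := Remora.ErasureEquiv.simulate (D := D) (.symm _ _ h) hy
      exact hs _ hv
    · simp only [Remora.Stuck, not_forall, not_not] at hs
      obtain ⟨x, hx⟩ := hs
      obtain ⟨u, v, rfl, hv, e⟩ := h₁ x hx
      exact .inl ⟨u, v, hx, hv, e⟩
  · obtain ⟨v, u, e, hu, huv⟩ := Remora.ErasureEquiv.simulate (D := D) (.symm _ _ h) hy
    exact ⟨u, v, e, hu, .symm _ _ huv⟩
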